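/- Let $\ell(x)$ denote the length of $x\in\mathbb N$ in binary ($\ell(0)=0$), let $\mathsf{sg}(z)=1$ if $z>0$ and $\mathsf{sg}(z)=0$ otherwise ($z\in\mathbb Z$), and let $\mathbf{FAC}^0$ be the class of functions $\mathbb N^k\to\mathbb N$ (numbers in binary) computed by $\mathbf{Dlogtime}$-uniform families of Boolean circuits of polynomial size and constant depth with unbounded fan-in $\wedge$, $\vee$ and with $\neg$ gates; $\mathbf{Dlogtime}$-uniform means that a Turing machine with a random access tape, given $1^n$, decides the direct connection language of the $n$-th circuit in time $O(\log n)$. A limited $\mathsf{sg}$-polynomial expression is an expression built from variables and integer constants by $+$, $-$, $\div 2$ (where $z\div 2=\lfloor z/2\rfloor$) and $\mathsf{sg}$. Let $p\in\mathbb N$, let $g:\mathbb N^p\to\mathbb N$ and $h:\mathbb N^{p+1}\to\mathbb N$ be in $\mathbf{FAC}^0$, and let $K(x,\mathbf y,h(x,\mathbf y),f(x,\mathbf y))$ be a limited $\mathsf{sg}$-polynomial expression in which $f(x,\mathbf y)$ occurs only in subexpressions of the form $\mathsf{sg}(f(x,\mathbf y))$ or, more generally, $\mathsf{sg}(f(x,\mathbf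 y)-c)$ with constants $c\in\mathbb N$. Consider the initial value problem $$f(0,\mathbf y)=g(\mathbf y),\qquad \frac{\partial f(x,\mathbf y)}{\partial \ell}=\big(K(x,\mathbf y,h(x,\mathbf y),f(x,\mathbf y))-1\big)\times f(x,\mathbf y),$$ where the second equation stands for $$f(x+1,\mathbf y)=f(x,\mathbf y)+\big(\ell(x+1)-\ell(x)\big)\times\big(K(x,\mathbf y,h(x,\mathbf y),f(x,\mathbf y))-1\big)\times f(x,\mathbf y).$$ Then it has exactly one solution $f:\mathbb N^{p+1}\to\mathbb Z$. If moreover $K(x,\mathbf y,h(x,\mathbf y),f(x,\mathbf y))\in\{0,1\}$ for all $x,\mathbf y$, then: 1. (bounded search) for all $x,\mathbf y$, $f(x,\mathbf y)=0$ if there is $u<\ell(x)$ with $K\big(2^u-1,\mathbf y,h(2^u-1,\mathbf y),g(\mathbf y)\big)=0$, and $f(x,\mathbf y)=g(\mathbf y)$ otherwise; 2. $f$ takes its values in $\mathbb N$ and is in $\mathbf{FAC}^0$. -/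

import Mathlib

/-! Boolean circuits over unbounded fan-in conjunction and disjunction and over negation -/

namespace BoolCircuit

/-- The label of a node of a circuit that reads `k` numbers of `n` bits each:
a Boolean connective, or the input bit `j` (bit `0` is the least significant) of the argument `i`. -/
inductive NodeLabel (k n : ℕ) : Type
  | and
  | or
  | not
  | input (i : Fin k) (j : Fin n)

/-- A Boolean circuit with `k * n` input bits.  It is a directed acyclic graph on the nodes
`0, …, size - 1`; the output bit `j` (bit `0` is the least significant) is the value of the node
`out j`.  A conjunction of no node is the constant `1`, a disjunction of no node is `0`. -/
structure Circuit (k n : ℕ) where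
  size : ℕ
  label : Fin size → NodeLabel k n
  pred : Fin size → Finset (Fin size)
  input_pred : ∀ a i j, label a = NodeLabel.input i j → pred a = ∅
  not_pred : ∀ a, label a = NodeLabel.not → (pred a).card = 1
  acyclic : WellFounded (fun b a : Fin size => b ∈ pred a)
  numOut : ℕ
  out : Fin numOut → Fin size

namespace Circuit

variable {k n : ℕ}

/-- The truth value of a node on the input `x`. -/
def eval (C : Circuit k n) (x : Fin k → ℕ) : Fin C.size → Prop :=
  C.acyclic.fix fun a val =>
    match C.label a with
    | NodeLabel.and => ∀ b (hb : b ∈ C.pred a), val b hb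
    | NodeLabel.or => ∃ b, ∃ hb : b ∈ C.pred a, val b hb
    | NodeLabel.not => ∃ b, ∃ hb : b ∈ C.pred a, ¬ val b hb
    | NodeLabel.input i j => (x i).testBit j = true

/-- The number whose binary digits are the output bits of the circuit on the input `x`. -/
noncomputable def value (C : Circuit k n) (x : Fin k → ℕ) : ℕ :=
  open Classical in ∑ j : Fin C.numOut, if C.eval x (C.out j) then 2 ^ (j : ℕ) else 0

/-- The length of the longest path that ends in a given node. -/
noncomputable def height (C : Circuit k n) : Fin C.size → ℕ :=
  C.acyclic.fix fun a ht => (C.pred a).attach.sup fun b => ht b.1 b.2 + 1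

/-- The length of the longest path of the circuit. -/
noncomputable def depth (C : Circuit k n) : ℕ := Finset.univ.sup C.height

end Circuit

/-- The kinds of questions about the nodes of a circuit. -/
inductive Query (k : ℕ) : Type
  | and
  | or
  | not
  | input (i : Fin k)
  | output
  | pred

/-- The direct connection language: is `a` a conjunction (disjunction, negation), is `a` the
input node for bit `b` of argument `i`, is `a` the node of output bit `b`, is `b` a predecessor
of `a`?  Numbers that are not names of nodes get the answer no. -/
def Circuit.Connection {k n : ℕ} (C : Circuit k n) : Query k → ℕ → ℕ → Prop
  | Query.and, a, _ => ∃ ha : a < C.size, C.label ⟨a, ha⟩ = NodeLabel.and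
  | Query.or, a, _ => ∃ ha : a < C.size, C.label ⟨a, ha⟩ = NodeLabel.or
  | Query.not, a, _ => ∃ ha : a < C.size, C.label ⟨a, ha⟩ = NodeLabel.not
  | Query.input i, a, b =>
      ∃ (ha : a < C.size) (hb : b < n), C.label ⟨a, ha⟩ = NodeLabel.input i ⟨b, hb⟩
  | Query.output, a, b => ∃ hb : b < C.numOut, (C.out ⟨b, hb⟩ : ℕ) = a
  | Query.pred, a, b => ∃ (ha : a < C.size) (hb : b < C.size), ⟨b, hb⟩ ∈ C.pred ⟨a, ha⟩

end BoolCircuit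

/-! Turing machines with a random access input tape -/

namespace RandomAccess

inductive Move : Type
  | left
  | stay
  | right

def Move.toInt : Move → ℤ
  | Move.left => -1
  | Move.stay => 0
  | Move.right => 1

/-- A two-way infinite tape over the alphabet blank, `0`, `1`. -/
structure Tape where
  cells : ℤ → Option Bool
  head : ℤ

def Tape.read (T : Tape) : Option Bool := T.cells T.head

/-- Overwrite the scanned cell, then move the head. -/
def Tape.act (T : Tape) (s : Option Bool) (m : Move) : Tape :=
  ⟨Function.update T.cells T.head s, T.head + m.toInt⟩

/-- The tape with the binary digits of `a` in the cells `0, 1, 2, …`, the least significant one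
first, blank elsewhere, and with the head on cell `0`. -/
def Tape.ofNat (a : ℕ) : Tape :=
  ⟨fun i => if 0 ≤ i ∧ i < (a.size : ℤ) then some (a.testBit i.toNat) else none, 0⟩

/-- The number written in binary in the cells `0, 1, 2, …`, the least significant digit first
(a blank counts as the digit `0`; only finitely many cells are ever in use). -/
noncomputable def Tape.toAddress (T : Tape) : ℕ :=
  ∑ᶠ i ∈ {i : ℕ | T.cells (i : ℤ) = some true}, 2 ^ i

/-- A deterministic Turing machine with a read-only random access tape and `work + 3` ordinary
tapes.  Tape `0` is the address tape: a step of the machine depends on the state, on the scanned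
symbols, and on the symbol of the random access tape in the cell whose number is written on the
address tape.  The value `none` of `trans` means that the machine halts. -/
structure Machine (Q : Type) where
  State : Type
  finite_state : Finite State
  work : ℕ
  start : Q → State
  accept : Set State
  trans : State → Bool → (Fin (work + 3) → Option Bool) →
    Option (State × (Fin (work + 3) → Option Bool × Move))

namespace Machine

variable {Q : Type}

structure Config (M : Machine Q) where
  state : M.State
  tapes : Fin (M.work + 3) → Tape

/-- The question `q` is in the state, the numbers `a` and `b` are in binary on the tapes `1`
and `2`, all other tapes are blank. -/
def init (M : Machine Q) (q : Q) (a b : ℕ) : M.Config where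
  state := M.start q
  tapes i := if (i : ℕ) = 1 then Tape.ofNat a else if (i : ℕ) = 2 then Tape.ofNat b
    else ⟨fun _ => none, 0⟩

/-- One step.  The random access tape contains the word `1ⁿ`, in the cells `0, …, n - 1`. -/
noncomputable def step (M : Machine Q) (n : ℕ) (c : M.Config) : Option M.Config :=
  (M.trans c.state (decide ((c.tapes 0).toAddress < n)) (fun i => (c.tapes i).read)).map
    fun r => ⟨r.1, fun i => (c.tapes i).act (r.2 i).1 (r.2 i).2⟩

/-- The configuration after `t` steps; a halted machine stays where it is. -/
noncomputable def run (M : Machine Q) (n : ℕ) (t : ℕ) (c : M.Config) : M.Config :=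
  (fun c' => (M.step n c').getD c')^[t] c

/-- On `1ⁿ`, `q`, `a` and `b` the machine halts within `t` steps, and it accepts exactly when
`P` holds. -/
def DecidesWithin (M : Machine Q) (t n : ℕ) (q : Q) (a b : ℕ) (P : Prop) : Prop :=
  M.step n (M.run n t (M.init q a b)) = none ∧ ((M.run n t (M.init q a b)).state ∈ M.accept ↔ P)

end Machine

end RandomAccess

/-- The function class `FAC⁰`: a function of `k` natural numbers is computed by a family of
circuits of polynomial size and constant depth whose direct connection language is decided in
time `O(log n)` by a Turing machine with random access.  The `n`-th circuit computes the function
on all arguments of at most `n` bits. -/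
def FAC0 {k : ℕ} (f : (Fin k → ℕ) → ℕ) : Prop :=
  ∃ C : (n : ℕ) → BoolCircuit.Circuit k n,
    (∃ c : ℕ, ∀ n, (C n).size + (C n).numOut ≤ n ^ c + c) ∧
    (∃ d : ℕ, ∀ n, (C n).depth ≤ d) ∧
    (∃ (M : RandomAccess.Machine (BoolCircuit.Query k)) (c : ℕ), ∀ n q a b,
      M.DecidesWithin (c * (n.size + 1)) n q a b ((C n).Connection q a b)) ∧
    ∀ (n : ℕ) (x : Fin k → ℕ), (∀ i, x i < 2 ^ n) → (C n).value x = f x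

/-! Limited `sg`-polynomial expressions and the schema -/

/-- The sign function: `1` for positive integers, `0` otherwise. -/
def sgInt (z : ℤ) : ℤ := if 0 < z then 1 else 0

/-- Limited `sg`-polynomial expressions in the variables `V`. -/
inductive LimitedExpr (V : Type) : Type
  | var (v : V)
  | const (c : ℤ)
  | add (P Q : LimitedExpr V)
  | sub (P Q : LimitedExpr V)
  | half (P : LimitedExpr V)
  | sg (P : LimitedExpr V)

namespace LimitedExpr

variable {V : Type}

/-- Here `/` is division with rounding towards minus infinity. -/
def eval (ρ : V → ℤ) : LimitedExpr V → ℤ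
  | var v => ρ v
  | const c => c
  | add P Q => P.eval ρ + Q.eval ρ
  | sub P Q => P.eval ρ - Q.eval ρ
  | half P => P.eval ρ / 2
  | sg P => sgInt (P.eval ρ)

/-- The variable `v` occurs only in subexpressions `sg(v)` or `sg(v - c)` with `c ∈ ℕ`. -/
def OnlySigned (v : V) : LimitedExpr V → Prop
  | var w => w ≠ v
  | const _ => True
  | add P Q => P.OnlySigned v ∧ Q.OnlySigned v
  | sub P Q => P.OnlySigned v ∧ Q.OnlySigned v
  | half P => P.OnlySigned v
  | sg P => P = var v ∨ (∃ c : ℕ, P = sub (var v) (const (c : ℤ))) ∨ P.OnlySigned v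

end LimitedExpr

/-- The terms `x`, `y₁, …, y_p`, `h(x, y)`, `f(x, y)` that may occur in the right-hand side. -/
inductive SchemaVar (p : ℕ) : Type
  | x
  | y (i : Fin p)
  | h
  | f

/-- The value `K(x, y, h(x, y), z)`. -/
def schemaValue {p : ℕ} (K : LimitedExpr (SchemaVar p)) (h : (Fin (p + 1) → ℕ) → ℕ)
    (x : ℕ) (y : Fin p → ℕ) (z : ℤ) : ℤ :=
  K.eval fun v => match v with
    | SchemaVar.x => (x : ℤ)
    | SchemaVar.y i => (y i : ℤ)
    | SchemaVar.h => (h (Fin.cons x y) : ℤ)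
    | SchemaVar.f => z

/-- The equation `∂F(x, y)/∂ℓ = H(x, y, F(x, y))`, where `ℓ(x) = Nat.size x` is the length of `x`
in binary. -/
def LengthODE {p : ℕ} (F : ℕ → (Fin p → ℕ) → ℤ) (H : ℕ → (Fin p → ℕ) → ℤ → ℤ) : Prop :=
  ∀ x y, F (x + 1) y = F x y + (((x + 1).size : ℤ) - (x.size : ℤ)) * H x y (F x y)

/-- `F` solves the initial value problem `F(0, y) = g(y)`,
`∂F(x, y)/∂ℓ = (K(x, y, h(x, y), F(x, y)) - 1) * F(x, y)`. -/
def SchemaSolution {p : ℕ} (g : (Fin p → ℕ) → ℕ) (h : (Fin (p + 1) → ℕ) → ℕ)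
    (K : LimitedExpr (SchemaVar p)) (F : ℕ → (Fin p → ℕ) → ℤ) : Prop :=
  (∀ y, F 0 y = (g y : ℤ)) ∧ LengthODE F fun x y z => (schemaValue K h x y z - 1) * z

/-! Numbers given by their binary digits -/

/-! The difference `ℓ(x + 1) - ℓ(x)` is `1` if `x + 1` is a power of two and `0` otherwise. So the
equation is a recursion with exactly one solution, which is constant except that at each point `x =
2 ^ u - 1` it is multiplied by the value of `K`. If `K` takes only the values `0` and `1` along the
solution, then `f` keeps the value `g(y)` until `K` vanishes for the first time at such a point, and
is `0` from then on (`SchemaSolution.eq_search`).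

It remains to put this bounded search into `FAC⁰`. The proof passes through first-order
definability: the digits of a function are described by one formula for all `n`, with quantifiers
over numbers below the polynomial bound `2 ^ (D * (n.size + 1))`, whose atoms are input digits,
comparisons, and numerical relations decidable in time `O(log n)`.

From formulas to circuits (`FAC0_of_definable`): a node is a subformula together with values of the
variables, and a quantifier becomes a disjunction of unbounded fan-in. The depth is at most the rank
of the formula. For uniformity, a node name consists of a tag for the subformula and the interleaved
digits of the variables. A machine measures `log n` with its address tape, compares two names digit
by digit in one pass, extracts one variable from each, and calls the machine of one atomic relation
(`exists_machine_of_plan`).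

From circuits to formulas (`definable_value`): the direct connection languages of the circuits for
`g` and `h` serve as atoms, and since the depth is bounded, unfolding the definition of a node value
a fixed number of times gives a formula.

Finally, two's complement digits of limited expressions are definable (`DefinableInt.eval`):
addition by carry lookahead, halving by a shift, `sg` from the sign digit and the existence of a
nonzero digit. Hence "some `u < ℓ(x)` has `K = 0`" is a formula, and so is each digit of `f`
(`FAC0_searchValue`). -/

/-- The number whose binary digits are `f 0, …, f (m - 1)`. -/
def natOfBits (f : ℕ → Bool) (m : ℕ) : ℕ := Nat.ofBits fun i : Fin m => f i

theorem testBit_natOfBits (f : ℕ → Bool) (m i : ℕ) :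
    (natOfBits f m).testBit i = (decide (i < m) && f i) := by
  by_cases h : i < m <;> simp [natOfBits, Nat.testBit_ofBits, h]

theorem natOfBits_lt (f : ℕ → Bool) (m : ℕ) : natOfBits f m < 2 ^ m := Nat.ofBits_lt_two_pow _

theorem natOfBits_congr {f g : ℕ → Bool} {m : ℕ} (h : ∀ i < m, f i = g i) :
    natOfBits f m = natOfBits g m := by
  unfold natOfBits
  congr 1
  funext i
  exact h i i.2

theorem natOfBits_testBit {a m : ℕ} (h : a < 2 ^ m) : natOfBits a.testBit m = a := by
  simp [natOfBits, Nat.ofBits_testBit, Nat.mod_eq_of_lt h]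

/-- Links the sums of powers of two that define circuit values and tape addresses to digitwise
reasoning. -/
theorem sum_range_eq_natOfBits (f : ℕ → Bool) (m : ℕ) :
    (∑ i ∈ Finset.range m, if f i then 2 ^ i else 0) = natOfBits f m := by
  induction m generalizing f with
  | zero => simp [natOfBits]
  | succ m ih =>
    rw [Finset.sum_range_succ']
    have h1 : natOfBits f (m + 1) = 2 * natOfBits (fun i => f (i + 1)) m + (f 0).toNat := by
      simp [natOfBits, Nat.ofBits_succ, Function.comp_def]
    rw [h1, ← ih, Finset.mul_sum]
    congr 1
    · refine Finset.sum_congr rfl fun i _ => ?_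
      by_cases h : f (i + 1) <;> simp [h, pow_succ, mul_comm]
    · cases f 0 <;> simp

theorem testBit_of_size_le {a i : ℕ} (h : a.size ≤ i) : a.testBit i = false :=
  Nat.testBit_lt_two_pow (Nat.size_le.1 h)

namespace RandomAccess

/-! Tapes that carry a word in the cells `0, …, t - 1` -/

/-- The tape with the word `w 0, …, w (t - 1)` in the cells `0, …, t - 1`, head on `h`. -/
def Tape.word (w : ℕ → Bool) (t : ℕ) (h : ℤ) : Tape :=
  ⟨fun i => if 0 ≤ i ∧ i < (t : ℤ) then some (w i.toNat) else none, h⟩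

namespace Tape

theorem ofNat_eq_word (a : ℕ) : Tape.ofNat a = word a.testBit a.size 0 := rfl

/-- The blank tape, head on cell `0`. -/
abbrev blank : Tape := ⟨fun _ => none, 0⟩

theorem word_zero (w : ℕ → Bool) (h : ℤ) : word w 0 h = ⟨fun _ => none, h⟩ := by
  simp only [word, Tape.mk.injEq, and_true]
  funext i
  rw [if_neg]
  simp only [Nat.cast_zero]
  omega

theorem word_congr {w v : ℕ → Bool} {t : ℕ} (h : ℤ) (e : ∀ i < t, w i = v i) :
    word w t h = word v t h := by
  simp only [word, Tape.mk.injEq, and_true]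
  funext i
  split_ifs with hi
  · rw [e]; omega
  · rfl

@[simp] theorem read_word (w : ℕ → Bool) (t : ℕ) (h : ℕ) :
    (word w t h).read = if h < t then some (w h) else none := by
  simp [word, read]

@[simp] theorem read_word_neg (w : ℕ → Bool) (t : ℕ) : (word w t (-1)).read = none := by
  simp [word, read]

theorem act_read (T : Tape) (m : Move) : T.act T.read m = ⟨T.cells, T.head + m.toInt⟩ := by
  simp [act, read]

@[simp] theorem act_read_stay (T : Tape) : T.act T.read Move.stay = T := by
  simp [act_read, Move.toInt]

theorem act_word (w : ℕ → Bool) (t : ℕ) (h : ℤ) (m : Move) :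
    (word w t h).act (word w t h).read m = word w t (h + m.toInt) := act_read _ _

theorem act_word_push (w : ℕ → Bool) (t : ℕ) {s : Bool} (hs : s = w t) :
    (word w t t).act (some s) Move.right = word w (t + 1) ((t + 1 : ℕ) : ℤ) := by
  simp only [word, act, Tape.mk.injEq, Move.toInt, Nat.cast_succ, and_true]
  funext i
  by_cases hi : i = t
  · subst hi
    rw [Function.update_self, if_pos (by omega), hs, Int.toNat_natCast]
  · rw [Function.update_of_ne hi]
    by_cases h : 0 ≤ i ∧ i < (t : ℤ)
    · rw [if_pos h, if_pos (by omega)]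
    · rw [if_neg h, if_neg (by omega)]

theorem act_word_pop (w : ℕ → Bool) (t : ℕ) (m : Move) :
    (word w (t + 1) t).act none m = word w t (t + m.toInt) := by
  simp only [word, act, Tape.mk.injEq, Nat.cast_succ, and_true]
  funext i
  by_cases hi : i = t
  · subst hi
    rw [Function.update_self, if_neg (by omega)]
  · rw [Function.update_of_ne hi]
    by_cases h : 0 ≤ i ∧ i < (t : ℤ)
    · rw [if_pos h, if_pos (by omega)]
    · rw [if_neg h, if_neg (by omega)]

theorem toAddress_word (w : ℕ → Bool) (t : ℕ) (h : ℤ) :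
    (word w t h).toAddress = natOfBits w t := by
  have hs : {i : ℕ | (word w t h).cells (i : ℤ) = some true} =
      ((Finset.range t).filter fun i => w i = true : Finset ℕ) := by
    ext i
    by_cases hi : i < t <;> simp [word, hi]
  rw [← sum_range_eq_natOfBits, toAddress, ← Finset.sum_filter, hs, finsum_mem_coe_finset]

end Tape

namespace Machine

variable {Q : Type} (M : Machine Q) (n : ℕ)

theorem run_add (s t : ℕ) (c : M.Config) : M.run n (s + t) c = M.run n t (M.run n s c) := by
  simp only [run, Nat.add_comm s t, Function.iterate_add_apply]

variable {M n}

theorem run_succ {c c' : M.Config} (h : M.step n c = some c') (t : ℕ) :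
    M.run n (t + 1) c = M.run n t c' := by
  simp [run, Function.iterate_succ_apply, h]

theorem run_one {c c' : M.Config} (h : M.step n c = some c') : M.run n 1 c = c' :=
  run_succ h 0

theorem run_of_halted {c : M.Config} (h : M.step n c = none) (t : ℕ) : M.run n t c = c := by
  induction t with
  | zero => rfl
  | succ t ih => simpa [run, Function.iterate_succ_apply, h] using ih

theorem DecidesWithin.mono {s t : ℕ} (hst : s ≤ t) {q : Q} {a b : ℕ} {P : Prop}
    (h : M.DecidesWithin s n q a b P) : M.DecidesWithin t n q a b P := by
  obtain ⟨r, rfl⟩ := Nat.exists_eq_add_of_le hst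
  unfold DecidesWithin
  rw [run_add, run_of_halted h.1]
  exact h

end Machine

end RandomAccess

/-! ### Relations decidable in logarithmic time; comparison of numbers -/

namespace RandomAccess

open Machine

/-- A relation between numbers is decided in time `O(log n)`, as long as the first number is at
most polynomial in `n`. -/
def LogDecidable (D : ℕ) (P : ℕ → ℕ → ℕ → Prop) : Prop :=
  ∃ (Q : Type) (M : Machine Q) (q : Q) (c : ℕ), ∀ n a b, a < 2 ^ (D * (n.size + 1)) →
    M.DecidesWithin (c * (n.size + 1)) n q a b (P n a b)

/-- The comparison of two numbers from the comparison of their remaining digits and the most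
significant digits. -/
def compareStep (x y : Bool) (o : Ordering) : Ordering :=
  (compare x y).then o

/-- The digit `t` outweighs all lower digits, so reading from the least significant end needs only
the last outcome as memory. -/
theorem compare_mod_two_pow_succ (a b t : ℕ) :
    compare (a % 2 ^ (t + 1)) (b % 2 ^ (t + 1)) =
      compareStep (a.testBit t) (b.testBit t) (compare (a % 2 ^ t) (b % 2 ^ t)) := by
  have h (a : ℕ) : a % 2 ^ (t + 1) = a % 2 ^ t + 2 ^ t * (a.testBit t).toNat := by
    rw [pow_succ, Nat.mod_mul, Nat.toNat_testBit]
  have ha := Nat.mod_lt a (Nat.two_pow_pos t)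
  have hb := Nat.mod_lt b (Nat.two_pow_pos t)
  rw [h a, h b]
  cases a.testBit t <;> cases b.testBit t
  · simp [compareStep]
  · simp only [Bool.toNat_false, Bool.toNat_true, compareStep]
    rw [Nat.compare_eq_lt.2 (by omega)]
    rfl
  · simp only [Bool.toNat_false, Bool.toNat_true, compareStep]
    rw [Nat.compare_eq_gt.2 (by omega)]
    rfl
  · simp only [Bool.toNat_true, compareStep]
    rcases lt_trichotomy (a % 2 ^ t) (b % 2 ^ t) with h | h | h
    · rw [Nat.compare_eq_lt.2 h, Nat.compare_eq_lt.2 (by omega)]; rfl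
    · rw [h]; simp
    · rw [Nat.compare_eq_gt.2 h, Nat.compare_eq_gt.2 (by omega)]; rfl

/-- The machine that compares the numbers `a` and `b` on the tapes `1` and `2`, and `a` with the
length `n` of the random access tape. -/
def compareMachine (q : Ordering → Bool → Bool) : Machine Unit where
  State := Ordering ⊕ Bool
  finite_state := inferInstance
  work := 0
  start _ := Sum.inl Ordering.eq
  accept := {Sum.inr true}
  trans := fun
    | Sum.inl o, r, s =>
      if s 1 = none then
        some (Sum.inr (q (if s 2 = none then o else Ordering.lt) r), fun i => (s i, Move.stay))
      else
        some (Sum.inl (compareStep (s 1 == some true) (s 2 == some true) o),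
          ![(s 1, Move.right), (s 1, Move.right), (s 2, Move.right)])
    | Sum.inr _, _, _ => none

/-- Loop invariant: the digits of `a` are copied to the address tape during the comparison, so that
in the end the random access symbol tells whether `a < n`. -/
theorem compareMachine_run (q : Ordering → Bool → Bool) (n a b t : ℕ) (ht : t ≤ a.size) :
    (compareMachine q).run n t ((compareMachine q).init () a b) =
      ⟨Sum.inl (compare (a % 2 ^ t) (b % 2 ^ t)),
        ![Tape.word a.testBit t t, Tape.word a.testBit a.size t,
          Tape.word b.testBit b.size t]⟩ := by
  induction t with
  | zero =>
    simp only [run, Function.iterate_zero, id, init, pow_zero, Nat.mod_one]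
    congr 1
    funext i
    change Fin 3 at i
    fin_cases i
    · simp [Tape.word_zero]
    · simp [Tape.ofNat_eq_word]
    · simp [Tape.ofNat_eq_word]
  | succ t ih =>
    rw [run_add, ih (by omega)]
    apply run_one
    have h1 : (a.testBit t == true) = a.testBit t := by simp
    have h2 : ((if t < b.size then some (b.testBit t) else none) == some true) = b.testBit t := by
      split_ifs with h
      · simp
      · rw [testBit_of_size_le (not_lt.1 h)]; rfl
    have ht' : t < a.size := ht
    simp only [step, compareMachine, Matrix.cons_val_one, Matrix.cons_val_zero,
      Tape.read_word, if_pos ht', reduceCtorEq, if_false, Option.map_some, Option.some.injEq,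
      Config.mk.injEq, compare_mod_two_pow_succ]
    refine ⟨?_, ?_⟩
    · congr 2
      exact (congrArg (· == some true) (Tape.read_word b.testBit b.size t)).trans h2
    · funext i
      change Fin 3 at i
      fin_cases i
      · simpa using Tape.act_word_push a.testBit t rfl
      · simpa [ht', Move.toInt] using Tape.act_word a.testBit a.size t Move.right
      · simpa [Move.toInt] using Tape.act_word b.testBit b.size t Move.right

/-- The running time depends on the length of `a` alone, because one look at the cell after the last
digit of `a` settles whether `b` is longer. Hence `b` may be arbitrarily large. -/
theorem logDecidable_compare (D : ℕ) (q : Ordering → Bool → Bool) :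
    LogDecidable D fun n a b => q (compare a b) (decide (a < n)) = true := by
  refine ⟨Unit, compareMachine q, (), D + 1, fun n a b hab => ?_⟩
  have hs : a.size + 1 ≤ (D + 1) * (n.size + 1) := by
    have := Nat.size_le.2 hab
    nlinarith
  refine DecidesWithin.mono hs ?_
  have hstep : (compareMachine q).step n
      ((compareMachine q).run n a.size ((compareMachine q).init () a b)) =
      some ⟨Sum.inr (q (compare a b) (decide (a < n))),
        ![Tape.word a.testBit a.size a.size, Tape.word a.testBit a.size a.size,
          Tape.word b.testBit b.size a.size]⟩ := by
    rw [compareMachine_run q n a b _ le_rfl]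
    have ha : a % 2 ^ a.size = a := Nat.mod_eq_of_lt (Nat.lt_size_self a)
    have hadr : (Tape.word a.testBit a.size a.size).toAddress = a := by
      rw [Tape.toAddress_word, natOfBits_testBit (Nat.lt_size_self a)]
    simp only [step, compareMachine, Matrix.cons_val_one, Matrix.cons_val_zero,
      Tape.read_word, lt_irrefl, if_false, if_true, Option.map_some, Option.some.injEq,
      Config.mk.injEq, ha]
    refine ⟨?_, ?_⟩
    · congr 2
      · change (if (Tape.word b.testBit b.size a.size).read = none then _ else _) = _
        rw [Tape.read_word]
        -- Tapes carry no leading zeros, so a digit of `b` beyond the end of `a` means `a < b`.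
        by_cases h : a.size < b.size
        · have : a < b := lt_of_lt_of_le (Nat.lt_size_self a) (Nat.lt_size.1 h)
          simp [h, Nat.compare_eq_lt.2 this]
        · have : b % 2 ^ a.size = b := Nat.mod_eq_of_lt (Nat.size_le.1 (not_lt.1 h))
          simp [h, this]
      · exact congrArg (fun m => decide (m < n)) hadr
    · funext i
      change Fin 3 at i
      fin_cases i
      · exact Tape.act_read_stay _
      · exact Tape.act_read_stay _
      · exact Tape.act_read_stay _
  unfold DecidesWithin
  rw [run_add, run_one hstep]
  refine ⟨rfl, ?_⟩
  change (Sum.inr _ : Ordering ⊕ Bool) ∈ ({Sum.inr true} : Set (Ordering ⊕ Bool)) ↔ _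
  simp

end RandomAccess

/-! ### The machine that decodes node names: measuring the logarithm -/

namespace RandomAccess

open Machine

theorem Machine.step_eq_some {Q : Type} {M : Machine Q} {n : ℕ} {c : M.Config} {st : M.State}
    {act : Fin (M.work + 3) → Option Bool × Move} {T : Fin (M.work + 3) → Tape}
    (h : M.trans c.state (decide ((c.tapes 0).toAddress < n)) (fun i => (c.tapes i).read) =
      some (st, act))
    (hT : ∀ i, (c.tapes i).act (act i).1 (act i).2 = T i) :
    M.step n c = some ⟨st, T⟩ := by
  simp only [step, h, Option.map_some, hT]

/-- What is to be checked about the node names `a` and `b`: the condition `chk` on the digits of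
every variable, and the relation `rel` for the variables `fst` of `a` and `snd` of `b`. -/
structure Plan (R : Type) (V : ℕ) where
  chk : Fin V → Bool → Bool → Bool
  fst : Fin V
  snd : Fin V
  rel : R

/-- The states of the machine that decodes node names. -/
inductive DecodeState (Q : Type) (τ V D : ℕ) : Type
  | mark (q : Q) (d : Fin (D + 1))
  | back (q : Q)
  | tag (q : Q) (i : Fin (τ + 1)) (ta tb : Fin τ → Bool)
  | scan (q : Q) (ta tb : Fin τ → Bool) (v : Fin (V + 1)) (ok : Bool)
  | rewind (q : Q) (ta tb : Fin τ → Bool) (fa fb : Bool)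
  | done (q : Q) (ta tb : Fin τ → Bool)

instance {Q : Type} [Finite Q] (τ V D : ℕ) : Finite (DecodeState Q τ V D) := by
  let B := Fin τ → Bool
  let f : (Q × Fin (D + 1)) ⊕ Q ⊕ (Q × Fin (τ + 1) × B × B) ⊕
      (Q × B × B × Fin (V + 1) × Bool) ⊕ (Q × B × B × Bool × Bool) ⊕ (Q × B × B) →
      DecodeState Q τ V D := fun
    | .inl (q, d) => .mark q d
    | .inr (.inl q) => .back q
    | .inr (.inr (.inl (q, i, ta, tb))) => .tag q i ta tb
    | .inr (.inr (.inr (.inl (q, ta, tb, v, ok)))) => .scan q ta tb v ok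
    | .inr (.inr (.inr (.inr (.inl (q, ta, tb, fa, fb))))) => .rewind q ta tb fa fb
    | .inr (.inr (.inr (.inr (.inr (q, ta, tb))))) => .done q ta tb
  refine Finite.of_surjective f fun s => ?_
  cases s with
  | mark q d => exact ⟨.inl (q, d), rfl⟩
  | back q => exact ⟨.inr (.inl q), rfl⟩
  | tag q i ta tb => exact ⟨.inr (.inr (.inl (q, i, ta, tb))), rfl⟩
  | scan q ta tb v ok => exact ⟨.inr (.inr (.inr (.inl (q, ta, tb, v, ok)))), rfl⟩
  | rewind q ta tb fa fb => exact ⟨.inr (.inr (.inr (.inr (.inl (q, ta, tb, fa, fb))))), rfl⟩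
  | done q ta tb => exact ⟨.inr (.inr (.inr (.inr (.inr (q, ta, tb))))), rfl⟩

section Decode

variable {Q R : Type} [Finite Q] {τ V D : ℕ} (two : Q → Bool)
  (plan : Q → (Fin τ → Bool) → (Fin τ → Bool) → Plan R V)

/-- The symbol to write and the move when a tape that shows `s` is rewound and leading zeros are
erased as long as `f` holds. -/
def rewindAct (f : Bool) (s : Option Bool) : Option Bool × Move :=
  (if f && s == some false then none else s, Move.left)

/-- The transitions of `decodeMachine`, from the state, the random access symbol and the symbols
on the tapes `0, …, 5`. -/
def decodeTrans (st : DecodeState Q τ V D) (r : Bool) (s0 s1 s2 s3 s4 s5 : Option Bool) :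
    Option (DecodeState Q τ V D × (Fin 6 → Option Bool × Move)) :=
  match st with
  | .mark q d =>
    if h : d = 0 then
      if r then
        some (.mark q (Fin.last D),
          ![(some true, .right), (s1, .stay), (s2, .stay), (s3, .stay), (s4, .stay), (s5, .stay)])
      else
        some (.back q,
          ![(s0, .left), (s1, .stay), (s2, .stay), (s3, .left), (s4, .stay), (s5, .stay)])
    else
      some (.mark q (Fin.castSucc (d.pred h)),
        ![(s0, .stay), (s1, .stay), (s2, .stay), (some true, .right), (s4, .stay), (s5, .stay)])
  | .back q =>
    if s3 = none then
      some (.tag q 0 (fun _ => false) (fun _ => false),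
        ![(s0, .right), (s1, .stay), (s2, .stay), (s3, .right), (s4, .stay), (s5, .stay)])
    else
      some (.back q, ![(none, if s0 = none then .stay else .left), (s1, .stay), (s2, .stay),
        (s3, .left), (s4, .stay), (s5, .stay)])
  | .tag q i ta tb =>
    if h : (i : ℕ) < τ then
      some (.tag q ⟨i + 1, Nat.succ_lt_succ h⟩ (Function.update ta ⟨i, h⟩ (s1 == some true))
        (Function.update tb ⟨i, h⟩ (two q && s2 == some true)),
        ![(s0, .stay), (s1, .right), (s2, if two q then .right else .stay), (s3, .stay),
          (s4, .stay), (s5, .stay)])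
    else
      some (.scan q ta tb (Fin.last V) true,
        ![(s0, .stay), (s1, .stay), (s2, .stay), (s3, .stay), (s4, .stay), (s5, .stay)])
  | .scan q ta tb v ok =>
    if h : (v : ℕ) < V then
      some (.scan q ta tb ⟨v + 1, Nat.succ_lt_succ h⟩
        (ok && (plan q ta tb).chk ⟨v, h⟩ (s1 == some true) (two q && s2 == some true)),
        ![(s0, .stay), (s1, .right), (s2, if two q then .right else .stay), (s3, .stay),
          if ((plan q ta tb).fst : ℕ) = v then (some (s1 == some true), .right) else (s4, .stay),
          if ((plan q ta tb).snd : ℕ) = v then (some (two q && s2 == some true), .right)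
            else (s5, .stay)])
    else if s3 = none then
      if s1 = none ∧ (two q = true → s2 = none) ∧ ok = true then
        some (.rewind q ta tb true true,
          ![(s0, .stay), (s1, .stay), (s2, .stay), (s3, .stay), (s4, .left), (s5, .left)])
      else none
    else
      some (.scan q ta tb 0 ok,
        ![(s0, .stay), (s1, .stay), (s2, .stay), (s3, .right), (s4, .stay), (s5, .stay)])
  | .rewind q ta tb fa fb =>
    if s4 = none then
      some (.done q ta tb,
        ![(s0, .stay), (s1, .stay), (s2, .stay), (s3, .stay), (s4, .right), (s5, .right)])
    else
      some (.rewind q ta tb (fa && s4 == some false) (fb && s5 == some false),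
        ![(s0, .stay), (s1, .stay), (s2, .stay), (s3, .stay), rewindAct fa s4, rewindAct fb s5])
  | .done .. => none

/-- The machine that writes `D * (n.size + 1)` marks on tape `3`, reads the tags and the variables
of the numbers `a` and `b` on the tapes `1` and `2`, makes the digitwise checks of the plan, and
copies the two selected variables to the tapes `4` and `5`.  The number `b` is left alone if
`two q` is false. -/
def decodeMachine : Machine Q where
  State := DecodeState Q τ V D
  finite_state := inferInstance
  work := 3
  start q := .mark q (Fin.last D)
  accept := ∅
  trans st r s := decodeTrans two plan st r (s 0) (s 1) (s 2) (s 3) (s 4) (s 5)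

/-- A configuration of the decoding machine. -/
abbrev decodeConfig (st : DecodeState Q τ V D) (T0 T1 T2 T3 T4 T5 : Tape) :
    (decodeMachine (D := D) two plan).Config :=
  ⟨st, ![T0, T1, T2, T3, T4, T5]⟩

variable {two plan} {n : ℕ}

/-- The default arguments cover tapes that the step leaves alone, so a use has to mention only the
tapes that change. -/
theorem decode_step {st st' : DecodeState Q τ V D} {T0 T1 T2 T3 T4 T5 T0' T1' T2' T3' T4' T5' : Tape}
    {a0 a1 a2 a3 a4 a5 : Option Bool × Move}
    (h : decodeTrans two plan st (decide (T0.toAddress < n)) T0.read T1.read T2.read T3.read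
      T4.read T5.read = some (st', ![a0, a1, a2, a3, a4, a5]))
    (e0 : T0.act a0.1 a0.2 = T0' := by exact Tape.act_read_stay _)
    (e1 : T1.act a1.1 a1.2 = T1' := by exact Tape.act_read_stay _)
    (e2 : T2.act a2.1 a2.2 = T2' := by exact Tape.act_read_stay _)
    (e3 : T3.act a3.1 a3.2 = T3' := by exact Tape.act_read_stay _)
    (e4 : T4.act a4.1 a4.2 = T4' := by exact Tape.act_read_stay _)
    (e5 : T5.act a5.1 a5.2 = T5' := by exact Tape.act_read_stay _) :
    (decodeMachine (D := D) two plan).step n (decodeConfig two plan st T0 T1 T2 T3 T4 T5) =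
      some (decodeConfig two plan st' T0' T1' T2' T3' T4' T5') := by
  subst e0 e1 e2 e3 e4 e5
  refine step_eq_some (M := decodeMachine (D := D) two plan)
    (act := (![a0, a1, a2, a3, a4, a5] : Fin 6 → Option Bool × Move)) h ?_
  intro i
  change Fin 6 at i
  fin_cases i <;> rfl

theorem decode_init (q : Q) (a b : ℕ) :
    (decodeMachine (D := D) two plan).init q a b =
      decodeConfig two plan (.mark q (Fin.last D)) Tape.blank (Tape.ofNat a) (Tape.ofNat b)
        Tape.blank Tape.blank Tape.blank := by
  simp only [init]
  congr 1
  funext i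
  change Fin 6 at i
  fin_cases i <;> rfl

/-- The word that consists of ones. -/
abbrev ones : ℕ → Bool := fun _ => true

theorem decode_mark_aux (q : Q) (k c j : ℕ) (hj : j ≤ D) (T1 T2 T4 T5 : Tape) :
    (decodeMachine (D := D) two plan).run n j
      (decodeConfig two plan (.mark q (Fin.last D)) (Tape.word ones k k) T1 T2
        (Tape.word ones c c) T4 T5) =
    decodeConfig two plan (.mark q ⟨D - j, by omega⟩) (Tape.word ones k k) T1 T2
        (Tape.word ones (c + j) ((c + j : ℕ) : ℤ)) T4 T5 := by
  induction j with
  | zero => rfl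
  | succ j ih =>
    rw [run_add, ih (by omega)]
    apply run_one
    have h0 : (⟨D - j, by omega⟩ : Fin (D + 1)) ≠ 0 := by
      intro h
      have := congrArg Fin.val h
      simp at this
      omega
    have h1 : Fin.castSucc (Fin.pred (⟨D - j, by omega⟩ : Fin (D + 1)) h0) =
        ⟨D - (j + 1), by omega⟩ := by
      ext
      simp
      omega
    exact decode_step ((dif_neg h0).trans (by rw [h1])) (e3 := Tape.act_word_push ones (c + j) rfl)

theorem natOfBits_ones (k : ℕ) : natOfBits ones k = 2 ^ k - 1 := by
  apply Nat.eq_of_testBit_eq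
  intro i
  simp [testBit_natOfBits, Nat.testBit_two_pow_sub_one]

/-- The address `2 ^ k - 1` is below `n` exactly if `2 ^ k ≤ n`. Writing ones on the address tape
until the random access symbol changes therefore measures `n.size` in unary. -/
theorem address_ones_lt_iff (k n : ℕ) (h : ℤ) :
    (Tape.word ones k h).toAddress < n ↔ k < n.size := by
  rw [Tape.toAddress_word, natOfBits_ones, Nat.lt_size]
  have := Nat.two_pow_pos k
  omega

theorem decode_mark (q : Q) (k : ℕ) (hk : k ≤ n.size) (T1 T2 T4 T5 : Tape) :
    (decodeMachine (D := D) two plan).run n (k * (D + 1))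
      (decodeConfig two plan (.mark q (Fin.last D)) Tape.blank T1 T2 Tape.blank T4 T5) =
    decodeConfig two plan (.mark q (Fin.last D)) (Tape.word ones k k) T1 T2
        (Tape.word ones (D * k) ((D * k : ℕ) : ℤ)) T4 T5 := by
  induction k with
  | zero =>
    simp only [Nat.zero_mul, Nat.mul_zero, Tape.word_zero, Nat.cast_zero]
    rfl
  | succ k ih =>
    rw [Nat.succ_mul, run_add, ih (by omega), run_add, decode_mark_aux q k (D * k) D le_rfl]
    apply run_one
    have h0 : (⟨D - D, by omega⟩ : Fin (D + 1)) = 0 := by ext; simp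
    have h1 : decide ((Tape.word ones k k).toAddress < n) = true :=
      decide_eq_true ((address_ones_lt_iff k n k).2 hk)
    exact decode_step ((dif_pos h0).trans (by rw [h1]; exact if_pos rfl))
      (e0 := Tape.act_word_push ones k rfl)

/-- Each test of an address is preceded by `D` marks, and the last, failing test counts too. This is
where `n.size + 1` comes from. -/
theorem decode_mark_back (q : Q) (T1 T2 T4 T5 : Tape) :
    (decodeMachine (D := D) two plan).run n ((n.size + 1) * (D + 1))
      (decodeConfig two plan (.mark q (Fin.last D)) Tape.blank T1 T2 Tape.blank T4 T5) =
    decodeConfig two plan (.back q) (Tape.word ones n.size (n.size - 1)) T1 T2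
        (Tape.word ones (D * (n.size + 1)) ((D * (n.size + 1) : ℕ) - 1)) T4 T5 := by
  rw [Nat.succ_mul, run_add, decode_mark q n.size le_rfl, run_add,
    decode_mark_aux q _ _ D le_rfl]
  apply run_one
  have h0 : (⟨D - D, by omega⟩ : Fin (D + 1)) = 0 := by ext; simp
  have h1 : decide ((Tape.word ones n.size n.size).toAddress < n) = false :=
    decide_eq_false (by simp [address_ones_lt_iff])
  exact decode_step ((dif_pos h0).trans (by rw [h1]; exact if_neg (by simp)))
    (e0 := Tape.act_word ..) (e3 := Tape.act_word ..)

theorem decode_back_aux (q : Q) (L c k : ℕ) (hk : k ≤ c) (hc : c ≤ L) (T1 T2 T4 T5 : Tape) :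
    (decodeMachine (D := D) two plan).run n c
      (decodeConfig two plan (.back q) (Tape.word ones k (k - 1)) T1 T2
        (Tape.word ones L (c - 1)) T4 T5) =
    decodeConfig two plan (.back q) (Tape.word ones 0 (-1)) T1 T2 (Tape.word ones L (-1)) T4 T5 := by
  induction c generalizing k with
  | zero =>
    obtain rfl : k = 0 := by omega
    rfl
  | succ c ih =>
    have hc1 : (((c + 1 : ℕ) : ℤ) - 1) = (c : ℕ) := by push_cast; ring
    have h3 : (Tape.word ones L (((c + 1 : ℕ) : ℤ) - 1)).read ≠ none := by
      rw [hc1]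
      simp [show c < L by omega]
    have h0 : (Tape.word ones k (k - 1)).act none
        (if (Tape.word ones k (k - 1)).read = none then .stay else .left) =
        Tape.word ones (k - 1) (((k - 1 : ℕ) : ℤ) - 1) := by
      -- The address word may be shorter than the word of marks. Once it is erased, its head waits
      -- on cell `-1`, and the truncated `k - 1` stays `0`.
      cases k with
      | zero =>
        have hn : (Tape.word ones 0 (((0 : ℕ) : ℤ) - 1)).read = none := by simp
        simpa [hn] using Tape.act_read_stay (Tape.word ones 0 (((0 : ℕ) : ℤ) - 1))
      | succ k =>
        have hk1 : (((k + 1 : ℕ) : ℤ) - 1) = (k : ℕ) := by push_cast; ring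
        rw [hk1]
        simpa [Move.toInt, sub_eq_add_neg] using Tape.act_word_pop ones k .left
    have hstep : (decodeMachine (D := D) two plan).step n
        (decodeConfig two plan (.back q) (Tape.word ones k (k - 1)) T1 T2
          (Tape.word ones L ((c + 1 : ℕ) - 1)) T4 T5) = some
        (decodeConfig two plan (.back q) (Tape.word ones (k - 1) (((k - 1 : ℕ) : ℤ) - 1)) T1 T2
          (Tape.word ones L (c - 1)) T4 T5) :=
      decode_step (if_neg h3) (e0 := h0)
        (e3 := (Tape.act_word ..).trans (by rw [hc1]; rfl))
    rw [run_succ hstep, ih (k - 1) (by omega) (by omega)]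

theorem decode_back (q : Q) (L k : ℕ) (hk : k ≤ L) (T1 T2 T4 T5 : Tape) :
    (decodeMachine (D := D) two plan).run n (L + 1)
      (decodeConfig two plan (.back q) (Tape.word ones k (k - 1)) T1 T2
        (Tape.word ones L (L - 1)) T4 T5) =
    decodeConfig two plan (.tag q 0 (fun _ => false) (fun _ => false)) Tape.blank T1 T2
      (Tape.word ones L 0) T4 T5 := by
  rw [run_add, decode_back_aux q L L k hk le_rfl]
  apply run_one
  have h3 : (Tape.word ones L (-1)).read = none := by simp
  refine decode_step (by rw [decodeTrans, if_pos h3]) (e0 := ?_) (e3 := Tape.act_word ..)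
  exact (Tape.act_word ..).trans (Tape.word_zero _ _)

end Decode

end RandomAccess

/-! ### The decoding machine: tags, digits and rewinding -/

namespace RandomAccess

open Machine

theorem Tape.read_word_testBit (a h : ℕ) :
    ((Tape.word a.testBit a.size h).read == some true) = a.testBit h := by
  rw [Tape.read_word]
  split_ifs with hi
  · simp
  · rw [testBit_of_size_le (not_lt.1 hi)]; rfl

/-- The tape of the number `b`, with the head on `h` if `two` and on `0` otherwise. -/
def secondTape (two : Bool) (b h : ℕ) : Tape := Tape.word b.testBit b.size (if two then h else 0)

theorem secondTape_read (two : Bool) (b h : ℕ) :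
    (two && (secondTape two b h).read == some true) = (two && b.testBit h) := by
  cases two
  · rfl
  · simp only [Bool.true_and, secondTape, if_true]
    exact Tape.read_word_testBit b h

theorem secondTape_act (two : Bool) (b h : ℕ) :
    (secondTape two b h).act (secondTape two b h).read (if two then .right else .stay) =
      secondTape two b (h + 1) := by
  cases two
  · exact Tape.act_read_stay _
  · simpa [secondTape, Move.toInt] using Tape.act_word b.testBit b.size h .right

theorem firstTape_act (a h : ℕ) :
    (Tape.word a.testBit a.size h).act (Tape.word a.testBit a.size h).read .right =
      Tape.word a.testBit a.size ((h + 1 : ℕ) : ℤ) := by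
  simpa [Move.toInt] using Tape.act_word a.testBit a.size h .right

section Rewind

/-- The tape that is rewound, on which the number `N` is left in the end, when `m` cells remain. -/
def rewindTape (N m : ℕ) : Tape := Tape.word N.testBit (max m N.size) (m - 1)

theorem rewindTape_read_succ (N m : ℕ) :
    (rewindTape N (m + 1)).read = some (N.testBit m) := by
  have h1 : (((m + 1 : ℕ) : ℤ) - 1) = (m : ℕ) := by push_cast; ring
  rw [rewindTape, h1, Tape.read_word, if_pos (by omega)]

/-- The flag says that no nonzero digit has been met so far. It drops at the leading digit of `N`,
which is `1`, and stays down below it. -/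
theorem rewindTape_flag (N m : ℕ) :
    (decide (N.size ≤ m + 1) && (rewindTape N (m + 1)).read == some false) =
      decide (N.size ≤ m) := by
  rw [rewindTape_read_succ]
  by_cases h : N.size ≤ m
  · simp [h, testBit_of_size_le h, Nat.le_succ_of_le h]
  · by_cases h' : N.size ≤ m + 1
    · have : N.testBit m = true := by
        have hs : 2 ^ m ≤ N := Nat.lt_size.1 (not_le.1 h)
        have hs' : N < 2 ^ (m + 1) := Nat.size_le.1 h'
        have : N / 2 ^ m = 1 :=
          Nat.div_eq_of_lt_le (by omega) (by rw [pow_succ] at hs'; omega)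
        rw [Nat.testBit_eq_decide_div_mod_eq, this]
        rfl
      simp [h, this]
    · simp [h, h']

/-- Zeros above the leading digit are erased on the way back. A called machine thus finds exactly
the tape `Tape.ofNat N`, as the comparison machine requires. -/
theorem rewindTape_act (N m : ℕ) :
    (rewindTape N (m + 1)).act (rewindAct (decide (N.size ≤ m + 1)) (rewindTape N (m + 1)).read).1
      (rewindAct (decide (N.size ≤ m + 1)) (rewindTape N (m + 1)).read).2 = rewindTape N m := by
  have h1 : (((m + 1 : ℕ) : ℤ) - 1) = (m : ℕ) := by push_cast; ring
  simp only [rewindAct, rewindTape_flag]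
  by_cases h : N.size ≤ m
  · have e1 : max (m + 1) N.size = m + 1 := by omega
    have e2 : max m N.size = m := by omega
    simp only [h, decide_true, if_true, rewindTape, e1, e2, h1]
    simpa [Move.toInt, sub_eq_add_neg] using Tape.act_word_pop N.testBit m .left
  · have e : max (m + 1) N.size = max m N.size := by omega
    simp only [h, decide_false, rewindTape, e, h1, Bool.false_eq_true, if_false]
    simpa [Move.toInt, sub_eq_add_neg] using
      Tape.act_word N.testBit (max m N.size) m .left

theorem rewindTape_zero_read (N : ℕ) : (rewindTape N 0).read = none := by
  simp [rewindTape]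

theorem rewindTape_zero_act (N : ℕ) :
    (rewindTape N 0).act (rewindTape N 0).read .right = Tape.ofNat N := by
  have := Tape.act_word N.testBit (max 0 N.size) (-1) .right
  simpa [Move.toInt, rewindTape, Tape.ofNat_eq_word] using this

theorem word_act_left_eq_rewindTape (w : ℕ → Bool) (L : ℕ) :
    (Tape.word w L L).act (Tape.word w L L).read .left = rewindTape (natOfBits w L) L := by
  rw [Tape.act_word, rewindTape, max_eq_left (Nat.size_le.2 (natOfBits_lt w L))]
  refine Tape.word_congr _ fun i hi => ?_
  simp [testBit_natOfBits, hi]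

end Rewind

section Decode

variable {Q R : Type} [Finite Q] {τ V D : ℕ} {two : Q → Bool}
  {plan : Q → (Fin τ → Bool) → (Fin τ → Bool) → Plan R V} {n : ℕ}

theorem decode_tag (q : Q) (a b i : ℕ) (hi : i ≤ τ) (T0 T3 T4 T5 : Tape) :
    (decodeMachine (D := D) two plan).run n i
      (decodeConfig two plan (.tag q 0 (fun _ => false) (fun _ => false)) T0 (Tape.ofNat a)
        (Tape.ofNat b) T3 T4 T5) =
    decodeConfig two plan (.tag q ⟨i, by omega⟩ (fun j => decide ((j : ℕ) < i) && a.testBit j)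
      (fun j => decide ((j : ℕ) < i) && (two q && b.testBit j)))
      T0 (Tape.word a.testBit a.size i) (secondTape (two q) b i) T3 T4 T5 := by
  induction i with
  | zero =>
    simp only [secondTape, Nat.not_lt_zero, decide_false, Bool.false_and, Nat.cast_zero, ite_self]
    rfl
  | succ i ih =>
    rw [run_add, ih (by omega)]
    apply run_one
    have hf (f : ℕ → Bool) : Function.update (fun j : Fin τ => decide ((j : ℕ) < i) && f j)
        ⟨i, hi⟩ (f i) = fun j : Fin τ => decide ((j : ℕ) < i + 1) && f j := by
      funext j
      by_cases hj : j = ⟨i, hi⟩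
      · subst hj
        simp
      · have : (j : ℕ) ≠ i := fun h => hj (Fin.ext h)
        rw [Function.update_of_ne hj]
        congr 2
        simp only [eq_iff_iff]
        omega
    exact decode_step (by
        refine (dif_pos (show i < τ from hi)).trans ?_
        rw [Tape.read_word_testBit, secondTape_read, hf a.testBit,
          hf (fun j => two q && b.testBit j)])
      (e1 := firstTape_act a i) (e2 := secondTape_act (two q) b i)

theorem decode_tag_scan (q : Q) (a b : ℕ) (T0 T3 T4 T5 : Tape) :
    (decodeMachine (D := D) two plan).run n (τ + 1)
      (decodeConfig two plan (.tag q 0 (fun _ => false) (fun _ => false)) T0 (Tape.ofNat a)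
        (Tape.ofNat b) T3 T4 T5) =
    decodeConfig two plan (.scan q (fun j => a.testBit j) (fun j => two q && b.testBit j)
      (Fin.last V) true)
      T0 (Tape.word a.testBit a.size τ) (secondTape (two q) b τ) T3 T4 T5 := by
  rw [run_add, decode_tag q a b τ le_rfl]
  apply run_one
  have h (f : ℕ → Bool) : (fun j : Fin τ => decide ((j : ℕ) < τ) && f j) = fun j : Fin τ => f j := by
    simp
  rw [h a.testBit, h fun j => two q && b.testBit j]
  exact decode_step (by exact dif_neg (lt_irrefl τ))

/-- The digits of the `V` variables are interleaved, so `V` steps pass over the digit `t` of every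
variable. All of them are checked on the fly, and the two selected ones are appended to the tapes
`4` and `5`. -/
theorem decode_scan_round (q : Q) (ta tb : Fin τ → Bool) (a b t : ℕ) (ok : Bool) (v : ℕ)
    (hv : v ≤ V) (T0 T3 : Tape) :
    let pl := plan q ta tb
    let w := fun u => a.testBit (τ + u * V + pl.fst)
    let w' := fun u => two q && b.testBit (τ + u * V + pl.snd)
    (decodeMachine (D := D) two plan).run n v
      (decodeConfig two plan (.scan q ta tb 0 ok) T0
        (Tape.word a.testBit a.size (τ + t * V : ℕ)) (secondTape (two q) b (τ + t * V)) T3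
        (Tape.word w t t) (Tape.word w' t t)) =
    decodeConfig two plan (.scan q ta tb ⟨v, by omega⟩
      (ok && decide (∀ u : Fin V, (u : ℕ) < v →
        pl.chk u (a.testBit (τ + t * V + u)) (two q && b.testBit (τ + t * V + u)) = true))) T0
        (Tape.word a.testBit a.size (τ + t * V + v : ℕ)) (secondTape (two q) b (τ + t * V + v)) T3
        (Tape.word w (t + if (pl.fst : ℕ) < v then 1 else 0)
          (t + if (pl.fst : ℕ) < v then 1 else 0 : ℕ))
        (Tape.word w' (t + if (pl.snd : ℕ) < v then 1 else 0)
          (t + if (pl.snd : ℕ) < v then 1 else 0 : ℕ)) := by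
  intro pl w w'
  induction v with
  | zero => simp [run]
  | succ v ih =>
    rw [run_add, ih (by omega)]
    apply run_one
    have hw (f : ℕ → Bool) (s : Fin V) (x : Bool)
        (hx : (s : ℕ) = v → x = f t) (T : Tape)
        (hT : T = Tape.word f (t + if (s : ℕ) < v then 1 else 0)
          (t + if (s : ℕ) < v then 1 else 0 : ℕ)) :
        T.act
          (if (s : ℕ) = v then (some x, Move.right) else (T.read, Move.stay)).1
          (if (s : ℕ) = v then (some x, Move.right) else (T.read, Move.stay)).2 =
        Tape.word f (t + if (s : ℕ) < v + 1 then 1 else 0)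
          (t + if (s : ℕ) < v + 1 then 1 else 0 : ℕ) := by
      by_cases hs : (s : ℕ) = v
      · have h1 : (s : ℕ) < v + 1 := by omega
        rw [if_pos hs, if_pos h1, hx hs, hT, if_neg (by omega)]
        exact Tape.act_word_push f t rfl
      · rw [if_neg hs, Tape.act_read_stay, hT]
        have : (s : ℕ) < v ↔ (s : ℕ) < v + 1 := by omega
        simp only [this]
    have hok : (ok && decide (∀ u : Fin V, (u : ℕ) < v + 1 →
        pl.chk u (a.testBit (τ + t * V + u)) (two q && b.testBit (τ + t * V + u)) = true)) =
        ((ok && decide (∀ u : Fin V, (u : ℕ) < v →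
        pl.chk u (a.testBit (τ + t * V + u)) (two q && b.testBit (τ + t * V + u)) = true)) &&
        pl.chk ⟨v, hv⟩ (a.testBit (τ + t * V + v)) (two q && b.testBit (τ + t * V + v))) := by
      rw [Bool.and_assoc]
      congr 1
      rw [Bool.eq_iff_iff, Bool.and_eq_true, decide_eq_true_iff, decide_eq_true_iff]
      constructor
      · intro h
        exact ⟨fun u hu => h u (by omega), h ⟨v, hv⟩ (Nat.lt_succ_self v)⟩
      · rintro ⟨h1, h2⟩ u hu
        rcases Nat.lt_succ_iff_lt_or_eq.1 hu with hu | hu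
        · exact h1 u hu
        · have : u = ⟨v, hv⟩ := Fin.ext hu
          subst this
          exact h2
    rw [hok]
    refine decode_step (by
        refine (dif_pos (show v < V from hv)).trans ?_
        rw [Tape.read_word_testBit, secondTape_read])
      (e1 := firstTape_act a _) (e2 := secondTape_act (two q) b _)
      (e4 := hw w pl.fst (a.testBit (τ + t * V + v)) ?_ _ rfl)
      (e5 := hw w' pl.snd (two q && b.testBit (τ + t * V + v)) ?_ _ rfl)
    · intro h
      simp only [w, h]
    · intro h
      simp only [w', h]

theorem decode_scan (q : Q) (ta tb : Fin τ → Bool) (a b L t : ℕ) (ht : t ≤ L) (T0 : Tape) :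
    let pl := plan q ta tb
    let w := fun u => a.testBit (τ + u * V + pl.fst)
    let w' := fun u => two q && b.testBit (τ + u * V + pl.snd)
    (decodeMachine (D := D) two plan).run n (t * (V + 1))
      (decodeConfig two plan (.scan q ta tb (Fin.last V) true) T0
        (Tape.word a.testBit a.size τ) (secondTape (two q) b τ) (Tape.word ones L 0)
        Tape.blank Tape.blank) =
    decodeConfig two plan (.scan q ta tb (Fin.last V)
      (decide (∀ s < t, ∀ u : Fin V,
        pl.chk u (a.testBit (τ + s * V + u)) (two q && b.testBit (τ + s * V + u)) = true))) T0
        (Tape.word a.testBit a.size (τ + t * V : ℕ)) (secondTape (two q) b (τ + t * V))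
        (Tape.word ones L t) (Tape.word w t t) (Tape.word w' t t) := by
  intro pl w w'
  induction t with
  | zero =>
    simp only [Nat.zero_mul, Nat.not_lt_zero, Nat.add_zero, Tape.word_zero, Nat.cast_zero,
      false_imp_iff, imp_true_iff, decide_true]
    rfl
  | succ t ih =>
    have hstep (ok : Bool) : (decodeMachine (D := D) two plan).step n
        (decodeConfig two plan (.scan q ta tb (Fin.last V) ok) T0
        (Tape.word a.testBit a.size (τ + t * V : ℕ)) (secondTape (two q) b (τ + t * V))
        (Tape.word ones L t) (Tape.word w t t) (Tape.word w' t t)) = some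
        (decodeConfig two plan (.scan q ta tb 0 ok) T0
        (Tape.word a.testBit a.size (τ + t * V : ℕ)) (secondTape (two q) b (τ + t * V))
        (Tape.word ones L (t + 1 : ℕ)) (Tape.word w t t) (Tape.word w' t t)) := by
      have h3 : (Tape.word ones L t).read ≠ none := by simp [show t < L from ht]
      refine decode_step ((dif_neg (lt_irrefl V)).trans (if_neg h3)) (e3 := ?_)
      simpa [Move.toInt] using Tape.act_word ones L t .right
    rw [Nat.succ_mul, run_add, ih (by omega), run_succ (hstep _)]
    refine (decode_scan_round q ta tb a b t _ V le_rfl T0 _).trans ?_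
    have hV : τ + t * V + V = τ + (t + 1) * V := by ring
    rw [hV, if_pos (Fin.is_lt _), if_pos (Fin.is_lt _)]
    congr 2
    rw [Bool.eq_iff_iff, Bool.and_eq_true, decide_eq_true_iff, decide_eq_true_iff,
      decide_eq_true_iff]
    constructor
    · rintro ⟨h1, h2⟩ s hs u
      rcases Nat.lt_succ_iff_lt_or_eq.1 hs with hs | rfl
      · exact h1 s hs u
      · exact h2 u u.2
    · intro h
      exact ⟨fun s hs => h s (by omega), fun u _ => h t (Nat.lt_succ_self t) u⟩

theorem decode_rewind (q : Q) (ta tb : Fin τ → Bool) (N N' m : ℕ) (T0 T1 T2 T3 : Tape) :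
    (decodeMachine (D := D) two plan).run n (m + 1)
      (decodeConfig two plan (.rewind q ta tb (decide (N.size ≤ m)) (decide (N'.size ≤ m)))
        T0 T1 T2 T3 (rewindTape N m) (rewindTape N' m)) =
    decodeConfig two plan (.done q ta tb) T0 T1 T2 T3 (Tape.ofNat N) (Tape.ofNat N') := by
  induction m with
  | zero =>
    apply run_one
    exact decode_step (by rw [decodeTrans, if_pos (rewindTape_zero_read N)])
      (e4 := rewindTape_zero_act N) (e5 := rewindTape_zero_act N')
  | succ m ih =>
    rw [← ih]
    have h4 : (rewindTape N (m + 1)).read ≠ none := by simp [rewindTape_read_succ]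
    exact run_succ (decode_step
      (by rw [decodeTrans, if_neg h4, rewindTape_flag, rewindTape_flag])
      (e4 := rewindTape_act N m) (e5 := rewindTape_act N' m)) _

end Decode

end RandomAccess

/-! ### The outcome of decoding -/

namespace RandomAccess

open Machine

section Decode

variable {Q R : Type} [Finite Q] {τ V D : ℕ} (two : Q → Bool)
  (plan : Q → (Fin τ → Bool) → (Fin τ → Bool) → Plan R V)

/-- The plan for the query `q` about the nodes `a` and `b`. -/
def planOf (q : Q) (a b : ℕ) : Plan R V :=
  plan q (fun j => a.testBit j) (fun j => two q && b.testBit j)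

/-- The variable `v` of the node name `a`. -/
def slot (τ V L a v : ℕ) : ℕ := natOfBits (fun u => a.testBit (τ + u * V + v)) L

/-- The node names `a` and `b` pass the digitwise checks. -/
def PassesChecks (L : ℕ) (q : Q) (a b : ℕ) : Prop :=
  a.size ≤ τ + L * V ∧ (two q = true → b.size ≤ τ + L * V) ∧ ∀ s < L, ∀ u : Fin V,
    (planOf two plan q a b).chk u (a.testBit (τ + s * V + u))
      (two q && b.testBit (τ + s * V + u)) = true

variable {two plan} {n : ℕ}

theorem decode_reaches_scan (hD : 0 < D) (q : Q) (a b : ℕ) :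
    let L := D * (n.size + 1)
    let pl := planOf two plan q a b
    let w := fun u => a.testBit (τ + u * V + pl.fst)
    let w' := fun u => two q && b.testBit (τ + u * V + pl.snd)
    (decodeMachine (D := D) two plan).run n
      ((n.size + 1) * (D + 1) + (L + 1) + (τ + 1) + L * (V + 1))
      ((decodeMachine (D := D) two plan).init q a b) =
    decodeConfig two plan (.scan q (fun j => a.testBit j) (fun j => two q && b.testBit j)
      (Fin.last V) (decide (∀ s < L, ∀ u : Fin V,
        pl.chk u (a.testBit (τ + s * V + u)) (two q && b.testBit (τ + s * V + u)) = true)))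
      Tape.blank (Tape.word a.testBit a.size (τ + L * V : ℕ)) (secondTape (two q) b (τ + L * V))
      (Tape.word ones L L) (Tape.word w L L) (Tape.word w' L L) := by
  intro L pl w w'
  -- The address word is erased while the marks are rewound, which takes long enough only if there
  -- are at least `n.size` marks; this uses `0 < D`.
  have hL : n.size ≤ L := le_trans (Nat.le_succ _) (Nat.le_mul_of_pos_left _ hD)
  rw [run_add _ n ((n.size + 1) * (D + 1) + (L + 1) + (τ + 1)),
    run_add _ n ((n.size + 1) * (D + 1) + (L + 1)) (τ + 1),
    run_add _ n ((n.size + 1) * (D + 1)) (L + 1), decode_init, decode_mark_back, decode_back q L n.size hL,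
    decode_tag_scan]
  exact decode_scan q _ _ a b L L le_rfl _

theorem decode_passes (hD : 0 < D) (q : Q) (a b : ℕ)
    (h : PassesChecks two plan (D * (n.size + 1)) q a b) :
    let L := D * (n.size + 1)
    ∃ T1 T2 T3, (two q = false → T2 = Tape.ofNat b) ∧
    (decodeMachine (D := D) two plan).run n
      ((n.size + 1) * (D + 1) + (L + 1) + (τ + 1) + L * (V + 1) + (1 + (L + 1)))
      ((decodeMachine (D := D) two plan).init q a b) =
    decodeConfig two plan (.done q (fun j => a.testBit j) (fun j => two q && b.testBit j))
      Tape.blank T1 T2 T3 (Tape.ofNat (slot τ V L a (planOf two plan q a b).fst))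
      (Tape.ofNat (natOfBits
        (fun u => two q && b.testBit (τ + u * V + (planOf two plan q a b).snd)) L)) := by
  intro L
  obtain ⟨ha, hb, hc⟩ := h
  refine ⟨Tape.word a.testBit a.size (τ + L * V : ℕ), secondTape (two q) b (τ + L * V),
    Tape.word ones L L, ?_, ?_⟩
  · intro h
    simp [secondTape, h, Tape.ofNat_eq_word]
  · rw [run_add, decode_reaches_scan hD, run_add]
    set N := slot τ V L a (planOf two plan q a b).fst
    set N' := natOfBits
      (fun u => two q && b.testBit (τ + u * V + (planOf two plan q a b).snd)) L
    have hN : decide (N.size ≤ L) = true := decide_eq_true (Nat.size_le.2 (natOfBits_lt _ _))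
    have hN' : decide (N'.size ≤ L) = true := decide_eq_true (Nat.size_le.2 (natOfBits_lt _ _))
    rw [← decode_rewind, hN, hN']
    congr 1
    apply run_one
    refine decode_step (by
      refine (dif_neg (lt_irrefl V)).trans ((if_pos ?_).trans (if_pos ⟨?_, ?_, ?_⟩))
      · exact (Tape.read_word _ _ _).trans (if_neg (lt_irrefl _))
      · rw [Tape.read_word, if_neg (not_lt.2 ha)]
      · intro h
        simp only [secondTape, h, if_true]
        rw [Tape.read_word, if_neg (not_lt.2 (hb h))]
      · exact decide_eq_true hc)
      (e4 := word_act_left_eq_rewindTape _ _) (e5 := word_act_left_eq_rewindTape _ _)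

/-- A failed check halts the machine in a scanning state. Since only `done` leads to a call, the
calling machine then halts and rejects, however long the names are. -/
theorem decode_fails (hD : 0 < D) (q : Q) (a b : ℕ)
    (h : ¬ PassesChecks two plan (D * (n.size + 1)) q a b) :
    let L := D * (n.size + 1)
    let c := (decodeMachine (D := D) two plan).run n
      ((n.size + 1) * (D + 1) + (L + 1) + (τ + 1) + L * (V + 1))
      ((decodeMachine (D := D) two plan).init q a b)
    (decodeMachine (D := D) two plan).step n c = none ∧ ∀ q ta tb, c.state ≠ .done q ta tb := by
  intro L c
  have hc : c = _ := decode_reaches_scan hD q a b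
  rw [hc]
  refine ⟨?_, fun _ _ _ h => by cases h⟩
  simp only [step, Option.map_eq_none_iff]
  refine (dif_neg (lt_irrefl V)).trans ((if_pos ?_).trans (if_neg ?_))
  · exact (Tape.read_word _ _ _).trans (if_neg (lt_irrefl _))
  · rintro ⟨h1, h2, h3⟩
    refine h ⟨?_, ?_, of_decide_eq_true h3⟩
    · by_contra hlt
      have := (Tape.read_word _ _ _).symm.trans h1
      simp [not_le.1 hlt] at this
    · intro htwo
      by_contra hlt
      have h2 : (secondTape (two q) b (τ + L * V)).read = none := h2 htwo
      simp only [secondTape, htwo, if_true] at h2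
      rw [Tape.read_word, if_pos (not_le.1 hlt)] at h2
      cases h2

end Decode

/-! ### Calling the machine of a relation after decoding -/

section Call

variable {Q R : Type} [Finite Q] [Finite R] {τ V : ℕ} (D : ℕ) (two : Q → Bool)
  (plan : Q → (Fin τ → Bool) → (Fin τ → Bool) → Plan R V)
  {QR : R → Type} (M : ∀ r, Machine (QR r)) (qR : ∀ r, QR r) (W : ℕ)

/-- Where the tapes of a called machine are found. -/
def callTape (bm : Bool) (k : ℕ) (hk : k ≤ W) (i : Fin (k + 3)) : Fin (W + 3 + 3) :=
  if (i : ℕ) = 0 then ⟨0, by omega⟩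
  else if (i : ℕ) = 1 then ⟨4, by omega⟩
  else if (i : ℕ) = 2 then (if bm then ⟨5, by omega⟩ else ⟨2, by omega⟩)
  else ⟨i + 3, by omega⟩

/-- Ensures that `Function.extend` in `callMachine` performs the actions of the called machine on
the right tapes. -/
theorem callTape_injective (bm : Bool) (k : ℕ) (hk : k ≤ W) :
    Function.Injective (callTape W bm k hk) := by
  intro i j h
  have := congrArg Fin.val h
  ext
  simp only [callTape] at this
  cases bm <;> split_ifs at this <;> simp at this <;> omega

/-- The machine that decodes node names according to the plan and then calls the machine of the
selected relation. -/
noncomputable def callMachine (hW : ∀ r, (M r).work ≤ W) : Machine Q where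
  State := DecodeState Q τ V D ⊕ (Bool × Σ r, (M r).State)
  finite_state := by
    have := fun r => (M r).finite_state
    infer_instance
  work := W + 3
  start q := Sum.inl (.mark q (Fin.last D))
  accept := {s | ∃ bm r σ, s = Sum.inr (bm, ⟨r, σ⟩) ∧ σ ∈ (M r).accept}
  trans := fun
    | Sum.inl st, ra, s =>
      match decodeTrans two plan st ra (s ⟨0, by omega⟩) (s ⟨1, by omega⟩) (s ⟨2, by omega⟩)
          (s ⟨3, by omega⟩) (s ⟨4, by omega⟩) (s ⟨5, by omega⟩) with
      | some p => some (Sum.inl p.1, fun j => if h : (j : ℕ) < 6 then p.2 ⟨j, h⟩ else (s j, .stay))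
      | none =>
        match st with
        | .done q ta tb =>
          some (Sum.inr (two q, ⟨(plan q ta tb).rel, (M _).start (qR _)⟩), fun j => (s j, .stay))
        | _ => none
    | Sum.inr (bm, ⟨r, σ⟩), ra, s =>
      ((M r).trans σ ra fun i => s (callTape W bm _ (hW r) i)).map fun p =>
        (Sum.inr (bm, ⟨r, p.1⟩),
          Function.extend (callTape W bm _ (hW r)) p.2 fun j => (s j, .stay))

variable {D two plan M qR W} {hW : ∀ r, (M r).work ≤ W} {n : ℕ}

/-- The configuration of the calling machine while it decodes. -/
def liftConfig (c : (decodeMachine (D := D) two plan).Config) :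
    (callMachine D two plan M qR W hW).Config :=
  ⟨Sum.inl c.state, fun j => if h : (j : ℕ) < 6 then c.tapes ⟨j, h⟩ else Tape.blank⟩

theorem callMachine_trans_some {st : DecodeState Q τ V D} {ra : Bool}
    {s : Fin (W + 3 + 3) → Option Bool} {s' : Fin 6 → Option Bool}
    {p : DecodeState Q τ V D × (Fin 6 → Option Bool × Move)}
    (hs : ∀ (j : ℕ) (h : j < 6), s ⟨j, by omega⟩ = s' ⟨j, h⟩)
    (h : (decodeMachine (D := D) two plan).trans st ra s' = some p) :
    (callMachine D two plan M qR W hW).trans (Sum.inl st) ra s =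
      some (Sum.inl p.1, fun j : Fin (W + 3 + 3) =>
        if h : (j : ℕ) < 6 then p.2 ⟨j, h⟩ else (s j, .stay)) := by
  have h' : decodeTrans two plan st ra (s ⟨0, by omega⟩) (s ⟨1, by omega⟩) (s ⟨2, by omega⟩)
      (s ⟨3, by omega⟩) (s ⟨4, by omega⟩) (s ⟨5, by omega⟩) = some p := by
    rw [hs 0, hs 1, hs 2, hs 3, hs 4, hs 5]
    exact h
  simp only [callMachine]
  rw [h']

theorem callMachine_trans_none {st : DecodeState Q τ V D} {ra : Bool}
    {s : Fin (W + 3 + 3) → Option Bool} {s' : Fin 6 → Option Bool}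
    (hs : ∀ (j : ℕ) (h : j < 6), s ⟨j, by omega⟩ = s' ⟨j, h⟩)
    (h : (decodeMachine (D := D) two plan).trans st ra s' = none)
    (hd : ∀ q ta tb, st ≠ .done q ta tb) :
    (callMachine D two plan M qR W hW).trans (Sum.inl st) ra s = none := by
  have h' : decodeTrans two plan st ra (s ⟨0, by omega⟩) (s ⟨1, by omega⟩) (s ⟨2, by omega⟩)
      (s ⟨3, by omega⟩) (s ⟨4, by omega⟩) (s ⟨5, by omega⟩) = none := by
    rw [hs 0, hs 1, hs 2, hs 3, hs 4, hs 5]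
    exact h
  simp only [callMachine]
  rw [h']

theorem liftConfig_tapes (c : (decodeMachine (D := D) two plan).Config) (j : ℕ) (h : j < 6)
    (h' : j < W + 3 + 3) :
    (liftConfig (M := M) (qR := qR) (hW := hW) c).tapes ⟨j, h'⟩ = c.tapes ⟨j, h⟩ := by
  simp [liftConfig, h]

theorem liftConfig_step {c c' : (decodeMachine (D := D) two plan).Config}
    (h : (decodeMachine (D := D) two plan).step n c = some c') :
    (callMachine D two plan M qR W hW).step n (liftConfig c) = some (liftConfig c') := by
  simp only [step, Option.map_eq_some_iff] at h
  obtain ⟨p, hp, rfl⟩ := h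
  have h0 := liftConfig_tapes (M := M) (qR := qR) (hW := hW) c 0 (by omega) (by omega)
  refine step_eq_some (callMachine_trans_some (s' := fun i => (c.tapes i).read) (fun j h => ?_)
    (Eq.trans ?_ hp)) ?_
  · exact congrArg Tape.read (liftConfig_tapes c j h _)
  · exact congrArg (fun T : Tape => (decodeMachine (D := D) two plan).trans c.state
      (decide (T.toAddress < n)) fun i => (c.tapes i).read) h0
  · intro i
    by_cases h : (i : ℕ) < 6
    · simp only [liftConfig, h, dite_true]
      rfl
    · simp only [liftConfig, h, dite_false]
      exact Tape.act_read_stay _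

theorem liftConfig_step_none {c : (decodeMachine (D := D) two plan).Config}
    (h : (decodeMachine (D := D) two plan).step n c = none)
    (hd : ∀ q ta tb, c.state ≠ .done q ta tb) :
    (callMachine D two plan M qR W hW).step n (liftConfig c) = none := by
  simp only [step, Option.map_eq_none_iff] at h ⊢
  have h0 := liftConfig_tapes (M := M) (qR := qR) (hW := hW) c 0 (by omega) (by omega)
  refine callMachine_trans_none (s' := fun i => (c.tapes i).read) (fun j h => ?_)
    (Eq.trans ?_ h) hd
  · exact congrArg Tape.read (liftConfig_tapes c j h _)
  · exact congrArg (fun T : Tape => (decodeMachine (D := D) two plan).trans c.state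
      (decide (T.toAddress < n)) fun i => (c.tapes i).read) h0

/-- The decoding machine idles after halting, whereas the calling machine goes on from `done`. So
the common configuration is only claimed for some `t' ≤ t`. -/
theorem liftConfig_run (t : ℕ) (c : (decodeMachine (D := D) two plan).Config) :
    ∃ t' ≤ t, (callMachine D two plan M qR W hW).run n t' (liftConfig c) =
      liftConfig ((decodeMachine (D := D) two plan).run n t c) := by
  induction t generalizing c with
  | zero => exact ⟨0, le_rfl, rfl⟩
  | succ t ih =>
    cases h : (decodeMachine (D := D) two plan).step n c with
    | none =>
      exact ⟨0, Nat.zero_le _, by rw [run_of_halted h]; rfl⟩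
    | some c' =>
      obtain ⟨t', ht', e⟩ := ih c'
      exact ⟨t' + 1, Nat.succ_le_succ ht', by rw [run_succ (liftConfig_step h), run_succ h, e]⟩

theorem liftConfig_init (q : Q) (a b : ℕ) :
    liftConfig ((decodeMachine (D := D) two plan).init q a b) =
      (callMachine D two plan M qR W hW).init q a b := by
  simp only [liftConfig, init]
  congr 1
  funext j
  by_cases h : (j : ℕ) < 6
  · simp [h]
  · simp [h, show (j : ℕ) ≠ 1 by omega, show (j : ℕ) ≠ 2 by omega]

/-- The calling machine is in the same situation as the called machine. -/
def Simulates (bm : Bool) (r : R) (c : (M r).Config)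
    (C : (callMachine D two plan M qR W hW).Config) : Prop :=
  C.state = Sum.inr (bm, ⟨r, c.state⟩) ∧
    ∀ i, C.tapes (callTape W bm _ (hW r) i) = c.tapes i

theorem Simulates.trans_eq {bm : Bool} {r : R} {c : (M r).Config}
    {C : (callMachine D two plan M qR W hW).Config} (h : Simulates bm r c C) :
    (callMachine D two plan M qR W hW).trans C.state (decide ((C.tapes 0).toAddress < n))
      (fun i => (C.tapes i).read) =
    ((M r).trans c.state (decide ((c.tapes 0).toAddress < n)) (fun i => (c.tapes i).read)).map
      fun p => (Sum.inr (bm, ⟨r, p.1⟩),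
        Function.extend (callTape W bm _ (hW r)) p.2 fun j => ((C.tapes j).read, .stay)) := by
  have h0 : C.tapes 0 = c.tapes 0 := h.2 0
  rw [h.1, h0]
  simp only [← h.2]
  rfl

theorem Simulates.step_some {bm : Bool} {r : R} {c c' : (M r).Config}
    {C : (callMachine D two plan M qR W hW).Config} (h : Simulates bm r c C)
    (hs : (M r).step n c = some c') :
    ∃ C', (callMachine D two plan M qR W hW).step n C = some C' ∧ Simulates bm r c' C' := by
  simp only [step, Option.map_eq_some_iff] at hs
  obtain ⟨p, hp, rfl⟩ := hs
  refine ⟨_, step_eq_some (h.trans_eq.trans (by rw [hp]; rfl)) (fun i => rfl), rfl, fun i => ?_⟩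
  simp only [(callTape_injective W bm _ (hW r)).extend_apply, h.2]

theorem Simulates.step_none {bm : Bool} {r : R} {c : (M r).Config}
    {C : (callMachine D two plan M qR W hW).Config} (h : Simulates bm r c C)
    (hs : (M r).step n c = none) : (callMachine D two plan M qR W hW).step n C = none := by
  simp only [step, Option.map_eq_none_iff] at hs ⊢
  rw [h.trans_eq, hs]
  rfl

theorem Simulates.run {bm : Bool} {r : R} {c : (M r).Config}
    {C : (callMachine D two plan M qR W hW).Config} (h : Simulates bm r c C) (t : ℕ) :
    Simulates bm r ((M r).run n t c) ((callMachine D two plan M qR W hW).run n t C) := by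
  induction t generalizing c C with
  | zero => exact h
  | succ t ih =>
    cases hs : (M r).step n c with
    | none => rwa [run_of_halted hs, run_of_halted (h.step_none hs)]
    | some c' =>
      obtain ⟨C', hC, h'⟩ := h.step_some hs
      rw [run_succ hs, run_succ hC]
      exact ih h'

theorem Simulates.accept_iff {bm : Bool} {r : R} {c : (M r).Config}
    {C : (callMachine D two plan M qR W hW).Config} (h : Simulates bm r c C) :
    C.state ∈ (callMachine D two plan M qR W hW).accept ↔ c.state ∈ (M r).accept := by
  rw [h.1]
  constructor
  · rintro ⟨bm', r', σ, he, hσ⟩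
    cases he
    exact hσ
  · exact fun hσ => ⟨_, _, _, rfl, hσ⟩

/-- The address tape has been cleared, the arguments have their heads on cell `0`, and the tapes
from `6` on are unused, so the called machine sees its own initial configuration. -/
theorem simulates_of_done (q : Q) (ta tb : Fin τ → Bool) (x y b : ℕ) (T1 T2 T3 : Tape)
    (hT2 : two q = false → T2 = Tape.ofNat b) :
    ∃ C, (callMachine D two plan M qR W hW).step n (liftConfig
      (decodeConfig two plan (.done q ta tb) Tape.blank T1 T2 T3 (Tape.ofNat x) (Tape.ofNat y))) =
        some C ∧
      Simulates (two q) (plan q ta tb).rel ((M _).init (qR _) x (if two q then y else b)) C := by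
  refine ⟨_, step_eq_some (by exact rfl) (fun i => Tape.act_read_stay _), rfl, ?_⟩
  intro i
  simp only [liftConfig, callTape, init]
  by_cases h0 : (i : ℕ) = 0
  · simp [h0]
  by_cases h1 : (i : ℕ) = 1
  · simp [h1]
    rfl
  by_cases h2 : (i : ℕ) = 2
  · cases h : two q
    · simp [h2]
      exact hT2 h
    · simp [h2]
      rfl
  · simp [h0, h1, h2, show ¬ ((i : ℕ) + 3 < 6) by omega]

end Call

/-- A relation between node names that is given by a plan is decided in logarithmic time. -/
theorem exists_machine_of_plan {Q R : Type} [Finite Q] [Finite R] {τ V D : ℕ} (hD : 0 < D)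
    (two : Q → Bool) (plan : Q → (Fin τ → Bool) → (Fin τ → Bool) → Plan R V)
    {rel : R → ℕ → ℕ → ℕ → Prop} (hrel : ∀ r, LogDecidable D (rel r)) :
    ∃ (M : Machine Q) (c : ℕ), ∀ n q a b, M.DecidesWithin (c * (n.size + 1)) n q a b
      (PassesChecks two plan (D * (n.size + 1)) q a b ∧
        rel (planOf two plan q a b).rel n
          (slot τ V (D * (n.size + 1)) a (planOf two plan q a b).fst)
          (if two q then slot τ V (D * (n.size + 1)) b (planOf two plan q a b).snd else b)) := by
  choose QR M qR c hM using hrel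
  obtain ⟨W, hW⟩ : ∃ W, ∀ r, (M r).work ≤ W := by
    obtain ⟨W, hW⟩ := Set.finite_range (fun r => (M r).work) |>.bddAbove
    exact ⟨W, fun r => hW ⟨r, rfl⟩⟩
  obtain ⟨K, hK⟩ : ∃ K, ∀ r, c r ≤ K := by
    obtain ⟨K, hK⟩ := Set.finite_range c |>.bddAbove
    exact ⟨K, fun r => hK ⟨r, rfl⟩⟩
  refine ⟨callMachine D two plan M qR W hW,
    (D + 1) + (D + 1) + (τ + 1) + D * (V + 1) + (D + 2) + 1 + K, fun n q a b => ?_⟩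
  by_cases hp : PassesChecks two plan (D * (n.size + 1)) q a b
  · obtain ⟨T1, T2, T3, hT2, hrun⟩ := decode_passes hD q a b hp
    obtain ⟨t, ht, hlift⟩ := liftConfig_run (M := M) (qR := qR) (hW := hW) (n := n)
      ((n.size + 1) * (D + 1) + (D * (n.size + 1) + 1) + (τ + 1) + D * (n.size + 1) * (V + 1) +
        (1 + (D * (n.size + 1) + 1))) ((decodeMachine (D := D) two plan).init q a b)
    rw [liftConfig_init, hrun] at hlift
    obtain ⟨C, hC, hsim⟩ := simulates_of_done (plan := plan) (D := D) (M := M) (qR := qR)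
      (hW := hW) (n := n) q
      (fun j => a.testBit j) (fun j => two q && b.testBit j)
      (slot τ V (D * (n.size + 1)) a (planOf two plan q a b).fst)
      (natOfBits (fun u => two q && b.testBit (τ + u * V + (planOf two plan q a b).snd))
        (D * (n.size + 1))) b T1 T2 T3 hT2
    have hy : (if two q then natOfBits (fun u => two q && b.testBit (τ + u * V +
        (planOf two plan q a b).snd)) (D * (n.size + 1)) else b) =
        if two q then slot τ V (D * (n.size + 1)) b (planOf two plan q a b).snd else b := by
      cases two q <;> simp [slot]
    rw [hy] at hsim
    have hdec := hM (planOf two plan q a b).rel n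
      (slot τ V (D * (n.size + 1)) a (planOf two plan q a b).fst)
      (if two q then slot τ V (D * (n.size + 1)) b (planOf two plan q a b).snd else b)
      (natOfBits_lt _ _)
    have hfin := hsim.run (n := n) (c (planOf two plan q a b).rel * (n.size + 1))
    refine DecidesWithin.mono
      (s := t + (1 + c (planOf two plan q a b).rel * (n.size + 1))) ?_ ?_
    · have := Nat.mul_le_mul_right (n.size + 1) (hK (planOf two plan q a b).rel)
      nlinarith [Nat.zero_le (τ * n.size)]
    · unfold DecidesWithin
      rw [run_add, hlift, run_add, run_one hC]
      refine ⟨hfin.step_none hdec.1, ?_⟩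
      rw [hfin.accept_iff]
      exact hdec.2.trans (and_iff_right hp).symm
  · have hf := decode_fails hD q a b hp
    obtain ⟨t, ht, hlift⟩ := liftConfig_run (M := M) (qR := qR) (hW := hW) (n := n)
      ((n.size + 1) * (D + 1) + (D * (n.size + 1) + 1) + (τ + 1) + D * (n.size + 1) * (V + 1))
      ((decodeMachine (D := D) two plan).init q a b)
    rw [liftConfig_init] at hlift
    refine DecidesWithin.mono (s := t) ?_ ?_
    · nlinarith [Nat.zero_le (τ * n.size), Nat.zero_le (K * (n.size + 1))]
    · unfold DecidesWithin
      rw [hlift]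
      refine ⟨liftConfig_step_none hf.1 hf.2, iff_of_false ?_ fun h => hp h.1⟩
      rintro ⟨bm, r, σ, h, -⟩
      cases h

end RandomAccess

open RandomAccess BoolCircuit

/-! First order formulas about numbers below a bound and the binary digits of the input -/

/-- Formulas in the variables `0, 1, 2, …` over numerical relations `R` and `k` inputs. -/
inductive Form (k : ℕ) (R : Type) : Type
  | rel (r : R) (i j : ℕ)
  | inp (m : Fin k) (i : ℕ)
  | neg (φ : Form k R)
  | and (φ ψ : Form k R)
  | ex (i : ℕ) (φ : Form k R)

namespace Form

variable {k : ℕ} {R : Type}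

/-- Truth of a formula; quantifiers range over the numbers below `B`. -/
def Holds (B : ℕ) (S : R → ℕ → ℕ → Prop) (x : Fin k → ℕ) : Form k R → (ℕ → ℕ) → Prop
  | rel r i j, ρ => S r (ρ i) (ρ j)
  | inp m i, ρ => (x m).testBit (ρ i) = true
  | neg φ, ρ => ¬ φ.Holds B S x ρ
  | and φ ψ, ρ => φ.Holds B S x ρ ∧ ψ.Holds B S x ρ
  | ex i φ, ρ => ∃ v < B, φ.Holds B S x (Function.update ρ i v)

/-- All variables of the formula are less than `V`. -/
def VarsLt (V : ℕ) : Form k R → Prop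
  | rel _ i j => i < V ∧ j < V
  | inp _ i => i < V
  | neg φ => φ.VarsLt V
  | and φ ψ => φ.VarsLt V ∧ ψ.VarsLt V
  | ex i φ => i < V ∧ φ.VarsLt V

theorem VarsLt.mono {V W : ℕ} (h : V ≤ W) {φ : Form k R} (hφ : φ.VarsLt V) : φ.VarsLt W := by
  induction φ with
  | rel r i j => exact ⟨hφ.1.trans_le h, hφ.2.trans_le h⟩
  | inp m i => exact lt_of_lt_of_le hφ h
  | neg φ ih => exact ih hφ
  | and φ ψ ih ih' => exact ⟨ih hφ.1, ih' hφ.2⟩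
  | ex i φ ih => exact ⟨hφ.1.trans_le h, ih hφ.2⟩

theorem exists_varsLt (φ : Form k R) : ∃ V, 0 < V ∧ φ.VarsLt V := by
  induction φ with
  | rel r i j => exact ⟨i + j + 1, by omega, by omega, by omega⟩
  | inp m i => exact ⟨i + 1, by omega, Nat.lt_succ_self i⟩
  | neg φ ih => exact ih
  | and φ ψ ih ih' =>
    obtain ⟨V, h, hV⟩ := ih
    obtain ⟨W, h', hW⟩ := ih'
    exact ⟨V + W, by omega, hV.mono (by omega), hW.mono (by omega)⟩
  | ex i φ ih =>
    obtain ⟨V, h, hV⟩ := ih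
    exact ⟨V + i + 1, by omega, by omega, hV.mono (by omega)⟩

/-- This is why a node name has to store only `V` variables. -/
theorem holds_congr {B V : ℕ} {S : R → ℕ → ℕ → Prop} {x : Fin k → ℕ} {φ : Form k R}
    (hφ : φ.VarsLt V) {ρ σ : ℕ → ℕ} (h : ∀ v < V, ρ v = σ v) :
    φ.Holds B S x ρ ↔ φ.Holds B S x σ := by
  induction φ generalizing ρ σ with
  | rel r i j => simp only [Holds, h i hφ.1, h j hφ.2]
  | inp m i => simp only [Holds, h i hφ]
  | neg φ ih => exact not_congr (ih hφ h)
  | and φ ψ ih ih' => exact and_congr (ih hφ.1 h) (ih' hφ.2 h)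
  | ex i φ ih =>
    refine exists_congr fun v => and_congr_right fun _ => ih hφ.2 fun w hw => ?_
    by_cases hwi : w = i
    · subst hwi; simp
    · simp [hwi, h w hw]

/-- The list of the subformulas. -/
def subs : Form k R → List (Form k R)
  | rel r i j => [rel r i j]
  | inp m i => [inp m i]
  | neg φ => neg φ :: φ.subs
  | and φ ψ => and φ ψ :: (φ.subs ++ ψ.subs)
  | ex i φ => ex i φ :: φ.subs

theorem self_mem_subs (φ : Form k R) : φ ∈ φ.subs := by
  cases φ <;> simp [subs]

theorem mem_subs_trans {φ ψ χ : Form k R} (h : φ ∈ ψ.subs) (h' : ψ ∈ χ.subs) : φ ∈ χ.subs := by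
  induction χ with
  | rel r i j => simp only [subs, List.mem_singleton] at h'; subst h'; exact h
  | inp m i => simp only [subs, List.mem_singleton] at h'; subst h'; exact h
  | neg χ ih =>
    simp only [subs, List.mem_cons] at h'
    rcases h' with rfl | h'
    · exact h
    · exact List.mem_cons_of_mem _ (ih h')
  | and χ χ' ih ih' =>
    simp only [subs, List.mem_cons, List.mem_append] at h'
    rcases h' with rfl | h' | h'
    · exact h
    · exact List.mem_cons_of_mem _ (List.mem_append_left _ (ih h'))
    · exact List.mem_cons_of_mem _ (List.mem_append_right _ (ih' h'))
  | ex i χ ih =>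
    simp only [subs, List.mem_cons] at h'
    rcases h' with rfl | h'
    · exact h
    · exact List.mem_cons_of_mem _ (ih h')

theorem VarsLt.of_mem_subs {V : ℕ} {φ ψ : Form k R} (hψ : ψ.VarsLt V) (h : φ ∈ ψ.subs) :
    φ.VarsLt V := by
  induction ψ with
  | rel r i j => simp only [subs, List.mem_singleton] at h; subst h; exact hψ
  | inp m i => simp only [subs, List.mem_singleton] at h; subst h; exact hψ
  | neg χ ih =>
    simp only [subs, List.mem_cons] at h
    rcases h with rfl | h
    · exact hψ
    · exact ih hψ h
  | and χ χ' ih ih' =>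
    simp only [subs, List.mem_cons, List.mem_append] at h
    rcases h with rfl | h | h
    · exact hψ
    · exact ih hψ.1 h
    · exact ih' hψ.2 h
  | ex i χ ih =>
    simp only [subs, List.mem_cons] at h
    rcases h with rfl | h
    · exact hψ
    · exact ih hψ.2 h

/-- The height of the syntax tree. -/
def rank : Form k R → ℕ
  | rel _ _ _ => 1
  | inp _ _ => 1
  | neg φ => φ.rank + 1
  | and φ ψ => max φ.rank ψ.rank + 1
  | ex _ φ => φ.rank + 1

theorem rank_pos (φ : Form k R) : 0 < φ.rank := by
  cases φ <;> simp [rank]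

theorem rank_le_of_mem_subs {φ ψ : Form k R} (h : φ ∈ ψ.subs) : φ.rank ≤ ψ.rank := by
  induction ψ with
  | rel r i j => simp only [subs, List.mem_singleton] at h; subst h; rfl
  | inp m i => simp only [subs, List.mem_singleton] at h; subst h; rfl
  | neg χ ih =>
    simp only [subs, List.mem_cons] at h
    rcases h with rfl | h
    · rfl
    · exact (ih h).trans (Nat.le_succ _)
  | and χ χ' ih ih' =>
    simp only [subs, List.mem_cons, List.mem_append] at h
    rcases h with rfl | h | h
    · rfl
    · exact (ih h).trans ((le_max_left _ _).trans (Nat.le_succ _))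
    · exact (ih' h).trans ((le_max_right _ _).trans (Nat.le_succ _))
  | ex i χ ih =>
    simp only [subs, List.mem_cons] at h
    rcases h with rfl | h
    · rfl
    · exact (ih h).trans (Nat.le_succ _)

open Classical in
/-- The number of a subformula in the list of the subformulas. -/
noncomputable def tag (φ ψ : Form k R) : ℕ := φ.subs.idxOf ψ

open Classical in
theorem tag_lt {φ ψ : Form k R} (h : ψ ∈ φ.subs) : φ.tag ψ < φ.subs.length :=
  List.idxOf_lt_length_of_mem h

open Classical in
theorem getElem?_tag {φ ψ : Form k R} (h : ψ ∈ φ.subs) : φ.subs[φ.tag ψ]? = some ψ := by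
  rw [List.getElem?_eq_getElem (tag_lt h)]
  exact congrArg some (List.getElem_idxOf _)

end Form

/-! Node names -/

section NodeName

variable {τ V L : ℕ}

theorem testBit_slot (τ V L a v u : ℕ) :
    (slot τ V L a v).testBit u = (decide (u < L) && a.testBit (τ + u * V + v)) :=
  testBit_natOfBits _ _ _

theorem slot_lt (τ V L a v : ℕ) : slot τ V L a v < 2 ^ L := natOfBits_lt _ _

theorem slot_eq_iff {a b v : ℕ} : slot τ V L a v = slot τ V L b v ↔
    ∀ u < L, a.testBit (τ + u * V + v) = b.testBit (τ + u * V + v) := by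
  constructor
  · intro h u hu
    simpa [testBit_slot, hu] using congrArg (fun x => x.testBit u) h
  · exact fun h => natOfBits_congr h

theorem slot_eq_zero_iff {a v : ℕ} : slot τ V L a v = 0 ↔
    ∀ u < L, a.testBit (τ + u * V + v) = false := by
  have h0 : slot τ V L 0 v = 0 := by
    apply Nat.eq_of_testBit_eq
    simp [testBit_slot]
  rw [← h0, slot_eq_iff]
  simp

/-- The position `p ≥ τ` holds the digit `(p - τ) / V` of the variable `(p - τ) % V`, so tag and
variables exhaust the digits. Uniqueness of names gives negation nodes their single predecessor. -/
theorem eq_of_slot_eq {a b : ℕ} (ha : a < 2 ^ (τ + L * V)) (hb : b < 2 ^ (τ + L * V))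
    (h : a % 2 ^ τ = b % 2 ^ τ) (hs : ∀ v < V, slot τ V L a v = slot τ V L b v) : a = b := by
  apply Nat.eq_of_testBit_eq
  intro p
  by_cases hp : p < τ
  · simpa [Nat.testBit_mod_two_pow, hp] using congrArg (fun x => x.testBit p) h
  by_cases hp' : p < τ + L * V
  · have hV : 0 < V := by
      rcases Nat.eq_zero_or_pos V with rfl | hV
      · omega
      · exact hV
    have := slot_eq_iff.1 (hs ((p - τ) % V) (Nat.mod_lt _ hV)) ((p - τ) / V)
      ((Nat.div_lt_iff_lt_mul hV).2 (by omega))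
    have e : τ + (p - τ) / V * V + (p - τ) % V = p := by
      have := Nat.div_add_mod' (p - τ) V
      omega
    rwa [e] at this
  · have hp' := not_lt.1 hp'
    rw [Nat.testBit_lt_two_pow (ha.trans_le (Nat.pow_le_pow_right two_pos hp')),
      Nat.testBit_lt_two_pow (hb.trans_le (Nat.pow_le_pow_right two_pos hp'))]

/-- The node name with given tag and variables. -/
def nodeName (τ V L t : ℕ) (ρ : ℕ → ℕ) : ℕ :=
  natOfBits (fun p => if p < τ then t.testBit p else (ρ ((p - τ) % V)).testBit ((p - τ) / V))
    (τ + L * V)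

theorem nodeName_lt (τ V L t : ℕ) (ρ : ℕ → ℕ) : nodeName τ V L t ρ < 2 ^ (τ + L * V) :=
  natOfBits_lt _ _

theorem nodeName_mod {t : ℕ} (ht : t < 2 ^ τ) (ρ : ℕ → ℕ) : nodeName τ V L t ρ % 2 ^ τ = t := by
  apply Nat.eq_of_testBit_eq
  intro p
  rw [Nat.testBit_mod_two_pow, nodeName, testBit_natOfBits]
  by_cases hp : p < τ
  · simp [hp, show p < τ + L * V by omega]
  · simp only [hp, decide_false, Bool.false_and]
    rw [Nat.testBit_lt_two_pow (ht.trans_le (Nat.pow_le_pow_right two_pos (not_lt.1 hp)))]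

theorem slot_nodeName {t v : ℕ} {ρ : ℕ → ℕ} (hv : v < V) (hρ : ρ v < 2 ^ L) :
    slot τ V L (nodeName τ V L t ρ) v = ρ v := by
  apply Nat.eq_of_testBit_eq
  intro u
  rw [testBit_slot, nodeName, testBit_natOfBits]
  by_cases hu : u < L
  · have h1 : τ + u * V + v < τ + L * V := by
      have := Nat.mul_le_mul_right V (show u + 1 ≤ L from hu)
      rw [Nat.succ_mul] at this
      omega
    have h2 : τ + u * V + v - τ = v + u * V := by omega
    have h3 : ¬ (τ + u * V + v < τ) := by omega
    simp [hu, h1, h2, h3, Nat.add_mul_mod_self_right, Nat.mod_eq_of_lt hv,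
      Nat.add_mul_div_right _ _ (show 0 < V by omega), Nat.div_eq_of_lt hv]
  · rw [Nat.testBit_lt_two_pow (hρ.trans_le (Nat.pow_le_pow_right two_pos (not_lt.1 hu)))]
    simp [hu]

end NodeName

/-! Evaluation of circuits -/

namespace BoolCircuit.Circuit

variable {k n : ℕ} (C : Circuit k n) (x : Fin k → ℕ)

theorem eval_and {a : Fin C.size} (h : C.label a = NodeLabel.and) :
    C.eval x a ↔ ∀ b ∈ C.pred a, C.eval x b := by
  rw [eval, WellFounded.fix_eq]
  simp only [h]

theorem eval_or {a : Fin C.size} (h : C.label a = NodeLabel.or) :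
    C.eval x a ↔ ∃ b ∈ C.pred a, C.eval x b := by
  rw [eval, WellFounded.fix_eq]
  simp only [h, exists_prop]

theorem eval_not {a : Fin C.size} (h : C.label a = NodeLabel.not) :
    C.eval x a ↔ ∃ b ∈ C.pred a, ¬ C.eval x b := by
  rw [eval, WellFounded.fix_eq]
  simp only [h, exists_prop]

theorem eval_input {a : Fin C.size} {i : Fin k} {j : Fin n} (h : C.label a = NodeLabel.input i j) :
    C.eval x a ↔ (x i).testBit j = true := by
  rw [eval, WellFounded.fix_eq]
  simp only [h]

theorem height_lt_of_mem {a b : Fin C.size} (h : b ∈ C.pred a) : C.height b < C.height a := by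
  conv_rhs => rw [height, WellFounded.fix_eq]
  exact Finset.le_sup (f := fun b : {b // b ∈ C.pred a} => C.height b.1 + 1)
    (Finset.mem_attach _ ⟨b, h⟩)

/-- Any measure that drops strictly along edges bounds the height; it is used with the rank of the
subformula. -/
theorem height_le_of_pred {μ : Fin C.size → ℕ} (h : ∀ a, ∀ b ∈ C.pred a, μ b < μ a)
    (a : Fin C.size) : C.height a ≤ μ a := by
  induction a using C.acyclic.induction with
  | _ a ih =>
    rw [height, WellFounded.fix_eq]
    exact Finset.sup_le fun b _ => (Nat.succ_le_succ (ih b.1 b.2)).trans (h a b.1 b.2)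

theorem testBit_value (j : ℕ) :
    (C.value x).testBit j = true ↔ ∃ h : j < C.numOut, C.eval x (C.out ⟨j, h⟩) := by
  classical
  have h : C.value x = natOfBits
      (fun j => decide (∃ h : j < C.numOut, C.eval x (C.out ⟨j, h⟩))) C.numOut := by
    rw [← sum_range_eq_natOfBits, Finset.sum_range, value]
    refine Finset.sum_congr rfl fun i _ => ?_
    simp
  rw [h, testBit_natOfBits, Bool.and_eq_true, decide_eq_true_iff, decide_eq_true_iff]
  exact ⟨fun h => h.2, fun h => ⟨h.1, h⟩⟩

end BoolCircuit.Circuit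

/-! The circuit of a formula -/

namespace Form

variable {k : ℕ} {R : Type} (φ : Form k R) (τ V L : ℕ) (S : R → ℕ → ℕ → Prop)

/-- The subformula to which a node belongs. -/
def formAt (a : ℕ) : Option (Form k R) := φ.subs[a % 2 ^ τ]?

/-- The nodes `a` and `b` have the same variables, except possibly for the variable `i`. -/
def SameSlots (i a b : ℕ) : Prop := ∀ v < V, v ≠ i → slot τ V L a v = slot τ V L b v

/-- The node `b` is a predecessor of the node `a`. -/
def IsPred (a b : ℕ) : Prop :=
  match φ.formAt τ a with
  | none => False
  | some (inp _ _) => False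
  | some (rel r i j) => b % 2 ^ τ = φ.subs.length ∧ SameSlots τ V L V a b ∧
      S r (slot τ V L a i) (slot τ V L a j)
  | some (neg ψ) => b % 2 ^ τ = φ.tag ψ ∧ SameSlots τ V L V a b
  | some (and ψ χ) => (b % 2 ^ τ = φ.tag ψ ∨ b % 2 ^ τ = φ.tag χ) ∧ SameSlots τ V L V a b
  | some (ex i ψ) => b % 2 ^ τ = φ.tag ψ ∧ SameSlots τ V L i a b

/-- The label of the node `a`. -/
def labelAt (n a : ℕ) : NodeLabel k n :=
  match φ.formAt τ a with
  | none => .and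
  | some (inp m i) =>
      if h : slot τ V L a i < n then .input m ⟨slot τ V L a i, h⟩ else .or
  | some (rel _ _ _) => .or
  | some (neg _) => .not
  | some (and _ _) => .and
  | some (ex _ _) => .or

/-- The rank of the node `a`. -/
def rankAt (a : ℕ) : ℕ := ((φ.formAt τ a).map rank).getD 0

variable {φ τ V L S}

theorem mem_subs_of_formAt {a : ℕ} {ψ : Form k R} (h : φ.formAt τ a = some ψ) : ψ ∈ φ.subs :=
  List.mem_of_getElem? h

theorem formAt_of_mod_eq_tag {b : ℕ} {ψ : Form k R} (hψ : ψ ∈ φ.subs)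
    (h : b % 2 ^ τ = φ.tag ψ) : φ.formAt τ b = some ψ := by
  rw [formAt, h, getElem?_tag hψ]

theorem formAt_of_mod_eq_length {b : ℕ} (h : b % 2 ^ τ = φ.subs.length) :
    φ.formAt τ b = none := by
  rw [formAt, h]
  simp

theorem neg_mem {ψ : Form k R} (h : neg ψ ∈ φ.subs) : ψ ∈ φ.subs :=
  mem_subs_trans (ψ := neg ψ) (by simp [subs, self_mem_subs]) h

theorem and_mem_left {ψ χ : Form k R} (h : and ψ χ ∈ φ.subs) : ψ ∈ φ.subs :=
  mem_subs_trans (ψ := and ψ χ) (by simp [subs, self_mem_subs]) h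

theorem and_mem_right {ψ χ : Form k R} (h : and ψ χ ∈ φ.subs) : χ ∈ φ.subs :=
  mem_subs_trans (ψ := and ψ χ) (by simp [subs, self_mem_subs]) h

theorem ex_mem {i : ℕ} {ψ : Form k R} (h : ex i ψ ∈ φ.subs) : ψ ∈ φ.subs :=
  mem_subs_trans (ψ := ex i ψ) (by simp [subs, self_mem_subs]) h

/-- One measure serves twice: it makes the circuit acyclic and bounds its depth independently of
`n`. -/
theorem IsPred.rankAt_lt {a b : ℕ} (h : IsPred φ τ V L S a b) :
    φ.rankAt τ b < φ.rankAt τ a := by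
  unfold IsPred at h
  cases ha : φ.formAt τ a with
  | none => rw [ha] at h; exact h.elim
  | some ψ =>
    rw [ha] at h
    have hm := mem_subs_of_formAt ha
    cases ψ with
    | inp m i => exact h.elim
    | rel r i j =>
      simp only [rankAt, ha, formAt_of_mod_eq_length h.1]
      exact rank_pos _
    | neg ψ =>
      simp only [rankAt, ha, formAt_of_mod_eq_tag (neg_mem hm) h.1]
      exact Nat.lt_succ_self _
    | and ψ χ =>
      rcases h.1 with h1 | h1
      · simp only [rankAt, ha, formAt_of_mod_eq_tag (and_mem_left hm) h1]
        exact Nat.lt_succ_of_le (le_max_left _ _)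
      · simp only [rankAt, ha, formAt_of_mod_eq_tag (and_mem_right hm) h1]
        exact Nat.lt_succ_of_le (le_max_right _ _)
    | ex i ψ =>
      simp only [rankAt, ha, formAt_of_mod_eq_tag (ex_mem hm) h.1]
      exact Nat.lt_succ_self _

theorem rankAt_le (a : ℕ) : φ.rankAt τ a ≤ φ.rank := by
  unfold rankAt
  cases ha : φ.formAt τ a with
  | none => exact Nat.zero_le _
  | some ψ => exact rank_le_of_mem_subs (mem_subs_of_formAt ha)

theorem tag_lt_two_pow (hτ : φ.subs.length < 2 ^ τ) {ψ : Form k R} (h : ψ ∈ φ.subs) :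
    φ.tag ψ < 2 ^ τ := (tag_lt h).trans hτ

theorem sameSlots_nodeName (t a i w : ℕ) :
    SameSlots τ V L i a (nodeName τ V L t (Function.update (slot τ V L a) i w)) := by
  intro v hv hvi
  have h : Function.update (slot τ V L a) i w v = slot τ V L a v := Function.update_of_ne hvi _ _
  rw [slot_nodeName hv (by rw [h]; exact slot_lt ..), h]

/-- The node with the tag `t` and the variables of `a`. -/
theorem exists_sameSlots {t : ℕ} (ht : t < 2 ^ τ) (a : ℕ) :
    ∃ b < 2 ^ (τ + L * V), b % 2 ^ τ = t ∧ SameSlots τ V L V a b :=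
  ⟨_, nodeName_lt .., nodeName_mod ht _,
    sameSlots_nodeName t a V 0⟩

open Classical in
/-- The circuit of a formula: its nodes are given by a subformula and the values of the
variables. -/
noncomputable def circuit (φ : Form k R) (τ V L n : ℕ) (S : R → ℕ → ℕ → Prop)
    (hτ : φ.subs.length < 2 ^ τ) : Circuit k n where
  size := 2 ^ (τ + L * V)
  label a := φ.labelAt τ V L n a
  pred a := Finset.univ.filter fun b => IsPred φ τ V L S a b
  input_pred a i j h := by
    ext b
    simp only [Finset.mem_filter, Finset.mem_univ, true_and, Finset.notMem_empty, iff_false]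
    intro hp
    unfold IsPred at hp
    unfold labelAt at h
    cases ha : φ.formAt τ a with
    | none => rw [ha] at hp; exact hp
    | some ψ =>
      rw [ha] at hp h
      cases ψ with
      | inp m i => exact hp
      | _ => cases h
  not_pred a h := by
    unfold labelAt at h
    cases ha : φ.formAt τ a with
    | none => rw [ha] at h; cases h
    | some ψ =>
      rw [ha] at h
      cases ψ with
      | neg ψ =>
        have ht := tag_lt_two_pow hτ (neg_mem (mem_subs_of_formAt ha))
        obtain ⟨b, hb, hbt, hbs⟩ := exists_sameSlots (V := V) (L := L) ht a
        -- The predecessor has a prescribed tag and the same value of every variable below `V`,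
        -- hence a prescribed name.
        refine Finset.card_eq_one.2 ⟨⟨b, hb⟩, ?_⟩
        ext c
        simp only [Finset.mem_filter, Finset.mem_univ, true_and, Finset.mem_singleton, IsPred, ha]
        constructor
        · rintro ⟨hct, hcs⟩
          refine Fin.ext (eq_of_slot_eq c.2 hb (hct.trans hbt.symm) fun v hv => ?_)
          rw [← hcs v hv hv.ne, hbs v hv hv.ne]
        · rintro rfl
          exact ⟨hbt, hbs⟩
      | inp m i =>
        simp only at h
        split_ifs at h
      | _ => cases h
  acyclic := by
    refine Subrelation.wf ?_
      (measure fun a : Fin (2 ^ (τ + L * V)) => φ.rankAt τ a).wf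
    intro b a h
    exact IsPred.rankAt_lt (Finset.mem_filter.1 h).2
  numOut := 2 ^ L
  out j := ⟨nodeName τ V L (φ.tag φ) (fun v => if v = 0 then j else 0), nodeName_lt ..⟩

theorem mem_pred_circuit {n : ℕ} {hτ : φ.subs.length < 2 ^ τ}
    {a b : Fin (circuit φ τ V L n S hτ).size} :
    b ∈ (circuit φ τ V L n S hτ).pred a ↔ IsPred φ τ V L S a b := by
  classical
  exact Finset.mem_filter.trans (and_iff_right (Finset.mem_univ _))

theorem depth_circuit_le (n : ℕ) (hτ : φ.subs.length < 2 ^ τ) :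
    (circuit φ τ V L n S hτ).depth ≤ φ.rank := by
  refine Finset.sup_le fun a _ => ?_
  refine (Circuit.height_le_of_pred _ (μ := fun a => φ.rankAt τ a) ?_ a).trans (rankAt_le _)
  exact fun a b h => (mem_pred_circuit.1 h).rankAt_lt

/-- By induction on the subformula. An existential node ranges over all names that differ in one
variable only. An atom is a disjunction that has a constant `1` as predecessor if the relation holds
and no predecessor otherwise. -/
theorem eval_circuit {n : ℕ} (hτ : φ.subs.length < 2 ^ τ) (hV : φ.VarsLt V) (x : Fin k → ℕ)
    (hx : ∀ i, x i < 2 ^ n) (ψ : Form k R) (a : Fin (circuit φ τ V L n S hτ).size)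
    (ha : φ.formAt τ a = some ψ) :
    (circuit φ τ V L n S hτ).eval x a ↔ ψ.Holds (2 ^ L) S x (slot τ V L a) := by
  have hm := mem_subs_of_formAt ha
  have hψ := hV.of_mem_subs hm
  have hlabel : (circuit φ τ V L n S hτ).label a = φ.labelAt τ V L n a := rfl
  induction ψ generalizing a with
  | inp m i =>
    simp only [labelAt, ha] at hlabel
    by_cases hi : slot τ V L a i < n
    · rw [dif_pos hi] at hlabel
      exact Circuit.eval_input _ x hlabel
    · rw [dif_neg hi] at hlabel
      rw [Circuit.eval_or _ x hlabel]
      refine iff_of_false ?_ ?_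
      · rintro ⟨b, hb, -⟩
        rw [mem_pred_circuit, IsPred, ha] at hb
        exact hb
      · simp only [Holds]
        -- A position outside the `n` input digits is labelled as an empty disjunction, which
        -- matches the missing digit.
        rw [Nat.testBit_lt_two_pow ((hx m).trans_le (Nat.pow_le_pow_right two_pos (not_lt.1 hi)))]
        simp
  | rel r i j =>
    simp only [labelAt, ha] at hlabel
    rw [Circuit.eval_or _ x hlabel]
    constructor
    · rintro ⟨b, hb, -⟩
      rw [mem_pred_circuit, IsPred, ha] at hb
      exact hb.2.2
    · intro h
      obtain ⟨b, hb, hbt, hbs⟩ := exists_sameSlots (V := V) (L := L) hτ a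
      refine ⟨⟨b, hb⟩, ?_, ?_⟩
      · rw [mem_pred_circuit, IsPred, ha]
        exact ⟨hbt, hbs, h⟩
      · have hn := formAt_of_mod_eq_length hbt
        have hl : (circuit φ τ V L n S hτ).label ⟨b, hb⟩ = .and := by
          change φ.labelAt τ V L n b = _
          rw [labelAt, hn]
        rw [Circuit.eval_and _ x hl]
        intro c hc
        rw [mem_pred_circuit, IsPred, hn] at hc
        exact hc.elim
  | neg ψ ih =>
    simp only [labelAt, ha] at hlabel
    have hm' := neg_mem hm
    rw [Circuit.eval_not _ x hlabel]
    have key (b : Fin (circuit φ τ V L n S hτ).size) (hbt : b % 2 ^ τ = φ.tag ψ)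
        (hbs : SameSlots τ V L V a b) : (circuit φ τ V L n S hτ).eval x b ↔
          ψ.Holds (2 ^ L) S x (slot τ V L a) := by
      refine (ih b (formAt_of_mod_eq_tag hm' hbt) hm' hψ rfl).trans ?_
      exact holds_congr (φ := ψ) hψ fun v hv => (hbs v hv hv.ne).symm
    constructor
    · rintro ⟨b, hb, hbe⟩
      rw [mem_pred_circuit, IsPred, ha] at hb
      exact fun h => hbe ((key b hb.1 hb.2).2 h)
    · intro h
      obtain ⟨b, hb, hbt, hbs⟩ := exists_sameSlots (V := V) (L := L) (tag_lt_two_pow hτ hm') a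
      refine ⟨⟨b, hb⟩, ?_, fun hbe => h ((key ⟨b, hb⟩ hbt hbs).1 hbe)⟩
      rw [mem_pred_circuit, IsPred, ha]
      exact ⟨hbt, hbs⟩
  | and ψ χ ih ih' =>
    simp only [labelAt, ha] at hlabel
    have hm1 := and_mem_left hm
    have hm2 := and_mem_right hm
    rw [Circuit.eval_and _ x hlabel]
    have key1 (b : Fin (circuit φ τ V L n S hτ).size) (hbt : b % 2 ^ τ = φ.tag ψ)
        (hbs : SameSlots τ V L V a b) : (circuit φ τ V L n S hτ).eval x b ↔
          ψ.Holds (2 ^ L) S x (slot τ V L a) := by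
      refine (ih b (formAt_of_mod_eq_tag hm1 hbt) hm1 hψ.1 rfl).trans ?_
      exact holds_congr hψ.1 fun v hv => (hbs v hv hv.ne).symm
    have key2 (b : Fin (circuit φ τ V L n S hτ).size) (hbt : b % 2 ^ τ = φ.tag χ)
        (hbs : SameSlots τ V L V a b) : (circuit φ τ V L n S hτ).eval x b ↔
          χ.Holds (2 ^ L) S x (slot τ V L a) := by
      refine (ih' b (formAt_of_mod_eq_tag hm2 hbt) hm2 hψ.2 rfl).trans ?_
      exact holds_congr hψ.2 fun v hv => (hbs v hv hv.ne).symm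
    constructor
    · intro h
      obtain ⟨b, hb, hbt, hbs⟩ := exists_sameSlots (V := V) (L := L) (tag_lt_two_pow hτ hm1) a
      obtain ⟨c, hc, hct, hcs⟩ := exists_sameSlots (V := V) (L := L) (tag_lt_two_pow hτ hm2) a
      refine ⟨(key1 ⟨b, hb⟩ hbt hbs).1 (h _ ?_), (key2 ⟨c, hc⟩ hct hcs).1 (h _ ?_)⟩
      · rw [mem_pred_circuit, IsPred, ha]
        exact ⟨Or.inl hbt, hbs⟩
      · rw [mem_pred_circuit, IsPred, ha]
        exact ⟨Or.inr hct, hcs⟩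
    · rintro ⟨h1, h2⟩ b hb
      rw [mem_pred_circuit, IsPred, ha] at hb
      rcases hb with ⟨hbt | hbt, hbs⟩
      · exact (key1 b hbt hbs).2 h1
      · exact (key2 b hbt hbs).2 h2
  | ex i ψ ih =>
    simp only [labelAt, ha] at hlabel
    have hm' := ex_mem hm
    rw [Circuit.eval_or _ x hlabel]
    have key (b : Fin (circuit φ τ V L n S hτ).size) (hbt : b % 2 ^ τ = φ.tag ψ)
        (hbs : SameSlots τ V L i a b) : (circuit φ τ V L n S hτ).eval x b ↔
          ψ.Holds (2 ^ L) S x (Function.update (slot τ V L a) i (slot τ V L b i)) := by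
      refine (ih b (formAt_of_mod_eq_tag hm' hbt) hm' hψ.2 rfl).trans ?_
      refine holds_congr hψ.2 fun v hv => ?_
      by_cases hvi : v = i
      · subst hvi; simp
      · rw [Function.update_of_ne hvi, hbs v hv hvi]
    constructor
    · rintro ⟨b, hb, hbe⟩
      rw [mem_pred_circuit, IsPred, ha] at hb
      exact ⟨slot τ V L b i, slot_lt .., (key b hb.1 hb.2).1 hbe⟩
    · rintro ⟨w, hw, h⟩
      have ht := tag_lt_two_pow hτ hm'
      have hb := nodeName_lt τ V L (φ.tag ψ) (Function.update (slot τ V L a) i w)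
      have hbs := sameSlots_nodeName (τ := τ) (V := V) (L := L) (φ.tag ψ) a i w
      have hbi : slot τ V L (nodeName τ V L (φ.tag ψ) (Function.update (slot τ V L a) i w)) i = w := by
        rw [slot_nodeName hψ.1 (by simpa using hw)]
        simp
      refine ⟨⟨_, hb⟩, ?_, (key ⟨_, hb⟩ (nodeName_mod ht _) hbs).2 ?_⟩
      · rw [mem_pred_circuit, IsPred, ha]
        exact ⟨nodeName_mod ht _, hbs⟩
      · rwa [hbi]

theorem out_circuit {n : ℕ} (hτ : φ.subs.length < 2 ^ τ)
    (j : Fin (circuit φ τ V L n S hτ).numOut) : ((circuit φ τ V L n S hτ).out j : ℕ) =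
      nodeName τ V L (φ.tag φ) (fun v => if v = 0 then (j : ℕ) else 0) := rfl

theorem testBit_value_circuit {n : ℕ} (hτ : φ.subs.length < 2 ^ τ) (hV : φ.VarsLt V)
    (x : Fin k → ℕ) (hx : ∀ i, x i < 2 ^ n) (j : ℕ) :
    ((circuit φ τ V L n S hτ).value x).testBit j = true ↔
      j < 2 ^ L ∧ φ.Holds (2 ^ L) S x (fun v => if v = 0 then j else 0) := by
  rw [Circuit.testBit_value]
  have h (j : Fin (circuit φ τ V L n S hτ).numOut) : (circuit φ τ V L n S hτ).eval x
      ((circuit φ τ V L n S hτ).out j) ↔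
      φ.Holds (2 ^ L) S x (fun v => if v = 0 then (j : ℕ) else 0) := by
    have hj : (j : ℕ) < 2 ^ L := j.2
    have hmod : ((circuit φ τ V L n S hτ).out j : ℕ) % 2 ^ τ = φ.tag φ := by
      rw [out_circuit]
      exact nodeName_mod (tag_lt_two_pow hτ φ.self_mem_subs) _
    refine (eval_circuit hτ hV x hx φ _ (formAt_of_mod_eq_tag φ.self_mem_subs hmod)).trans ?_
    refine holds_congr hV fun v hv => ?_
    rw [out_circuit]
    refine slot_nodeName hv ?_
    split_ifs
    · exact hj
    · exact Nat.two_pow_pos L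
  have hn : (circuit φ τ V L n S hτ).numOut = 2 ^ L := rfl
  constructor
  · rintro ⟨hj, he⟩
    exact ⟨hn ▸ hj, (h ⟨j, hj⟩).1 he⟩
  · rintro ⟨hj, he⟩
    exact ⟨hn ▸ hj, (h ⟨j, hn ▸ hj⟩).2 he⟩

end Form

/-! The circuit of a formula is uniform -/

instance (k : ℕ) : Finite (Query k) := by
  let f : Fin k ⊕ Fin 5 → Query k := fun
    | .inl i => .input i
    | .inr 0 => .and
    | .inr 1 => .or
    | .inr 2 => .not
    | .inr 3 => .output
    | .inr 4 => .pred
  refine Finite.of_surjective f fun q => ?_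
  cases q with
  | and => exact ⟨.inr 0, rfl⟩
  | or => exact ⟨.inr 1, rfl⟩
  | not => exact ⟨.inr 2, rfl⟩
  | input i => exact ⟨.inl i, rfl⟩
  | output => exact ⟨.inr 3, rfl⟩
  | pred => exact ⟨.inr 4, rfl⟩

namespace Form

variable {k : ℕ} {R : Type}

/-- The relations `S` together with all relations `q (compare a b) (a < n)`. -/
def withCompare (S : R → ℕ → ℕ → ℕ → Prop) :
    R ⊕ (Ordering → Bool → Bool) → ℕ → ℕ → ℕ → Prop
  | .inl r => S r
  | .inr q => fun n a b => q (compare a b) (decide (a < n)) = true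

/-- Only predecessor queries are about two nodes. -/
def twoNodes : Query k → Bool
  | .pred => true
  | _ => false

section Plan

variable {V : ℕ} (hV0 : 0 < V)

/-- The variable `i`. -/
def varIdx (i : ℕ) : Fin V := if h : i < V then ⟨i, h⟩ else ⟨0, hV0⟩

theorem varIdx_val {i : ℕ} (h : i < V) : (varIdx hV0 i : ℕ) = i := by simp [varIdx, h]

/-- The plan for a constant answer. -/
def constPlan (c : Bool) : Plan (R ⊕ (Ordering → Bool → Bool)) V :=
  ⟨fun _ _ _ => true, varIdx hV0 0, varIdx hV0 0, .inr fun _ _ => c⟩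

/-- The plan that compares the variable `i`. -/
def comparePlan (i : ℕ) (q : Ordering → Bool → Bool) : Plan (R ⊕ (Ordering → Bool → Bool)) V :=
  ⟨fun _ _ _ => true, varIdx hV0 i, varIdx hV0 0, .inr q⟩

/-- The plan that asks for equal variables, with the possible exception of the variable `e`. -/
def samePlan (e i j : ℕ) (r : R ⊕ (Ordering → Bool → Bool)) :
    Plan (R ⊕ (Ordering → Bool → Bool)) V :=
  ⟨fun v x y => decide ((v : ℕ) = e) || x == y, varIdx hV0 i, varIdx hV0 j, r⟩

/-- The plan that asks whether a node is an output node. -/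
def outputPlan : Plan (R ⊕ (Ordering → Bool → Bool)) V :=
  ⟨fun v x _ => decide ((v : ℕ) = 0) || !x, varIdx hV0 0, varIdx hV0 0, .inr fun o _ => o == .eq⟩

/-- How to answer the query `q` about nodes with the tags `s` and `t`. -/
noncomputable def nodePlan (φ : Form k R) (q : Query k) (s t : ℕ) :
    Plan (R ⊕ (Ordering → Bool → Bool)) V :=
  match q, φ.subs[s]? with
  | .and, none => constPlan hV0 true
  | .and, some (and _ _) => constPlan hV0 true
  | .or, some (rel _ _ _) => constPlan hV0 true
  | .or, some (ex _ _) => constPlan hV0 true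
  | .or, some (inp _ i) => comparePlan hV0 i fun _ c => !c
  | .not, some (neg _) => constPlan hV0 true
  | .input m', some (inp m i) =>
    if m = m' then comparePlan hV0 i fun o c => o == .eq && c else constPlan hV0 false
  | .output, _ => if s = φ.tag φ then outputPlan hV0 else constPlan hV0 false
  | .pred, some (rel r i j) =>
    if t = φ.subs.length then samePlan hV0 V i j (.inl r) else constPlan hV0 false
  | .pred, some (neg ψ) =>
    if t = φ.tag ψ then samePlan hV0 V 0 0 (.inr fun _ _ => true) else constPlan hV0 false
  | .pred, some (and ψ χ) =>
    if t = φ.tag ψ ∨ t = φ.tag χ then samePlan hV0 V 0 0 (.inr fun _ _ => true)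
    else constPlan hV0 false
  | .pred, some (ex i ψ) =>
    if t = φ.tag ψ then samePlan hV0 i 0 0 (.inr fun _ _ => true) else constPlan hV0 false
  | _, _ => constPlan hV0 false

/-- The nodes pass the checks of a plan and satisfy its relation. -/
def PlanHolds (S : R → ℕ → ℕ → ℕ → Prop) (τ L n : ℕ) (two : Bool)
    (pl : Plan (R ⊕ (Ordering → Bool → Bool)) V) (a b : ℕ) : Prop :=
  (∀ s < L, ∀ u : Fin V,
    pl.chk u (a.testBit (τ + s * V + u)) (two && b.testBit (τ + s * V + u)) = true) ∧
  withCompare S pl.rel n (slot τ V L a pl.fst) (if two then slot τ V L b pl.snd else b)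

variable {S : R → ℕ → ℕ → ℕ → Prop} {τ L n : ℕ} {two : Bool} {a b : ℕ}

theorem planHolds_const {c : Bool} :
    PlanHolds S τ L n two (constPlan hV0 c) a b ↔ c = true := by
  simp [PlanHolds, constPlan, withCompare]

theorem planHolds_compare {i : ℕ} (hi : i < V) {q : Ordering → Bool → Bool} :
    PlanHolds S τ L n false (comparePlan hV0 i q) a b ↔
      q (compare (slot τ V L a i) b) (decide (slot τ V L a i < n)) = true := by
  simp [PlanHolds, comparePlan, withCompare, varIdx_val hV0 hi]

theorem planHolds_same {e i j : ℕ} {r : R ⊕ (Ordering → Bool → Bool)} :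
    PlanHolds S τ L n true (samePlan hV0 e i j r) a b ↔ SameSlots τ V L e a b ∧
      withCompare S r n (slot τ V L a (varIdx hV0 i)) (slot τ V L b (varIdx hV0 j)) := by
  unfold PlanHolds samePlan
  refine and_congr ?_ (by simp)
  simp only [Bool.true_and, Bool.or_eq_true, decide_eq_true_iff, beq_iff_eq]
  constructor
  · intro h v hv hve
    exact slot_eq_iff.2 fun u hu => (h u hu ⟨v, hv⟩).resolve_left hve
  · intro h s hs u
    by_cases hu : (u : ℕ) = e
    · exact Or.inl hu
    · exact Or.inr (slot_eq_iff.1 (h u u.2 hu) s hs)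

theorem planHolds_output :
    PlanHolds S τ L n false (outputPlan hV0) a b ↔
      (∀ v < V, v ≠ 0 → slot τ V L a v = 0) ∧ slot τ V L a 0 = b := by
  unfold PlanHolds outputPlan
  refine and_congr ?_ (by simp [withCompare, varIdx_val hV0 hV0])
  simp only [Bool.or_eq_true, decide_eq_true_iff, Bool.not_eq_true']
  constructor
  · intro h v hv hve
    exact slot_eq_zero_iff.2 fun u hu => (h u hu ⟨v, hv⟩).resolve_left hve
  · intro h s hs u
    by_cases hu : (u : ℕ) = 0
    · exact Or.inl hu
    · exact Or.inr (slot_eq_zero_iff.1 (h u u.2 hu) s hs)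

end Plan

section Connection

variable {V τ L n : ℕ} {S : R → ℕ → ℕ → ℕ → Prop} {φ : Form k R} (hV0 : 0 < V)

theorem label_iff {q : NodeLabel k n} (a : ℕ) (hτ : φ.subs.length < 2 ^ τ) :
    (∃ ha : a < (circuit φ τ V L n (fun r => S r n) hτ).size,
      (circuit φ τ V L n (fun r => S r n) hτ).label ⟨a, ha⟩ = q) ↔
    a < 2 ^ (τ + L * V) ∧ φ.labelAt τ V L n a = q :=
  ⟨fun ⟨h, e⟩ => ⟨h, e⟩, fun ⟨h, e⟩ => ⟨h, e⟩⟩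

/-- Once the finitely many tags are known, every question about the circuit reduces to digitwise
checks and one relation between a variable of `a` and either a variable of `b` or the number `b`
itself. -/
theorem connection_circuit (hτ : φ.subs.length < 2 ^ τ) (hV : φ.VarsLt V) (q : Query k)
    (a b : ℕ) :
    (circuit φ τ V L n (fun r => S r n) hτ).Connection q a b ↔
      a < 2 ^ (τ + L * V) ∧ (twoNodes q = true → b < 2 ^ (τ + L * V)) ∧
      PlanHolds S τ L n (twoNodes q)
        (nodePlan hV0 φ q (a % 2 ^ τ) (if twoNodes q then b % 2 ^ τ else 0)) a b := by
  cases q with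
  | and =>
    refine (label_iff a hτ).trans (and_congr_right fun _ => ?_)
    simp only [twoNodes, Bool.false_eq_true, false_imp_iff, true_and, if_false]
    rw [labelAt]
    cases hA : φ.formAt τ a with
    | none =>
      have hA' : φ.subs[a % 2 ^ τ]? = none := hA
      simp [nodePlan, hA', planHolds_const]
    | some ψ =>
      have hA' : φ.subs[a % 2 ^ τ]? = some ψ := hA
      cases ψ with
      | inp m i =>
        simp only [nodePlan, hA', planHolds_const]
        split_ifs <;> simp
      | _ => simp [nodePlan, hA', planHolds_const]
  | or =>
    refine (label_iff a hτ).trans (and_congr_right fun _ => ?_)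
    simp only [twoNodes, Bool.false_eq_true, false_imp_iff, true_and, if_false]
    rw [labelAt]
    cases hA : φ.formAt τ a with
    | none =>
      have hA' : φ.subs[a % 2 ^ τ]? = none := hA
      simp [nodePlan, hA', planHolds_const]
    | some ψ =>
      have hA' : φ.subs[a % 2 ^ τ]? = some ψ := hA
      cases ψ with
      | inp m i =>
        have hi : i < V := hV.of_mem_subs (mem_subs_of_formAt hA)
        simp only [nodePlan, hA', planHolds_compare hV0 hi]
        split_ifs with h <;> simp [h]
      | _ => simp [nodePlan, hA', planHolds_const]
  | not =>
    refine (label_iff a hτ).trans (and_congr_right fun _ => ?_)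
    simp only [twoNodes, Bool.false_eq_true, false_imp_iff, true_and, if_false]
    rw [labelAt]
    cases hA : φ.formAt τ a with
    | none =>
      have hA' : φ.subs[a % 2 ^ τ]? = none := hA
      simp [nodePlan, hA', planHolds_const]
    | some ψ =>
      have hA' : φ.subs[a % 2 ^ τ]? = some ψ := hA
      cases ψ with
      | inp m i =>
        simp only [nodePlan, hA', planHolds_const]
        split_ifs <;> simp
      | _ => simp [nodePlan, hA', planHolds_const]
  | input m' =>
    have h1 : (circuit φ τ V L n (fun r => S r n) hτ).Connection (.input m') a b ↔
        a < 2 ^ (τ + L * V) ∧ ∃ hb : b < n, φ.labelAt τ V L n a = .input m' ⟨b, hb⟩ :=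
      ⟨fun ⟨ha, hb, e⟩ => ⟨ha, hb, e⟩, fun ⟨ha, hb, e⟩ => ⟨ha, hb, e⟩⟩
    refine h1.trans (and_congr_right fun _ => ?_)
    simp only [twoNodes, Bool.false_eq_true, false_imp_iff, true_and, if_false]
    rw [labelAt]
    cases hA : φ.formAt τ a with
    | none =>
      have hA' : φ.subs[a % 2 ^ τ]? = none := hA
      simp [nodePlan, hA', planHolds_const]
    | some ψ =>
      have hA' : φ.subs[a % 2 ^ τ]? = some ψ := hA
      cases ψ with
      | inp m i =>
        have hi : i < V := hV.of_mem_subs (mem_subs_of_formAt hA)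
        simp only [nodePlan, hA']
        by_cases hm : m = m'
        · subst hm
          rw [if_pos rfl, planHolds_compare hV0 hi]
          simp only [Bool.and_eq_true, beq_iff_eq, decide_eq_true_iff, Nat.compare_eq_eq]
          split_ifs with h
          · simp only [NodeLabel.input.injEq, Fin.mk.injEq, true_and, h, and_true]
            exact ⟨fun ⟨_, e⟩ => e, fun e => ⟨e ▸ h, e⟩⟩
          · simp [h]
        · rw [if_neg hm, planHolds_const]
          split_ifs <;> simp [hm]
      | _ => simp [nodePlan, hA', planHolds_const]
  | output =>
    simp only [twoNodes, Bool.false_eq_true, false_imp_iff, true_and, if_false]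
    have h1 : (circuit φ τ V L n (fun r => S r n) hτ).Connection .output a b ↔
        b < 2 ^ L ∧ nodeName τ V L (φ.tag φ) (fun v => if v = 0 then b else 0) = a :=
      ⟨fun ⟨hb, e⟩ => ⟨hb, e⟩, fun ⟨hb, e⟩ => ⟨hb, e⟩⟩
    have ht := tag_lt_two_pow hτ φ.self_mem_subs
    have hslot (hb : b < 2 ^ L) (v : ℕ) (hv : v < V) :
        slot τ V L (nodeName τ V L (φ.tag φ) (fun v => if v = 0 then b else 0)) v =
          if v = 0 then b else 0 := by
      refine slot_nodeName hv ?_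
      split_ifs
      · exact hb
      · exact Nat.two_pow_pos L
    have hnp (t : ℕ) : (nodePlan hV0 φ .output (a % 2 ^ τ) t) =
        if a % 2 ^ τ = φ.tag φ then outputPlan hV0 else constPlan hV0 false := by
      simp only [nodePlan]
    rw [h1, hnp]
    constructor
    · rintro ⟨hb, rfl⟩
      refine ⟨nodeName_lt .., ?_⟩
      rw [if_pos (nodeName_mod ht _), planHolds_output]
      refine ⟨fun v hv hv0 => ?_, ?_⟩
      · rw [hslot hb v hv, if_neg hv0]
      · rw [hslot hb 0 hV0, if_pos rfl]
    · rintro ⟨ha, h⟩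
      split_ifs at h with hs
      · rw [planHolds_output] at h
        have hb : b < 2 ^ L := h.2 ▸ slot_lt ..
        refine ⟨hb, eq_of_slot_eq (nodeName_lt ..) ha ((nodeName_mod ht _).trans hs.symm) ?_⟩
        intro v hv
        rw [hslot hb v hv]
        split_ifs with hv0
        · rw [hv0, h.2]
        · exact (h.1 v hv hv0).symm
      · rw [planHolds_const] at h
        cases h
  | pred =>
    have h1 : (circuit φ τ V L n (fun r => S r n) hτ).Connection .pred a b ↔
        a < 2 ^ (τ + L * V) ∧ b < 2 ^ (τ + L * V) ∧ IsPred φ τ V L (fun r => S r n) a b :=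
      ⟨fun ⟨ha, hb, e⟩ => ⟨ha, hb, mem_pred_circuit.1 e⟩,
        fun ⟨ha, hb, e⟩ => ⟨ha, hb, mem_pred_circuit.2 e⟩⟩
    refine h1.trans (and_congr_right fun _ => ?_)
    simp only [twoNodes, true_imp_iff, if_true]
    refine and_congr_right fun _ => ?_
    rw [IsPred]
    cases hA : φ.formAt τ a with
    | none =>
      have hA' : φ.subs[a % 2 ^ τ]? = none := hA
      simp [nodePlan, hA', planHolds_const]
    | some ψ =>
      have hA' : φ.subs[a % 2 ^ τ]? = some ψ := hA
      cases ψ with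
      | inp m i => simp [nodePlan, hA', planHolds_const]
      | rel r i j =>
        have hij := hV.of_mem_subs (mem_subs_of_formAt hA)
        simp only [nodePlan, hA']
        split_ifs with h
        · rw [planHolds_same, varIdx_val hV0 hij.1, varIdx_val hV0 hij.2]
          simp only [h, true_and]
          refine and_congr_right fun hs => ?_
          -- The machine extracts one variable from each name, so the second argument of the
          -- relation is read off `b`. This is why the constant node below an atom repeats the
          -- variables of `a`.
          rw [hs j hij.2 hij.2.ne]
          rfl
        · simp [h, planHolds_const]
      | neg ψ =>
        simp only [nodePlan, hA']
        split_ifs with h <;> simp [h, planHolds_const, planHolds_same, withCompare]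
      | and ψ χ =>
        simp only [nodePlan, hA']
        split_ifs with h
        · rw [planHolds_same]
          simp [h, withCompare]
        · rw [planHolds_const]
          simp [h]
      | ex i ψ =>
        simp only [nodePlan, hA']
        split_ifs with h <;> simp [h, planHolds_const, planHolds_same, withCompare]

end Connection

theorem exists_machine_circuit {D : ℕ} (hD : 0 < D) [Finite R] {S : R → ℕ → ℕ → ℕ → Prop}
    (hS : ∀ r, LogDecidable D (S r)) {φ : Form k R} {V τ : ℕ} (hV0 : 0 < V)
    (hτ : φ.subs.length < 2 ^ τ) (hV : φ.VarsLt V) :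
    ∃ (M : Machine (Query k)) (c : ℕ), ∀ n q a b,
      M.DecidesWithin (c * (n.size + 1)) n q a b
        ((circuit φ τ V (D * (n.size + 1)) n (fun r => S r n) hτ).Connection q a b) := by
  have hrel : ∀ r, LogDecidable D (withCompare S r) := by
    rintro (r | q)
    · exact hS r
    · exact logDecidable_compare D q
  obtain ⟨M, c, hM⟩ := exists_machine_of_plan hD (twoNodes (k := k))
    (fun q (ta tb : Fin τ → Bool) => nodePlan hV0 φ q (Nat.ofBits ta) (Nat.ofBits tb)) hrel
  refine ⟨M, c, fun n q a b => ?_⟩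
  convert hM n q a b using 1
  rw [connection_circuit hV0 hτ hV]
  have hplan : planOf (twoNodes (k := k))
      (fun q (ta tb : Fin τ → Bool) => nodePlan hV0 φ q (Nat.ofBits ta) (Nat.ofBits tb)) q a b =
      nodePlan hV0 φ q (a % 2 ^ τ) (if twoNodes q then b % 2 ^ τ else 0) := by
    unfold planOf
    dsimp only
    rw [Nat.ofBits_testBit]
    congr 1
    -- If the query concerns one node, the machine does not read `b`, and all digits of its tag
    -- count as `0`.
    cases twoNodes q
    · apply Nat.eq_of_testBit_eq
      intro i
      simp [Nat.testBit_ofBits]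
    · simp [Nat.ofBits_testBit]
  unfold PassesChecks PlanHolds
  rw [hplan, Nat.size_le, Nat.size_le]
  simp only [and_assoc]

end Form

/-! ### Definability with polynomially bounded quantifiers -/

section Definability

/-- For `n ≥ 2` one has `2 ^ n.size ≤ 2 * n ≤ n ^ 2`; the additive constant takes care of `n < 2`.
-/
theorem exists_two_pow_size_le (α β : ℕ) : ∃ c, ∀ n : ℕ, 2 ^ (α + β * n.size) ≤ n ^ c + c := by
  refine ⟨α + 2 * β + 2 ^ (α + β), fun n => ?_⟩
  rcases Nat.lt_or_ge n 2 with hn | hn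
  · have hs : n.size ≤ 1 := Nat.size_le.2 (by omega)
    have : 2 ^ (α + β * n.size) ≤ 2 ^ (α + β) :=
      Nat.pow_le_pow_right two_pos (by nlinarith)
    omega
  · have h1 : 2 ^ n.size ≤ n ^ 2 := by
      have h0 : 0 < n.size := Nat.size_pos.2 (by omega)
      have h2 : 2 ^ (n.size - 1) ≤ n := Nat.lt_size.1 (by omega)
      calc 2 ^ n.size = 2 ^ (n.size - 1) * 2 := by rw [← pow_succ]; congr 1; omega
        _ ≤ n * n := Nat.mul_le_mul h2 hn
        _ = n ^ 2 := (sq n).symm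
    calc 2 ^ (α + β * n.size) = 2 ^ α * (2 ^ n.size) ^ β := by
          rw [pow_add, mul_comm β, pow_mul]
      _ ≤ n ^ α * (n ^ 2) ^ β :=
          Nat.mul_le_mul (Nat.pow_le_pow_left hn α) (Nat.pow_le_pow_left h1 β)
      _ = n ^ (α + 2 * β) := by rw [← pow_mul, ← pow_add]
      _ ≤ n ^ (α + 2 * β + 2 ^ (α + β)) := Nat.pow_le_pow_right (by omega) (Nat.le_add_right _ _)
      _ ≤ _ := Nat.le_add_right _ _

/-- The bound of the quantifiers. -/
def quantBound (D n : ℕ) : ℕ := 2 ^ (D * (n.size + 1))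

variable {k : ℕ} {R : Type} {D : ℕ} {S : R → ℕ → ℕ → ℕ → Prop} {m : ℕ}

/-- A relation between `m` numbers, which depends on `n` and on the input, is defined by a formula
that does not depend on `n`. -/
def Definable (D : ℕ) (S : R → ℕ → ℕ → ℕ → Prop)
    (P : ℕ → (Fin k → ℕ) → (Fin m → ℕ) → Prop) : Prop :=
  ∀ w : Fin m → ℕ, ∃ φ : Form k (R ⊕ (Ordering → Bool → Bool)), ∀ n x ρ, (∀ i, x i < 2 ^ n) →
    (∀ v, ρ v < quantBound D n) →
    (φ.Holds (quantBound D n) (fun r => Form.withCompare S r n) x ρ ↔ P n x fun i => ρ (w i))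

/-- A function with definable digits is in `FAC⁰`. -/
theorem FAC0_of_definable [Finite R] (hD : 0 < D) (hS : ∀ r, LogDecidable D (S r))
    {P : ℕ → (Fin k → ℕ) → (Fin 1 → ℕ) → Prop} (hP : Definable D S P) {f : (Fin k → ℕ) → ℕ}
    (hf : ∀ n x, (∀ i, x i < 2 ^ n) → ∀ j,
      (f x).testBit j = true ↔ j < quantBound D n ∧ P n x fun _ => j) : FAC0 f := by
  -- Variable `0` is the one that the output nodes set to the index of the digit.
  obtain ⟨φ, hφ⟩ := hP fun _ => 0
  obtain ⟨V, hV0, hV⟩ := φ.exists_varsLt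
  have hτ : φ.subs.length < 2 ^ φ.subs.length := Nat.lt_two_pow_self
  have hS' : ∀ r, LogDecidable D (Form.withCompare S r) := by
    rintro (r | q)
    · exact hS r
    · exact logDecidable_compare D q
  refine ⟨fun n => φ.circuit φ.subs.length V (D * (n.size + 1)) n
    (fun r => Form.withCompare S r n) hτ, ?_, ⟨φ.rank, fun n => Form.depth_circuit_le n hτ⟩,
    Form.exists_machine_circuit hD hS' hV0 hτ hV, fun n x hx => ?_⟩
  -- There are `2 ^ (τ + L * V)` nodes and `2 ^ L` outputs, where `L = D * (n.size + 1)`; the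
  -- summand `1` in the exponent pays for adding the two powers.
  · obtain ⟨c, hc⟩ := exists_two_pow_size_le (φ.subs.length + D * V + D + 1) (D * V + D)
    refine ⟨c, fun n => le_trans ?_ (hc n)⟩
    have h1 : φ.subs.length + D * V + D + 1 + (D * V + D) * n.size =
        (φ.subs.length + D * (n.size + 1) * V + D * (n.size + 1)) + 1 := by ring
    rw [h1, pow_succ, mul_two]
    exact Nat.add_le_add (Nat.pow_le_pow_right two_pos (by omega))
      (Nat.pow_le_pow_right two_pos (by omega))
  · apply Nat.eq_of_testBit_eq
    intro j
    rw [Bool.eq_iff_iff, Form.testBit_value_circuit hτ hV x hx, hf n x hx]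
    refine and_congr_right fun hj => ?_
    refine (hφ n x (fun v => if v = 0 then j else 0) hx fun v => ?_).trans (Eq.to_iff rfl)
    split_ifs
    · exact hj
    · exact Nat.two_pow_pos _

/-! ### Closure properties of definable relations -/

namespace Definable

theorem congr {P Q : ℕ → (Fin k → ℕ) → (Fin m → ℕ) → Prop} (hP : Definable D S P)
    (h : ∀ n x v, (∀ i, x i < 2 ^ n) → (∀ i, v i < quantBound D n) → (P n x v ↔ Q n x v)) :
    Definable D S Q := by
  intro w
  obtain ⟨φ, hφ⟩ := hP w
  exact ⟨φ, fun n x ρ hx hρ => (hφ n x ρ hx hρ).trans (h n x _ hx fun i => hρ _)⟩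

/-- Definability asks for a formula for every choice of variable names, so substitution of variables
is merely another choice. -/
theorem comp {l : ℕ} {P : ℕ → (Fin k → ℕ) → (Fin l → ℕ) → Prop} (hP : Definable D S P)
    (s : Fin l → Fin m) : Definable D S fun n x (v : Fin m → ℕ) => P n x fun i => v (s i) :=
  fun w => hP fun i => w (s i)

theorem rel (r : R) (i j : Fin m) :
    Definable (k := k) D S fun n _ (v : Fin m → ℕ) => S r n (v i) (v j) :=
  fun w => ⟨.rel (.inl r) (w i) (w j), fun _ _ _ _ _ => Iff.rfl⟩

theorem compare (q : Ordering → Bool → Bool) (i j : Fin m) :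
    Definable (k := k) D S fun n _ (v : Fin m → ℕ) =>
      q (Ord.compare (v i) (v j)) (decide (v i < n)) = true :=
  fun w => ⟨.rel (.inr q) (w i) (w j), fun _ _ _ _ _ => Iff.rfl⟩

theorem input (a : Fin k) (i : Fin m) :
    Definable D S fun _ (x : Fin k → ℕ) (v : Fin m → ℕ) => (x a).testBit (v i) = true :=
  fun w => ⟨.inp a (w i), fun _ _ _ _ _ => Iff.rfl⟩

variable {P Q : ℕ → (Fin k → ℕ) → (Fin m → ℕ) → Prop}

theorem not (hP : Definable D S P) : Definable D S fun n x v => ¬ P n x v := by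
  intro w
  obtain ⟨φ, hφ⟩ := hP w
  exact ⟨.neg φ, fun n x ρ hx hρ => not_congr (hφ n x ρ hx hρ)⟩

theorem and (hP : Definable D S P) (hQ : Definable D S Q) :
    Definable D S fun n x v => P n x v ∧ Q n x v := by
  intro w
  obtain ⟨φ, hφ⟩ := hP w
  obtain ⟨ψ, hψ⟩ := hQ w
  exact ⟨.and φ ψ, fun n x ρ hx hρ => and_congr (hφ n x ρ hx hρ) (hψ n x ρ hx hρ)⟩

theorem or (hP : Definable D S P) (hQ : Definable D S Q) :
    Definable D S fun n x v => P n x v ∨ Q n x v :=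
  (hP.not.and hQ.not).not.congr fun n x v _ _ => by tauto

theorem imp (hP : Definable D S P) (hQ : Definable D S Q) :
    Definable D S fun n x v => P n x v → Q n x v :=
  (hP.and hQ.not).not.congr fun n x v _ _ => by tauto

theorem iff (hP : Definable D S P) (hQ : Definable D S Q) :
    Definable D S fun n x v => P n x v ↔ Q n x v :=
  ((hP.imp hQ).and (hQ.imp hP)).congr fun n x v _ _ => by tauto

theorem ex {Q : ℕ → (Fin k → ℕ) → (Fin m → ℕ) → ℕ → Prop}
    (hQ : Definable D S fun n x (v : Fin (m + 1) → ℕ) => Q n x (Fin.tail v) (v 0)) :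
    Definable D S fun n x v => ∃ u < quantBound D n, Q n x v u := by
  intro w
  -- A fresh variable for the quantifier, beyond all names in use, so that nothing is captured.
  obtain ⟨z, hz⟩ : ∃ z, ∀ i, w i < z := by
    obtain ⟨z, hz⟩ := (Set.finite_range w).bddAbove
    exact ⟨z + 1, fun i => Nat.lt_succ_of_le (hz ⟨i, rfl⟩)⟩
  obtain ⟨φ, hφ⟩ := hQ (Fin.cons z w)
  refine ⟨.ex z φ, fun n x ρ hx hρ => exists_congr fun u => and_congr_right fun hu => ?_⟩
  rw [hφ n x (Function.update ρ z u) hx ?_]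
  · have h0 : Function.update ρ z u ((Fin.cons z w : Fin (m + 1) → ℕ) 0) = u := by simp
    have h1 : (Fin.tail fun i => Function.update ρ z u ((Fin.cons z w : Fin (m + 1) → ℕ) i)) =
        fun i => ρ (w i) := by
      funext i
      simp [Fin.tail, Function.update_of_ne (hz i).ne]
    dsimp only
    rw [h0, h1]
  · intro v
    by_cases hv : v = z
    · subst hv; simpa using hu
    · rw [Function.update_of_ne hv]; exact hρ v

theorem all {Q : ℕ → (Fin k → ℕ) → (Fin m → ℕ) → ℕ → Prop}
    (hQ : Definable D S fun n x (v : Fin (m + 1) → ℕ) => Q n x (Fin.tail v) (v 0)) :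
    Definable D S fun n x v => ∀ u < quantBound D n, Q n x v u :=
  (ex (Q := fun n x v u => ¬ Q n x v u) hQ.not).not.congr fun n x v _ _ => by
    push Not
    rfl

theorem const (c : Prop) : Definable D S fun (_ : ℕ) (_ : Fin k → ℕ) (_ : Fin m → ℕ) => c := by
  classical
  -- Atoms need a variable and `m` may be `0`, so a dummy quantifier supplies one.
  have h : Definable D S fun (n : ℕ) (_ : Fin k → ℕ) (v : Fin m → ℕ) => ∃ u < quantBound D n, c :=
    ex ((compare (fun _ _ => decide c) 0 0).congr fun _ _ _ _ _ => by simp)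
  exact h.congr fun n x v _ _ => ⟨fun ⟨_, _, h⟩ => h, fun h => ⟨0, Nat.two_pow_pos _, h⟩⟩

theorem exists_fin {l : ℕ} {P : Fin l → ℕ → (Fin k → ℕ) → (Fin m → ℕ) → Prop}
    (hP : ∀ i, Definable D S (P i)) : Definable D S fun n x v => ∃ i, P i n x v := by
  induction l with
  | zero => exact (const False).congr fun n x v _ _ => by simp
  | succ l ih =>
    exact ((hP 0).or (ih fun i => hP i.succ)).congr fun n x v _ _ =>
      (Fin.exists_fin_succ (P := fun i => P i n x v)).symm

theorem lt (i j : Fin m) : Definable (k := k) D S fun _ _ (v : Fin m → ℕ) => v i < v j :=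
  (compare (fun o _ => o == .lt) i j).congr fun n x v _ _ => by simp [Nat.compare_eq_lt]

theorem lt_length (i : Fin m) : Definable (k := k) D S fun n _ (v : Fin m → ℕ) => v i < n :=
  (compare (fun _ c => c) i i).congr fun n x v _ _ => by simp

theorem app {P : ℕ → (Fin k → ℕ) → ℕ → ℕ → Prop}
    (hP : Definable D S fun n x (v : Fin 2 → ℕ) => P n x (v 0) (v 1)) (i j : Fin m) :
    Definable D S fun n x (v : Fin m → ℕ) => P n x (v i) (v j) :=
  hP.comp ![i, j]

end Definable

/-! Values of circuits are definable -/

section CircuitValue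

variable {l : ℕ} (D)

/-- The values of the nodes of height less than `t` of the circuit `C n`, with the input
`inp i n x u`. -/
def nodeVal (C : ∀ n, Circuit l n) (inp : Fin l → ℕ → (Fin k → ℕ) → ℕ → ℕ → Prop) :
    ℕ → ℕ → (Fin k → ℕ) → ℕ → ℕ → Prop
  | 0, _, _, _, _ => False
  | t + 1, n, x, u, a =>
    ((C n).Connection .and a a ∧
      ∀ b < quantBound D n, (C n).Connection .pred a b → nodeVal C inp t n x u b) ∨
    ((C n).Connection .or a a ∧
      ∃ b < quantBound D n, (C n).Connection .pred a b ∧ nodeVal C inp t n x u b) ∨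
    ((C n).Connection .not a a ∧
      ∃ b < quantBound D n, (C n).Connection .pred a b ∧ ¬ nodeVal C inp t n x u b) ∨
    ∃ i, ∃ b < quantBound D n, (C n).Connection (.input i) a b ∧ inp i n x u b

variable {D} {C : ∀ n, Circuit l n} {inp : Fin l → ℕ → (Fin k → ℕ) → ℕ → ℕ → Prop}

/-- Predecessors have smaller height, so `t` unfoldings are enough for nodes of height below `t`.
The bounds on size and input length bring all nodes and input positions into the range of the
quantifiers. -/
theorem nodeVal_iff {n : ℕ} {x : Fin k → ℕ} {u : ℕ} {X : Fin l → ℕ}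
    (hC : (C n).size ≤ quantBound D n) (hn : n ≤ quantBound D n)
    (hX : ∀ i j, inp i n x u j ↔ (X i).testBit j = true)
    (t : ℕ) (a : Fin (C n).size) (ha : (C n).height a < t) :
    nodeVal D C inp t n x u a ↔ (C n).eval X a := by
  induction t generalizing a with
  | zero => exact absurd ha (Nat.not_lt_zero _)
  | succ t ih =>
    have hl (q : NodeLabel l n) : (∃ ha : (a : ℕ) < (C n).size, (C n).label ⟨a, ha⟩ = q) ↔
        (C n).label a = q := ⟨fun ⟨_, h⟩ => h, fun h => ⟨a.2, h⟩⟩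
    have hi (i : Fin l) (b : ℕ) : (C n).Connection (.input i) a b ↔
        ∃ hb : b < n, (C n).label a = .input i ⟨b, hb⟩ :=
      ⟨fun ⟨_, hb, h⟩ => ⟨hb, h⟩, fun ⟨hb, h⟩ => ⟨a.2, hb, h⟩⟩
    have hp (b : ℕ) : (C n).Connection .pred a b ↔
        ∃ hb : b < (C n).size, ⟨b, hb⟩ ∈ (C n).pred a :=
      ⟨fun ⟨_, hb, h⟩ => ⟨hb, h⟩, fun ⟨hb, h⟩ => ⟨a.2, hb, h⟩⟩
    have hv (b : Fin (C n).size) (hb : b ∈ (C n).pred a) :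
        nodeVal D C inp t n x u b ↔ (C n).eval X b :=
      ih b ((Circuit.height_lt_of_mem _ hb).trans_le (Nat.le_of_lt_succ ha))
    have hand : (C n).Connection .and a a ↔ (C n).label a = .and := hl _
    have hor : (C n).Connection .or a a ↔ (C n).label a = .or := hl _
    have hnot : (C n).Connection .not a a ↔ (C n).label a = .not := hl _
    simp only [nodeVal, hand, hor, hnot, hi, hp]
    cases hq : (C n).label a with
    | and =>
      rw [Circuit.eval_and _ X hq]
      simp only [true_and, reduceCtorEq, false_and, exists_false, and_false, or_false]
      exact ⟨fun h b hb => (hv b hb).1 (h b (b.2.trans_le hC) ⟨b.2, hb⟩),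
        fun h b _ ⟨hb, hm⟩ => (hv ⟨b, hb⟩ hm).2 (h _ hm)⟩
    | or =>
      rw [Circuit.eval_or _ X hq]
      simp only [true_and, reduceCtorEq, false_and, exists_false, and_false, or_false, false_or]
      exact ⟨fun ⟨b, _, ⟨hb, hm⟩, h⟩ => ⟨⟨b, hb⟩, hm, (hv ⟨b, hb⟩ hm).1 h⟩,
        fun ⟨b, hm, h⟩ => ⟨b, b.2.trans_le hC, ⟨b.2, hm⟩, (hv b hm).2 h⟩⟩
    | not =>
      rw [Circuit.eval_not _ X hq]
      simp only [true_and, reduceCtorEq, false_and, exists_false, and_false, or_false, false_or]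
      exact ⟨fun ⟨b, _, ⟨hb, hm⟩, h⟩ => ⟨⟨b, hb⟩, hm, fun h' => h ((hv ⟨b, hb⟩ hm).2 h')⟩,
        fun ⟨b, hm, h⟩ => ⟨b, b.2.trans_le hC, ⟨b.2, hm⟩, fun h' => h ((hv b hm).1 h')⟩⟩
    | input i j =>
      rw [Circuit.eval_input _ X hq]
      simp only [reduceCtorEq, false_and, false_or]
      constructor
      · rintro ⟨i', b, _, ⟨hb, h⟩, hin⟩
        rw [NodeLabel.input.injEq] at h
        obtain ⟨rfl, rfl⟩ := h
        exact (hX _ _).1 hin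
      · intro h
        exact ⟨i, j, j.2.trans_le hn, ⟨j.2, rfl⟩, (hX _ _).2 h⟩

/-- The number `t` of unfoldings does not depend on `n`, so a single formula works for all circuits
of the family. -/
theorem definable_nodeVal {r : Query l → R} (hr : ∀ q n, S (r q) n = (C n).Connection q)
    (hinp : ∀ i, Definable D S fun n (x : Fin k → ℕ) (v : Fin 2 → ℕ) => inp i n x (v 0) (v 1))
    (t : ℕ) :
    Definable D S fun n (x : Fin k → ℕ) (v : Fin 2 → ℕ) => nodeVal D C inp t n x (v 0) (v 1) := by
  have hconn {m : ℕ} (q : Query l) (i j : Fin m) : Definable (k := k) D S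
      fun n _ (v : Fin m → ℕ) => (C n).Connection q (v i) (v j) := by
    simpa only [hr] using Definable.rel (k := k) (D := D) (S := S) (r q) i j
  induction t with
  | zero => exact Definable.const False
  | succ t ih =>
    -- Under a quantifier the bound variable has index `0`, and the parameter `u` and the node `a`
    -- move to `1` and `2`.
    refine .or (.and (hconn .and 1 1) (.all (.imp (hconn .pred 2 0) (ih.app 1 0))))
      (.or (.and (hconn .or 1 1) (.ex (.and (hconn .pred 2 0) (ih.app 1 0))))
      (.or (.and (hconn .not 1 1) (.ex (.and (hconn .pred 2 0) (ih.app 1 0).not)))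
      (.exists_fin fun i => .ex (.and (hconn (.input i) 2 0) ((hinp i).app 1 0)))))

/-- The digits of a circuit value are definable if the digits of the input are. -/
theorem definable_value {r : Query l → R} (hr : ∀ q n, S (r q) n = (C n).Connection q)
    (hC : ∀ n, (C n).size ≤ quantBound D n) (hn : ∀ n, n ≤ quantBound D n)
    {d : ℕ} (hd : ∀ n, (C n).depth ≤ d) {X : ℕ → (Fin k → ℕ) → ℕ → Fin l → ℕ}
    (hX : ∀ i, Definable D S fun n (x : Fin k → ℕ) (v : Fin 2 → ℕ) =>
      (X n x (v 0) i).testBit (v 1) = true) :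
    Definable D S fun n (x : Fin k → ℕ) (v : Fin 2 → ℕ) =>
      ((C n).value (X n x (v 0))).testBit (v 1) = true := by
  have hval := definable_nodeVal (C := C)
    (inp := fun i n x u j => (X n x u i).testBit j = true) hr hX (d + 1)
  have hout {m : ℕ} (i j : Fin m) : Definable (k := k) D S
      fun n _ (v : Fin m → ℕ) => (C n).Connection .output (v i) (v j) := by
    simpa only [hr] using Definable.rel (k := k) (D := D) (S := S) (r .output) i j
  have h : Definable D S fun n (x : Fin k → ℕ) (v : Fin 2 → ℕ) => ∃ a < quantBound D n,
      (C n).Connection .output a (v 1) ∧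
        nodeVal D C (fun i n x u j => (X n x u i).testBit j = true) (d + 1) n x (v 0) a :=
    .ex (.and (hout 0 2) (hval.app 1 0))
  refine h.congr fun n x v _ _ => ?_
  have hv (a : Fin (C n).size) := nodeVal_iff (C := C) (n := n) (x := x) (u := v 0)
    (inp := fun i n x u j => (X n x u i).testBit j = true) (X := X n x (v 0)) (hC n) (hn n)
    (fun i j => Iff.rfl) (d + 1) a
    (Nat.lt_succ_of_le ((Finset.le_sup (f := (C n).height) (Finset.mem_univ a)).trans (hd n)))
  rw [Circuit.testBit_value]
  constructor
  · rintro ⟨a, _, ⟨hb, rfl⟩, h⟩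
    exact ⟨hb, (hv _).1 h⟩
  · rintro ⟨hb, h⟩
    exact ⟨(C n).out ⟨v 1, hb⟩, (Fin.is_lt _).trans_le (hC n), ⟨hb, rfl⟩, (hv _).2 h⟩

end CircuitValue

end Definability

section IntegerArithmetic

/-! Two's complement digits of integers -/

/-- The digit `j` of the integer `z` in two's complement is `1`. -/
def IntBit (z : ℤ) (j : ℕ) : Prop := z / 2 ^ j % 2 = 1

theorem intBit_natCast (a j : ℕ) : IntBit (a : ℤ) j ↔ a.testBit j = true := by
  rw [IntBit, Nat.testBit_eq_decide_div_mod_eq, decide_eq_true_iff]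
  norm_cast

theorem intBit_half (z : ℤ) (j : ℕ) : IntBit (z / 2) j ↔ IntBit z (j + 1) := by
  rw [IntBit, IntBit, Int.ediv_ediv_of_nonneg (by norm_num), pow_succ']

theorem neg_sub_one_ediv (z : ℤ) (j : ℕ) : (-z - 1) / 2 ^ j = -(z / 2 ^ j) - 1 := by
  have hp : (0 : ℤ) < 2 ^ j := by positivity
  have h1 := Int.emod_add_mul_ediv z (2 ^ j)
  have h2 := Int.emod_nonneg z hp.ne'
  have h3 := Int.emod_lt_of_pos z hp
  rw [Int.ediv_eq_iff_of_pos hp]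
  constructor <;> nlinarith

/-- In two's complement, `-z - 1` is the digitwise complement of `z`; division with rounding
downwards makes this exact for negative integers as well. -/
theorem intBit_not (z : ℤ) (j : ℕ) : IntBit (-z - 1) j ↔ ¬ IntBit z j := by
  unfold IntBit
  rw [neg_sub_one_ediv]
  omega

theorem emod_two_pow_succ (z : ℤ) (j : ℕ) :
    z % 2 ^ (j + 1) = z % 2 ^ j + 2 ^ j * (z / 2 ^ j % 2) := by
  have hp : (0 : ℤ) < 2 ^ j := by positivity
  rw [Int.emod_def z (2 ^ (j + 1)), Int.emod_def z (2 ^ j), Int.emod_def (z / 2 ^ j) 2, pow_succ,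
    ← Int.ediv_ediv_of_nonneg hp.le]
  ring

/-- There is a carry to the digit `j` in the sum of `a` and `b`. -/
def Carry (a b : ℤ) (j : ℕ) : Prop :=
  ∃ i < j, IntBit a i ∧ IntBit b i ∧ ∀ l, i < l → l < j → IntBit a l ∨ IntBit b l

theorem carry_succ (a b : ℤ) (j : ℕ) : Carry a b (j + 1) ↔
    (IntBit a j ∧ IntBit b j) ∨ ((IntBit a j ∨ IntBit b j) ∧ Carry a b j) := by
  constructor
  · rintro ⟨i, hi, ha, hb, h⟩
    rcases Nat.lt_succ_iff_lt_or_eq.1 hi with hi | rfl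
    · exact Or.inr ⟨h j hi (Nat.lt_succ_self j), i, hi, ha, hb,
        fun l hl hlj => h l hl (hlj.trans (Nat.lt_succ_self j))⟩
    · exact Or.inl ⟨ha, hb⟩
  · rintro (⟨ha, hb⟩ | ⟨hab, i, hi, ha, hb, h⟩)
    · exact ⟨j, Nat.lt_succ_self j, ha, hb, fun l h1 h2 => by omega⟩
    · refine ⟨i, hi.trans (Nat.lt_succ_self j), ha, hb, fun l hl hlj => ?_⟩
      rcases Nat.lt_succ_iff_lt_or_eq.1 hlj with hlj | rfl
      · exact h l hl hlj
      · exact hab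

/-- Carry lookahead: a carry is generated where both digits are `1` and is propagated while at least
one is. This replaces the recursion on the digits by a first-order condition. -/
theorem carry_iff (a b : ℤ) (j : ℕ) : Carry a b j ↔ 2 ^ j ≤ a % 2 ^ j + b % 2 ^ j := by
  induction j with
  | zero =>
    simp only [Carry, pow_zero, Int.emod_one, Nat.not_lt_zero, false_and, exists_false, false_iff]
    norm_num
  | succ j ih =>
    have hp : (0 : ℤ) < 2 ^ j := by positivity
    rw [carry_succ, ih, emod_two_pow_succ, emod_two_pow_succ b]
    unfold IntBit
    have ha := Int.emod_nonneg a hp.ne'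
    have ha' := Int.emod_lt_of_pos a hp
    have hb := Int.emod_nonneg b hp.ne'
    have hb' := Int.emod_lt_of_pos b hp
    rw [pow_succ]
    rcases Int.emod_two_eq_zero_or_one (a / 2 ^ j) with h1 | h1 <;>
      rcases Int.emod_two_eq_zero_or_one (b / 2 ^ j) with h2 | h2 <;>
      rw [h1, h2] <;> clear h1 h2 <;> generalize (2 : ℤ) ^ j = t at * <;>
      generalize a % t = r at * <;> generalize b % t = s at * <;> omega

theorem intBit_add (a b : ℤ) (j : ℕ) :
    IntBit (a + b) j ↔ (IntBit a j ↔ (IntBit b j ↔ Carry a b j)) := by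
  have hp : (0 : ℤ) < 2 ^ j := by positivity
  have h1 := Int.emod_add_mul_ediv a (2 ^ j)
  have h2 := Int.emod_add_mul_ediv b (2 ^ j)
  have ha := Int.emod_nonneg a hp.ne'
  have ha' := Int.emod_lt_of_pos a hp
  have hb := Int.emod_nonneg b hp.ne'
  have hb' := Int.emod_lt_of_pos b hp
  rw [carry_iff]
  unfold IntBit
  by_cases hc : (2 : ℤ) ^ j ≤ a % 2 ^ j + b % 2 ^ j
  · have h : (a + b) / 2 ^ j = a / 2 ^ j + b / 2 ^ j + 1 := by
      rw [Int.ediv_eq_iff_of_pos hp]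
      constructor <;> nlinarith
    simp only [h, hc, iff_true]
    omega
  · have h : (a + b) / 2 ^ j = a / 2 ^ j + b / 2 ^ j := by
      rw [Int.ediv_eq_iff_of_pos hp]
      constructor <;> nlinarith
    simp only [h, hc, iff_false]
    omega

/-- The integer `z` has at most `m` digits and a sign. -/
def InRange (z : ℤ) (m : ℕ) : Prop := -2 ^ m ≤ z ∧ z < 2 ^ m

theorem InRange.mono {z : ℤ} {m l : ℕ} (h : InRange z m) (hml : m ≤ l) : InRange z l := by
  have : (2 : ℤ) ^ m ≤ 2 ^ l := pow_le_pow_right₀ (by norm_num) hml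
  exact ⟨by linarith [h.1], by linarith [h.2]⟩

/-- Above the range all digits repeat the sign, so a single high digit decides negativity. -/
theorem InRange.intBit_iff {z : ℤ} {m j : ℕ} (h : InRange z m) (hj : m ≤ j) :
    IntBit z j ↔ z < 0 := by
  obtain ⟨h1, h2⟩ := h.mono hj
  have hp : (0 : ℤ) < 2 ^ j := by positivity
  unfold IntBit
  rcases lt_or_ge z 0 with hz | hz
  · have : z / 2 ^ j = -1 := by
      rw [Int.ediv_eq_iff_of_pos hp]
      constructor <;> linarith
    simp [this, hz]
  · rw [Int.ediv_eq_zero_of_lt hz h2]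
    simp [hz]

/-- The digit `m` has to be included: `-2 ^ m` is in range and has no nonzero digit below `m`. -/
theorem InRange.ne_zero_iff {z : ℤ} {m : ℕ} (h : InRange z m) :
    z ≠ 0 ↔ ∃ j < m + 1, IntBit z j := by
  constructor
  · intro hz
    by_contra! hn
    have hz0 : 0 ≤ z := not_lt.1 fun hlt => hn m (Nat.lt_succ_self m)
      ((h.intBit_iff le_rfl).2 hlt)
    obtain ⟨a, rfl⟩ := Int.eq_ofNat_of_zero_le hz0
    refine hz (congrArg Nat.cast (Nat.eq_of_testBit_eq (y := 0) fun j => ?_))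
    rw [Nat.zero_testBit, ← Bool.not_eq_true, ← intBit_natCast]
    rcases Nat.lt_or_ge j m with hj | hj
    · exact hn j (hj.trans (Nat.lt_succ_self m))
    · rw [h.intBit_iff hj]
      exact not_lt.2 hz0
  · rintro ⟨j, _, hj⟩ rfl
    simp [IntBit] at hj

namespace InRange

variable {a b : ℤ} {m l : ℕ}

theorem add (ha : InRange a m) (hb : InRange b m) : InRange (a + b) (m + 1) := by
  unfold InRange at *
  rw [pow_succ]
  exact ⟨by linarith [ha.1, hb.1], by linarith [ha.2, hb.2]⟩

theorem sub (ha : InRange a m) (hb : InRange b m) : InRange (a - b) (m + 1) := by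
  unfold InRange at *
  rw [pow_succ]
  exact ⟨by linarith [ha.1, hb.2], by linarith [ha.2, hb.1]⟩

theorem half (ha : InRange a m) : InRange (a / 2) m := by
  have h := ha.1
  have h' := ha.2
  have hp : (0 : ℤ) < 2 ^ m := by positivity
  constructor <;> omega

theorem of_natAbs (c : ℤ) : InRange c c.natAbs := by
  have h : c.natAbs < 2 ^ c.natAbs := Nat.lt_two_pow_self
  have h' : ((c.natAbs : ℕ) : ℤ) < 2 ^ c.natAbs := by exact_mod_cast h
  constructor <;> omega

theorem sg (z : ℤ) : InRange (sgInt z) 1 := by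
  unfold sgInt InRange
  split_ifs <;> norm_num

theorem of_nat_lt {c : ℕ} (h : c < 2 ^ m) : InRange (c : ℤ) m := by
  have h' : (c : ℤ) < 2 ^ m := by exact_mod_cast h
  have hp : (0 : ℤ) < 2 ^ m := by positivity
  exact ⟨by linarith [Int.natCast_nonneg c], h'⟩

end InRange

namespace LimitedExpr

variable {V : Type}

/-- A bound for the number of digits that the value of an expression may have in addition to those
of the variables. -/
def weight : LimitedExpr V → ℕ
  | var _ => 0
  | const c => c.natAbs
  | add P Q => P.weight + Q.weight + 1
  | sub P Q => P.weight + Q.weight + 1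
  | half P => P.weight
  | sg P => P.weight + 1

theorem inRange_eval {ρ : V → ℤ} {N : ℕ} (h : ∀ v, InRange (ρ v) N) (E : LimitedExpr V) :
    InRange (E.eval ρ) (N + E.weight) := by
  induction E with
  | var v => exact h v
  | const c => exact (InRange.of_natAbs c).mono (Nat.le_add_left _ _)
  | add P Q ihP ihQ =>
    exact ((ihP.mono (l := N + (P.weight + Q.weight)) (by omega)).add (ihQ.mono (by omega))).mono
      (Nat.le_of_eq (Nat.add_assoc ..))
  | sub P Q ihP ihQ =>
    exact ((ihP.mono (l := N + (P.weight + Q.weight)) (by omega)).sub (ihQ.mono (by omega))).mono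
      (Nat.le_of_eq (Nat.add_assoc ..))
  | half P ih => exact ih.half
  | sg P ih => exact (InRange.sg _).mono (by simp only [weight]; omega)

end LimitedExpr

/-! ### Integers with definable digits and limited expressions -/

variable {k : ℕ} {R : Type} {D : ℕ} {S : R → ℕ → ℕ → ℕ → Prop}

/-- An integer that depends on a number `u` has definable digits. -/
def DefinableInt (D : ℕ) (S : R → ℕ → ℕ → ℕ → Prop) (t : ℕ → (Fin k → ℕ) → ℕ → ℤ) : Prop :=
  Definable D S fun n x (v : Fin 2 → ℕ) => IntBit (t n x (v 0)) (v 1)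

namespace DefinableInt

variable {s t : ℕ → (Fin k → ℕ) → ℕ → ℤ}

theorem app (ht : DefinableInt D S t) {m : ℕ} (i j : Fin m) :
    Definable D S fun n x (v : Fin m → ℕ) => IntBit (t n x (v i)) (v j) :=
  Definable.app (P := fun n x u j => IntBit (t n x u) j) ht i j

theorem compl (ht : DefinableInt D S t) : DefinableInt D S fun n x u => -t n x u - 1 :=
  (Definable.not ht).congr fun _ _ _ _ _ => (intBit_not _ _).symm

theorem carry (hs : DefinableInt D S s) (ht : DefinableInt D S t) :
    Definable D S fun n x (v : Fin 2 → ℕ) => Carry (s n x (v 0)) (t n x (v 0)) (v 1) := by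
  have h : Definable D S fun n x (v : Fin 2 → ℕ) => ∃ i < quantBound D n, i < v 1 ∧
      IntBit (s n x (v 0)) i ∧ IntBit (t n x (v 0)) i ∧ ∀ l < quantBound D n, i < l ∧ l < v 1 →
        IntBit (s n x (v 0)) l ∨ IntBit (t n x (v 0)) l :=
    .ex (.and (.lt 0 2) (.and (hs.app 1 0) (.and (ht.app 1 0)
      (.all (.imp (.and (.lt 1 0) (.lt 0 3)) (.or (hs.app 2 0) (ht.app 2 0)))))))
  refine h.congr fun n x v _ hv => ?_
  constructor
  · rintro ⟨i, _, hij, hsi, hti, h⟩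
    exact ⟨i, hij, hsi, hti, fun l hl hlj => h l (hlj.trans (hv 1)) ⟨hl, hlj⟩⟩
  · rintro ⟨i, hij, hsi, hti, h⟩
    exact ⟨i, hij.trans (hv 1), hij, hsi, hti, fun l _ hl => h l hl.1 hl.2⟩

theorem add (hs : DefinableInt D S s) (ht : DefinableInt D S t) :
    DefinableInt D S fun n x u => s n x u + t n x u :=
  (Definable.iff hs (Definable.iff ht (hs.carry ht))).congr fun _ _ _ _ _ =>
    (intBit_add _ _ _).symm

/-- The complement of `(complement of s) + t` is `s - t`. -/
theorem sub (hs : DefinableInt D S s) (ht : DefinableInt D S t) :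
    DefinableInt D S fun n x u => s n x u - t n x u := by
  have h := (hs.compl.add ht).compl
  have e : (fun n x u => -(-s n x u - 1 + t n x u) - 1) = fun n x u => s n x u - t n x u := by
    funext n x u
    ring
  rwa [e] at h

theorem zero_iff : Definable (k := k) D S fun _ _ (v : Fin 2 → ℕ) => v 1 = 0 := by
  have h : Definable (k := k) D S fun n _ (v : Fin 2 → ℕ) => ∀ l < quantBound D n, ¬ l < v 1 :=
    .all (.not (.lt 0 2))
  refine h.congr fun n x v _ hv => ⟨fun h => ?_, fun h l _ => by omega⟩
  by_contra h0
  exact h 0 (Nat.two_pow_pos _) (Nat.pos_of_ne_zero h0)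

theorem intBit_one (j : ℕ) : IntBit 1 j ↔ j = 0 := by
  rw [← Nat.cast_one, intBit_natCast, Nat.testBit_one_eq_true_iff_self_eq_zero]

theorem intBit_zero (j : ℕ) : ¬ IntBit 0 j := by
  simp [IntBit]

theorem const (c : ℤ) : DefinableInt (k := k) D S fun _ _ _ => c := by
  have h0 : DefinableInt (k := k) D S fun _ _ _ => (0 : ℤ) :=
    (Definable.const False).congr fun n x v _ _ => iff_of_false id (intBit_zero _)
  have h1 : DefinableInt (k := k) D S fun _ _ _ => (1 : ℤ) :=
    zero_iff.congr fun n x v _ _ => (intBit_one _).symm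
  induction c with
  | zero => exact h0
  | succ c ih => exact ih.add h1
  | pred c ih => exact ih.sub h1

/-- Halving shifts the digits by one position. The successor of a position is defined through the
order; the largest position has none below the bound, and there the sign digit is repeated. -/
theorem half (ht : DefinableInt D S t) (hr : ∀ n x u, (∀ i, x i < 2 ^ n) → u < quantBound D n →
    InRange (t n x u) (quantBound D n - 1)) : DefinableInt D S fun n x u => t n x u / 2 := by
  have h : Definable D S fun n x (v : Fin 2 → ℕ) =>
      (∃ m < quantBound D n, v 1 < m ∧ (∀ l < quantBound D n, ¬ (v 1 < l ∧ l < m)) ∧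
        IntBit (t n x (v 0)) m) ∨
      ((∀ m < quantBound D n, ¬ v 1 < m) ∧ IntBit (t n x (v 0)) (v 1)) :=
    .or (.ex (.and (.lt 2 0) (.and (.all (.not (.and (.lt 3 0) (.lt 0 1)))) (ht.app 1 0))))
      (.and (.all (.not (.lt 2 0))) (ht.app 0 1))
  refine h.congr fun n x v hx hv => ?_
  rw [intBit_half]
  have hv1 := hv 1
  rcases Nat.lt_or_ge (v 1 + 1) (quantBound D n) with hj | hj
  · constructor
    · rintro (⟨m, hm, h1, h2, h3⟩ | ⟨h, -⟩)
      · have : m = v 1 + 1 := by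
          have := h2 (v 1 + 1) hj
          omega
        rwa [this] at h3
      · exact absurd (Nat.lt_succ_self _) (h _ hj)
    · intro h
      exact Or.inl ⟨v 1 + 1, hj, Nat.lt_succ_self _, fun l _ => by omega, h⟩
  · have hr := hr n x (v 0) hx (hv 0)
    rw [hr.intBit_iff (by omega), hr.intBit_iff (by omega)]
    constructor
    · rintro (⟨m, hm, h1, -⟩ | ⟨-, h⟩)
      · omega
      · exact h
    · exact fun h => Or.inr ⟨fun m hm => by omega, h⟩

theorem intBit_sgInt (z : ℤ) (j : ℕ) : IntBit (sgInt z) j ↔ j = 0 ∧ 0 < z := by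
  unfold sgInt
  split_ifs with h
  · rw [intBit_one]; simp [h]
  · simp [h, intBit_zero]

/-- An integer is positive if it has a nonzero digit and its sign digit, here the one at the largest
position below the bound, is `0`. -/
theorem sg (ht : DefinableInt D S t) (hr : ∀ n x u, (∀ i, x i < 2 ^ n) → u < quantBound D n →
    InRange (t n x u) (quantBound D n - 1)) : DefinableInt D S fun n x u => sgInt (t n x u) := by
  have h : Definable D S fun n x (v : Fin 2 → ℕ) => v 1 = 0 ∧
      (∃ j < quantBound D n, IntBit (t n x (v 0)) j) ∧
      ∀ m < quantBound D n, (∀ l < quantBound D n, ¬ m < l) → ¬ IntBit (t n x (v 0)) m :=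
    .and zero_iff (.and (.ex (ht.app 1 0))
      (.all (.imp (.all (.not (.lt 1 0))) (ht.app 1 0).not)))
  refine h.congr fun n x v hx hv => ?_
  have hB : 0 < quantBound D n := Nat.two_pow_pos _
  have hr := hr n x (v 0) hx (hv 0)
  rw [intBit_sgInt]
  refine and_congr_right fun _ => ?_
  have h1 : (∃ j < quantBound D n, IntBit (t n x (v 0)) j) ↔ t n x (v 0) ≠ 0 := by
    rw [hr.ne_zero_iff, Nat.sub_add_cancel hB]
  rw [h1]
  constructor
  · rintro ⟨h0, h⟩
    have := h (quantBound D n - 1) (by omega) (fun l hl => by omega)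
    rw [hr.intBit_iff le_rfl] at this
    omega
  · intro h
    refine ⟨h.ne', fun m hm hmax => ?_⟩
    have : m = quantBound D n - 1 := by
      have := hmax (quantBound D n - 1) (by omega)
      omega
    rw [this, hr.intBit_iff le_rfl]
    omega

/-- Limited `sg`-polynomial expressions in definable integers are definable. -/
theorem eval {V : Type} {ρ : ℕ → (Fin k → ℕ) → ℕ → V → ℤ} {N : ℕ → ℕ}
    (hρ : ∀ v, DefinableInt D S fun n x u => ρ n x u v)
    (hN : ∀ n x u, (∀ i, x i < 2 ^ n) → u < quantBound D n → ∀ v, InRange (ρ n x u v) (N n))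
    (E : LimitedExpr V) (hE : ∀ n, N n + E.weight < quantBound D n) :
    DefinableInt D S fun n x u => E.eval (ρ n x u) := by
  induction E with
  | var v => exact hρ v
  | const c => exact const c
  | add P Q ihP ihQ =>
    exact (ihP fun n => lt_of_le_of_lt (by simp only [LimitedExpr.weight]; omega) (hE n)).add
      (ihQ fun n => lt_of_le_of_lt (by simp only [LimitedExpr.weight]; omega) (hE n))
  | sub P Q ihP ihQ =>
    exact (ihP fun n => lt_of_le_of_lt (by simp only [LimitedExpr.weight]; omega) (hE n)).sub
      (ihQ fun n => lt_of_le_of_lt (by simp only [LimitedExpr.weight]; omega) (hE n))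
  | half P ih =>
    exact (ih hE).half fun n x u hx hu =>
      (P.inRange_eval (hN n x u hx hu)).mono (Nat.le_sub_one_of_lt (hE n))
  | sg P ih =>
    have hP : ∀ n, N n + P.weight < quantBound D n := fun n =>
      lt_of_le_of_lt (by simp only [LimitedExpr.weight]; omega) (hE n)
    exact (ih hP).sg fun n x u hx hu =>
      (P.inRange_eval (hN n x u hx hu)).mono (Nat.le_sub_one_of_lt (hP n))

end DefinableInt

end IntegerArithmetic

/-! The solution of the schema -/

/-- The length grows only when `x + 1` is a power of two, so the derivative along `ℓ` acts only at
the points `2 ^ u - 1`. -/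
theorem size_succ (x : ℕ) :
    (x + 1).size = x.size ∨ (x + 1).size = x.size + 1 ∧ x = 2 ^ x.size - 1 := by
  have h1 : x < 2 ^ x.size := Nat.lt_size_self x
  rcases Nat.lt_or_ge (x + 1) (2 ^ x.size) with h | h
  · exact Or.inl (le_antisymm (Nat.size_le.2 h) (Nat.size_le_size (Nat.le_succ x)))
  · have h2 : x + 1 = 2 ^ x.size := le_antisymm h1 h
    exact Or.inr ⟨by rw [h2, Nat.size_pow], by omega⟩

section Schema

variable {p : ℕ} (g : (Fin p → ℕ) → ℕ) (h : (Fin (p + 1) → ℕ) → ℕ) (K : LimitedExpr (SchemaVar p))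

theorem existsUnique_schemaSolution : ∃! F : ℕ → (Fin p → ℕ) → ℤ, SchemaSolution g h K F := by
  refine ⟨fun x y => Nat.rec (g y : ℤ) (fun x z => z + (((x + 1).size : ℤ) - (x.size : ℤ)) *
    ((schemaValue K h x y z - 1) * z)) x, ⟨fun y => rfl, fun x y => rfl⟩, ?_⟩
  rintro F ⟨h0, hs⟩
  funext x y
  induction x with
  | zero => exact h0 y
  | succ x ih => rw [hs, ih]

/-- The search for a zero of `K` at the numbers `2 ^ u - 1`. -/
def HasZero (x : ℕ) (y : Fin p → ℕ) : Prop :=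
  ∃ u < x.size, schemaValue K h (2 ^ u - 1) y (g y) = 0

variable {g h K}

theorem hasZero_succ {x : ℕ} {y : Fin p → ℕ} (hx : (x + 1).size = x.size + 1)
    (hx' : x = 2 ^ x.size - 1) :
    HasZero g h K (x + 1) y ↔ HasZero g h K x y ∨ schemaValue K h x y (g y) = 0 := by
  unfold HasZero
  rw [hx]
  constructor
  · rintro ⟨u, hu, h0⟩
    rcases Nat.lt_succ_iff_lt_or_eq.1 hu with hu | rfl
    · exact Or.inl ⟨u, hu, h0⟩
    · exact Or.inr (by rwa [← hx'] at h0)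
  · rintro (⟨u, hu, h0⟩ | h0)
    · exact ⟨u, hu.trans (Nat.lt_succ_self _), h0⟩
    · exact ⟨x.size, Nat.lt_succ_self _, by rwa [← hx']⟩

/-- As long as no zero has occurred, the solution equals `g(y)`, so `K` may be evaluated at `g(y)`.
After a zero the solution is `0` and the later factors do not matter. -/
theorem SchemaSolution.eq_search {F : ℕ → (Fin p → ℕ) → ℤ} (hF : SchemaSolution g h K F)
    (h01 : ∀ x y, schemaValue K h x y (F x y) = 0 ∨ schemaValue K h x y (F x y) = 1)
    (x : ℕ) (y : Fin p → ℕ) :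
    (HasZero g h K x y → F x y = 0) ∧ (¬ HasZero g h K x y → F x y = g y) := by
  induction x with
  | zero =>
    exact ⟨fun ⟨u, hu, _⟩ => absurd hu (by simp), fun _ => hF.1 y⟩
  | succ x ih =>
    have hs := hF.2 x y
    rcases size_succ x with hx | ⟨hx, hx'⟩
    · have hz : HasZero g h K (x + 1) y ↔ HasZero g h K x y := by unfold HasZero; rw [hx]
      rw [hs, hx, sub_self, zero_mul, add_zero, hz]
      exact ih
    -- Where the length grows, `F + (K - 1) * F = K * F`.
    · have hs' : F (x + 1) y = schemaValue K h x y (F x y) * F x y := by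
        rw [hs, hx]
        push_cast
        ring
      rw [hasZero_succ hx hx', hs']
      by_cases hz : HasZero g h K x y
      · simp [hz, ih.1 hz]
      · have hg := ih.2 hz
        have h01 := h01 x y
        rw [hg] at h01 ⊢
        rcases h01 with h0 | h1
        · simp [h0]
        · simp [h1, hz]

end Schema

/-! The solution has definable digits -/

theorem pow_add_lt_quantBound {c D : ℕ} (hD : c + 1 ≤ D) (n : ℕ) : n ^ c + c < quantBound D n := by
  have h1 : n ^ c ≤ 2 ^ (c * n.size) := by
    rw [mul_comm, pow_mul]
    exact Nat.pow_le_pow_left (Nat.lt_size_self n).le c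
  have h2 : n ^ c ≤ 2 ^ (c * (n.size + 1)) :=
    h1.trans (Nat.pow_le_pow_right two_pos (Nat.mul_le_mul_left c (Nat.le_succ _)))
  have h3 : c < 2 ^ (c * (n.size + 1)) :=
    Nat.lt_two_pow_self.trans_le (Nat.pow_le_pow_right two_pos
      (Nat.le_mul_of_pos_right c n.size.succ_pos))
  calc n ^ c + c < 2 ^ (c * (n.size + 1) + 1) := by rw [pow_succ]; omega
    _ ≤ quantBound D n := Nat.pow_le_pow_right two_pos (by nlinarith [n.size.zero_le])

theorem BoolCircuit.Circuit.value_lt {k n : ℕ} (C : Circuit k n) (x : Fin k → ℕ) :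
    C.value x < 2 ^ C.numOut := by
  refine Nat.lt_pow_two_of_testBit _ fun j hj => ?_
  rw [← Bool.not_eq_true, Circuit.testBit_value]
  rintro ⟨h, -⟩
  omega

/-- The number `2 ^ u - 1`, provided it has at most `n` digits. -/
def searchPoint (n u : ℕ) : ℕ := if u < n then 2 ^ u - 1 else 0

theorem searchPoint_lt (n u : ℕ) : searchPoint n u < 2 ^ n := by
  unfold searchPoint
  split_ifs with hu
  · have h1 : 2 ^ u ≤ 2 ^ n := Nat.pow_le_pow_right two_pos hu.le
    have h2 := Nat.two_pow_pos u
    omega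
  · exact Nat.two_pow_pos n

/-- The digits of `2 ^ u - 1` are given by comparisons alone, so the point enters the circuit for
`h` as a definable input. The cutoff keeps it below `2 ^ n` for every `u` in the range of the
quantifiers. -/
theorem testBit_searchPoint (n u j : ℕ) :
    (searchPoint n u).testBit j = true ↔ j < u ∧ u < n := by
  unfold searchPoint
  split_ifs with hu <;> simp [hu, Nat.testBit_two_pow_sub_one]

section Search

variable {p : ℕ} {g : (Fin p → ℕ) → ℕ} {h : (Fin (p + 1) → ℕ) → ℕ}

open Classical in
/-- The result of the bounded search. -/
noncomputable def searchValue (g : (Fin p → ℕ) → ℕ) (h : (Fin (p + 1) → ℕ) → ℕ)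
    (K : LimitedExpr (SchemaVar p)) (x : Fin (p + 1) → ℕ) : ℕ :=
  if HasZero g h K (x 0) (Fin.tail x) then 0 else g (Fin.tail x)

/-- The values of the variables of the schema at the point `2 ^ u - 1`. -/
def searchAssign (g : (Fin p → ℕ) → ℕ) (h : (Fin (p + 1) → ℕ) → ℕ) (n : ℕ) (x : Fin (p + 1) → ℕ)
    (u : ℕ) : SchemaVar p → ℕ
  | .x => searchPoint n u
  | .y i => x i.succ
  | .h => h (Fin.cons (searchPoint n u) (Fin.tail x))
  | .f => g (Fin.tail x)

theorem eval_searchAssign (K : LimitedExpr (SchemaVar p)) (n : ℕ) (x : Fin (p + 1) → ℕ) (u : ℕ) :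
    (K.eval fun v => (searchAssign g h n x u v : ℤ)) =
      schemaValue K h (searchPoint n u) (Fin.tail x) (g (Fin.tail x)) := by
  unfold schemaValue
  congr 1
  funext v
  cases v <;> rfl

/-- Expresses the bound of the search by the digits of the input. -/
theorem lt_size_iff (a u : ℕ) : u < a.size ↔ ∃ i, u ≤ i ∧ a.testBit i = true := by
  constructor
  · intro hu
    obtain ⟨i, hi, hb⟩ := Nat.exists_ge_and_testBit_of_ge_two_pow (Nat.lt_size.1 hu)
    exact ⟨i, hi, hb⟩
  · rintro ⟨i, hi, hb⟩
    exact Nat.lt_size.2 ((Nat.pow_le_pow_right two_pos hi).trans (Nat.ge_two_pow_of_testBit hb))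

theorem FAC0_searchValue (hg : FAC0 g) (hh : FAC0 h) (K : LimitedExpr (SchemaVar p)) :
    FAC0 (searchValue g h K) := by
  obtain ⟨Cg, ⟨cg, hcg⟩, ⟨dg, hdg⟩, ⟨Mg, tg, hMg⟩, hvg⟩ := hg
  obtain ⟨Ch, ⟨ch, hch⟩, ⟨dh, hdh⟩, ⟨Mh, th, hMh⟩, hvh⟩ := hh
  -- The numerical relations of the formulas are the direct connection languages of the circuits for
  -- `g` and `h`.
  set S : Query p ⊕ Query (p + 1) → ℕ → ℕ → ℕ → Prop :=
    Sum.elim (fun q n => (Cg n).Connection q) (fun q n => (Ch n).Connection q) with hS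
  -- `N n` bounds the number of digits of every variable of the schema. `D₀` makes the bound
  -- `quantBound D₀ n` exceed each of the four summands of `N n + K.weight`, and the further `2` in
  -- `D` contributes a factor of at least `4` for their sum.
  set N : ℕ → ℕ := fun n => n + (n ^ cg + cg) + (n ^ ch + ch) with hN
  set D₀ := cg + ch + K.weight + 2 with hD₀
  set D := D₀ + 2 with hD
  have hlog : ∀ r, LogDecidable D (S r) := by
    rintro (q | q)
    · exact ⟨_, Mg, q, tg, fun n a b _ => hMg n q a b⟩
    · exact ⟨_, Mh, q, th, fun n a b _ => hMh n q a b⟩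
  have hB : ∀ n, N n + K.weight < quantBound D n := by
    intro n
    have h1 := pow_add_lt_quantBound (c := 1) (D := D₀) (by omega) n
    have h2 := pow_add_lt_quantBound (c := cg) (D := D₀) (by omega) n
    have h3 := pow_add_lt_quantBound (c := ch) (D := D₀) (by omega) n
    have h4 := pow_add_lt_quantBound (c := K.weight) (D := D₀) (by omega) n
    have h5 : 4 * quantBound D₀ n ≤ quantBound D n := by
      unfold quantBound
      rw [hD, show 4 = 2 ^ 2 from rfl, ← pow_add]
      exact Nat.pow_le_pow_right two_pos (by nlinarith [n.size.zero_le])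
    rw [pow_one] at h1
    simp only [hN]
    omega
  have hBg : ∀ n, (Cg n).size + (Cg n).numOut ≤ N n := fun n =>
    (hcg n).trans (by simp only [hN]; omega)
  have hBh : ∀ n, (Ch n).size + (Ch n).numOut ≤ N n := fun n =>
    (hch n).trans (by simp only [hN]; omega)
  have hNn : ∀ n, n ≤ N n := fun n => by simp only [hN]; omega
  have hBn : ∀ n, N n ≤ quantBound D n := fun n => (Nat.le_add_right _ _).trans (hB n).le
  have htail : ∀ {n : ℕ} {x : Fin (p + 1) → ℕ}, (∀ i, x i < 2 ^ n) → ∀ i, Fin.tail x i < 2 ^ n :=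
    fun hx i => hx i.succ
  have hcons : ∀ {n : ℕ} {x : Fin (p + 1) → ℕ} (u : ℕ), (∀ i, x i < 2 ^ n) →
      ∀ i, (Fin.cons (searchPoint n u) (Fin.tail x) : Fin (p + 1) → ℕ) i < 2 ^ n := by
    intro n x u hx i
    refine Fin.cases ?_ (fun i => ?_) i
    · exact searchPoint_lt n u
    · exact hx i.succ
  have hpoint : Definable D S fun n (_ : Fin (p + 1) → ℕ) (v : Fin 2 → ℕ) =>
      (searchPoint n (v 0)).testBit (v 1) = true :=
    ((Definable.lt 1 0).and (.lt_length 0)).congr fun n x v _ _ => (testBit_searchPoint _ _ _).symm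
  have hdefg : Definable D S fun n (x : Fin (p + 1) → ℕ) (v : Fin 2 → ℕ) =>
      (g (Fin.tail x)).testBit (v 1) = true :=
    (definable_value (C := Cg) (r := Sum.inl) (X := fun _ x _ => Fin.tail x) (fun _ _ => rfl)
      (fun n => ((Nat.le_add_right _ _).trans (hBg n)).trans (hBn n))
      (fun n => (hNn n).trans (hBn n)) hdg fun i => Definable.input i.succ 1).congr
      fun n x v hx _ => by rw [hvg n _ (htail hx)]
  have hdefh : Definable D S fun n (x : Fin (p + 1) → ℕ) (v : Fin 2 → ℕ) =>
      (h (Fin.cons (searchPoint n (v 0)) (Fin.tail x))).testBit (v 1) = true := by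
    refine (definable_value (C := Ch) (r := Sum.inr)
      (X := fun n x u => Fin.cons (searchPoint n u) (Fin.tail x)) (fun _ _ => rfl)
      (fun n => ((Nat.le_add_right _ _).trans (hBh n)).trans (hBn n))
      (fun n => (hNn n).trans (hBn n)) hdh fun i => ?_).congr
      fun n x v hx _ => by rw [hvh n _ (hcons _ hx)]
    refine Fin.cases ?_ (fun i => ?_) i
    · exact hpoint
    · exact Definable.input i.succ 1
  have hdefv : ∀ w, DefinableInt D S fun n (x : Fin (p + 1) → ℕ) u =>
      (searchAssign g h n x u w : ℤ) := by
    intro w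
    refine Definable.congr (P := fun n x v => (searchAssign g h n x (v 0) w).testBit (v 1) = true)
      ?_ fun n x v _ _ => (intBit_natCast _ _).symm
    cases w with
    | x => exact hpoint
    | y i => exact Definable.input i.succ 1
    | h => exact hdefh
    | f => exact hdefg
  have hrange : ∀ n (x : Fin (p + 1) → ℕ) (u : ℕ), (∀ i, x i < 2 ^ n) → u < quantBound D n →
      ∀ w, InRange (searchAssign g h n x u w : ℤ) (N n) := by
    intro n x u hx _ w
    refine InRange.of_nat_lt ?_
    cases w with
    | x => exact (searchPoint_lt n u).trans_le (Nat.pow_le_pow_right two_pos (hNn n))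
    | y i => exact (hx i.succ).trans_le (Nat.pow_le_pow_right two_pos (hNn n))
    | h =>
      change h _ < _
      rw [← hvh n _ (hcons u hx)]
      exact ((Ch n).value_lt _).trans_le (Nat.pow_le_pow_right two_pos
        ((Nat.le_add_left _ _).trans (hBh n)))
    | f =>
      change g _ < _
      rw [← hvg n _ (htail hx)]
      exact ((Cg n).value_lt _).trans_le (Nat.pow_le_pow_right two_pos
        ((Nat.le_add_left _ _).trans (hBg n)))
  have hdefK := DefinableInt.eval hdefv hrange K hB
  -- A digit of the result is a digit of `g` unless the search succeeds: `u < ℓ(x)` because some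
  -- digit `i ≥ u` of `x` is `1`, and `K` is `0` because none of its digits is `1`.
  have hdef : Definable D S fun n (x : Fin (p + 1) → ℕ) (v : Fin 1 → ℕ) =>
      (g (Fin.tail x)).testBit (v 0) = true ∧ ¬ ∃ u < quantBound D n,
        (∃ i < quantBound D n, ¬ i < u ∧ (x 0).testBit i = true) ∧ ∀ j < quantBound D n,
          ¬ IntBit (K.eval fun w => (searchAssign g h n x u w : ℤ)) j :=
    .and (hdefg.comp ![0, 0]) (.not (.ex (.and (.ex (.and (.not (.lt 0 1)) (.input 0 0)))
      (.all (hdefK.app 1 0).not))))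
  refine FAC0_of_definable (by omega) hlog hdef fun n x hx j => ?_
  have hzero : HasZero g h K (x 0) (Fin.tail x) ↔ ∃ u < quantBound D n,
        (∃ i < quantBound D n, ¬ i < u ∧ (x 0).testBit i = true) ∧ ∀ j < quantBound D n,
          ¬ IntBit (K.eval fun w => (searchAssign g h n x u w : ℤ)) j := by
    have hsize : (x 0).size ≤ n := Nat.size_le.2 (hx 0)
    have hnB : n ≤ quantBound D n := (hNn n).trans (hBn n)
    have hK : ∀ u < (x 0).size, ((∀ j < quantBound D n,
        ¬ IntBit (K.eval fun w => (searchAssign g h n x u w : ℤ)) j) ↔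
        schemaValue K h (2 ^ u - 1) (Fin.tail x) (g (Fin.tail x)) = 0) := by
      intro u hu
      have hun : u < n := hu.trans_le hsize
      have hr := (K.inRange_eval (hrange n x u hx (hun.trans_le hnB))).mono
        (Nat.le_sub_one_of_lt (hB n))
      have h0 := hr.ne_zero_iff
      have hpos : 0 < quantBound D n := Nat.two_pow_pos _
      rw [Nat.sub_add_cancel hpos] at h0
      rw [← not_iff_not]
      have hp : searchPoint n u = 2 ^ u - 1 := if_pos hun
      rw [← hp, ← eval_searchAssign, ← ne_eq, h0]
      push Not
      rfl
    constructor
    · rintro ⟨u, hu, h0⟩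
      obtain ⟨i, hi, hb⟩ := (lt_size_iff _ _).1 hu
      have hin : i < n := ((lt_size_iff _ _).2 ⟨i, le_rfl, hb⟩).trans_le hsize
      exact ⟨u, (hu.trans_le hsize).trans_le hnB, ⟨i, hin.trans_le hnB, hi.not_gt, hb⟩,
        (hK u hu).2 h0⟩
    · rintro ⟨u, _, ⟨i, _, hi, hb⟩, h0⟩
      have hu := (lt_size_iff _ _).2 ⟨i, not_lt.1 hi, hb⟩
      exact ⟨u, hu, (hK u hu).1 h0⟩
  rw [← hzero]
  unfold searchValue
  split_ifs with hz
  · simp [hz]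
  -- A nonzero digit of `g` comes from an output of its circuit, and the number of outputs is below
  -- the bound.
  · refine ⟨fun hj => ⟨?_, hj, hz⟩, fun hj => hj.2.1⟩
    have hj' := hj
    rw [← hvg n _ (htail hx), Circuit.testBit_value] at hj'
    obtain ⟨hj', -⟩ := hj'
    exact hj'.trans_le (((Nat.le_add_left _ _).trans (hBg n)).trans (hBn n))

end Search

theorem mainTheorem12 (p : ℕ) (g : (Fin p → ℕ) → ℕ) (h : (Fin (p + 1) → ℕ) → ℕ)
    (hg : FAC0 g) (hh : FAC0 h)
    (K : LimitedExpr (SchemaVar p)) (hK : K.OnlySigned SchemaVar.f) :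
    (∃! F : ℕ → (Fin p → ℕ) → ℤ, SchemaSolution g h K F) ∧
    ∀ F : ℕ → (Fin p → ℕ) → ℤ, SchemaSolution g h K F →
      (∀ x y, schemaValue K h x y (F x y) = 0 ∨ schemaValue K h x y (F x y) = 1) →
      ((∀ x y, (∃ u < x.size, schemaValue K h (2 ^ u - 1) y (g y) = 0) → F x y = 0) ∧
        (∀ x y, (¬ ∃ u < x.size, schemaValue K h (2 ^ u - 1) y (g y) = 0) → F x y = g y)) ∧
      ∃ f : (Fin (p + 1) → ℕ) → ℕ, (∀ x y, F x y = (f (Fin.cons x y) : ℤ)) ∧ FAC0 f := by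
  refine ⟨existsUnique_schemaSolution g h K, fun F hF h01 => ?_⟩
  have hs := hF.eq_search h01
  refine ⟨⟨fun x y => (hs x y).1, fun x y => (hs x y).2⟩, searchValue g h K, fun x y => ?_,
    FAC0_searchValue hg hh K⟩
  unfold searchValue
  rw [Fin.cons_zero, Fin.tail_cons]
  split_ifs with hz
  · exact (hs x y).1 hz
  · exact (hs x y).2 hz
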